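/- **Setting.** Let $M$ be a (Hausdorff, $\sigma$-compact, finite-dimensional) complex manifold. Let $\rho:\overline{T}M\to M$ be the total space of the complex conjugate of the tangent bundle of $M$, regarded as a smooth real manifold with the action of $U(1)$ by dilatations along the fibres ($u\in U(1)$ acts by multiplication by $u$ in the conjugate complex structure, i.e. by $\bar u$ in $T_mM$), and regard $M\subset\overline{T}M$ as the zero section. Let $T^*M$ be the total space of the holomorphic cotangent bundle, with the canonical holomorphic symplectic form $\Omega=d\lambda$ ($\lambda$ the tautological $1$-form) and with the action of $U(1)$ by dilatations along the fibres. A *Hodge manifold structure* on an open $U(1)$-invariant neighbourhood $U\subset\overline{T}M$ of $M$ consists of two smooth anticommuting integrable almost complex structures $I,J$ on $U$ such that each $u=e^{\sqrt{-1}\theta}\in U(1)$ satisfies $u_*Iu_*^{-1}=I$ and $u_*Ju_*^{-1}=\cos\theta\,J+\sin\theta\,IJ$. It is *polarized* by a $U(1)$-invariant Riemannian metric $h$ on $U$ if $h$ is Hermitian for $I$ and for $J$ and the forms $\omega_I=h(I\cdot,\cdot)$ and $\omega_J=h(J\cdot,\cdot)$ are closed. Put $\Omega_I=\omega_J+\sqrt{-1}\,\omega_K$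 with $K=IJ$ and $\omega_K=h(K\cdot,\cdot)$; this is a closed holomorphic $2$-form for the complex structure $I$. Write $\overline{T}M_I$ for $\overline{T}M$ (or $U$) with the complex structure $I$. *Formal* polarized Hodge manifold structures along $M$ and *formal* maps are defined in the same way, with functions and sections of bundles replaced by elements of their completions with respect to the powers of the ideal of smooth functions vanishing on $M$: all data are infinite jets along $M$ of smooth objects, all identities are identities of infinite jets along $M$, and positivity of the metric is required at the points of $M$. **Proposition.** 1. Assume given a formal polarized Hodge manifold structure on $\overline{T}M$ along $M$ such that the projection $\rho:\overline{T}M_I\to M$ is holomorphic. Then there exists a unique formal map $\kappa:\overline{T}M_I\to T^*M$ along $M$ that is holomorphic, $U(1)$-equivariant, commutes with the projections to $M$ and satisfies $\kappa^*\Omega=\Omega_I$. 2. Assume given a polarized Hodge manifold structure on an open $U(1)$-invariant neighbourhood $U\subset\overline{T}M$ of $M$ such that $\rho:U_I\to M$ is holomorphic. Then there exist a (possibly smaller) open $U(1)$-invariant neighbourhood $V\subset U$ of $M$ and a holomorphic $U(1)$-equivariant map $\kappa:V_I\to T^*M$ that commutes with the projections to $M$ and satisfies $\kappa^*\Omega=\Omega_I$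 on $V$. Any other such map on an open $U(1)$-invariant neighbourhood $V'\subset U$ of $M$ coincides with $\kappa$ on $V\cap V'$, and the infinite jet of $\kappa$ along $M$ is the unique formal map of part 1 for the formal completion of the given structure. -/

import Mathlib

open scoped Manifold ContDiff Bundle

noncomputable section

namespace HodgeCotangent

/-! ### The two total spaces -/

/-- A complex (analytic) manifold modelled on the complex vector space `E` is in particular a
real-analytic, hence smooth, manifold modelled on the real vector space underlying `E`. -/
instance isManifoldReal {E : Type*} [NormedAddCommGroup E] [NormedSpace ℂ E]
    {M : Type*} [TopologicalSpace M] [ChartedSpace E M] [IsManifold 𝓘(ℂ, E) ω M] :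
    IsManifold 𝓘(ℝ, E) ω M := by
  refine isManifold_of_contDiffOn _ _ _ fun e e' he he' => ?_
  have h := (contDiffGroupoid ω 𝓘(ℂ, E)).compatible he he'
  rw [contDiffGroupoid, mem_groupoid_of_pregroupoid] at h
  have h1 : ContDiffOn ℂ ω (𝓘(ℂ, E) ∘ (e.symm ≫ₕ e') ∘ 𝓘(ℂ, E).symm)
    (𝓘(ℂ, E).symm ⁻¹' (e.symm ≫ₕ e').source ∩ Set.range 𝓘(ℂ, E)) := h.1
  exact h1.restrict_scalars ℝ

section

variable {E : Type*} [NormedAddCommGroup E] [NormedSpace ℂ E]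
  {M : Type*} [TopologicalSpace M] [ChartedSpace E M] [IsManifold 𝓘(ℂ, E) ω M]

/-- The total space of the complex conjugate `T̄M` of the tangent bundle of the complex
manifold `M`, as a smooth real manifold. Its underlying real vector bundle is that of `TM`; the
complex conjugation enters through the dilatations, see `rotate`. -/
abbrev ConjTangent (E M : Type*) [NormedAddCommGroup E] [NormedSpace ℂ E]
    [TopologicalSpace M] [ChartedSpace E M] [IsManifold 𝓘(ℂ, E) ω M] : Type _ :=
  TangentBundle 𝓘(ℝ, E) M

/-- The total space `T^*M` of the holomorphic cotangent bundle: a point is a point `m` of `M`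
together with a `ℂ`-linear form on the tangent space of `M` at `m`. -/
abbrev Cotangent (E M : Type*) [NormedAddCommGroup E] [NormedSpace ℂ E]
    [TopologicalSpace M] [ChartedSpace E M] [IsManifold 𝓘(ℂ, E) ω M] : Type _ :=
  Bundle.TotalSpace (E →L[ℂ] ℂ)
    (fun m : M => TangentSpace 𝓘(ℂ, E) m →L[ℂ] Bundle.Trivial M ℂ m)

/-- The model of `T̄M` as a real manifold. -/
abbrev modelT (E : Type*) [NormedAddCommGroup E] [NormedSpace ℂ E] :
    ModelWithCorners ℝ (E × E) (ModelProd E E) :=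
  𝓘(ℝ, E).prod 𝓘(ℝ, E)

/-- The model of `T^*M` as a real manifold; the charts are those of the complex manifold `T^*M`. -/
abbrev modelC (E : Type*) [NormedAddCommGroup E] [NormedSpace ℂ E] :
    ModelWithCorners ℝ (E × (E →L[ℂ] ℂ)) (ModelProd E (E →L[ℂ] ℂ)) :=
  𝓘(ℝ, E).prod 𝓘(ℝ, E →L[ℂ] ℂ)

/-- The real tangent space of `T̄M` at `x`. -/
abbrev TT (x : ConjTangent E M) : Type _ := TangentSpace (modelT E) x

/-- The real tangent space of `T^*M` at `q`. -/
abbrev TC (q : Cotangent E M) : Type _ := TangentSpace (modelC E) q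

/-- The zero section `M ⊆ T̄M`. -/
def zeroSection (E M : Type*) [NormedAddCommGroup E] [NormedSpace ℂ E]
    [TopologicalSpace M] [ChartedSpace E M] [IsManifold 𝓘(ℂ, E) ω M] :
    Set (ConjTangent E M) := {x | x.2 = 0}

/-- The action of `U(1)` on `T̄M` by dilatations along the fibres. Multiplication by `u` in the
complex conjugate of a complex vector space is multiplication by `ū` in that space. -/
def rotate (u : Circle) (x : ConjTangent E M) : ConjTangent E M :=
  ⟨x.1, (starRingEnd ℂ (u : ℂ) • (show E from x.2) : E)⟩

/-- The action of `U(1)` on `T^*M` by dilatations along the fibres. -/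
def rotateCot (u : Circle) (q : Cotangent E M) : Cotangent E M :=
  ⟨q.1, ((u : ℂ) • (show E →L[ℂ] ℂ from q.2) : E →L[ℂ] ℂ)⟩

/-- Open `U(1)`-invariant neighbourhoods of the zero section. -/
structure IsInvariantNhd (U : Set (ConjTangent E M)) : Prop where
  isOpen : IsOpen U
  zero_subset : zeroSection E M ⊆ U
  rotate_mem : ∀ (u : Circle), ∀ x ∈ U, rotate u x ∈ U

/-! ### The canonical holomorphic symplectic form on the cotangent bundle -/

/-- Multiplication by `√-1` on the tangent spaces of the complex manifold `T^*M`. -/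
def mulI (q : Cotangent E M) (ξ : TC q) : TC q :=
  (Complex.I • (show E × (E →L[ℂ] ℂ) from ξ) : E × (E →L[ℂ] ℂ))

/-- The exterior derivative `dα(ξ, η)` of a complex-valued `1`-form `α` on a real manifold:
in the chart `φ` at `q`, with `a` the form `α` written in that chart, it is
`(D_ξ a)(η) - (D_η a)(ξ)`. -/
def extDerivOne {F H N : Type*} [NormedAddCommGroup F] [NormedSpace ℝ F] [TopologicalSpace H]
    (𝕀 : ModelWithCorners ℝ F H) [TopologicalSpace N] [ChartedSpace H N]
    (α : ∀ q : N, TangentSpace 𝕀 q →L[ℝ] ℂ) (q : N) (ξ η : TangentSpace 𝕀 q) : ℂ :=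
  let a : F → F →L[ℝ] ℂ := fun y =>
    (α ((extChartAt 𝕀 q).symm y)).comp (mfderiv 𝓘(ℝ, F) 𝕀 (extChartAt 𝕀 q).symm y)
  let toF : TangentSpace 𝕀 q →L[ℝ] F := mfderiv 𝕀 𝓘(ℝ, F) (extChartAt 𝕀 q) q
  fderiv ℝ a (extChartAt 𝕀 q q) (toF ξ) (toF η) - fderiv ℝ a (extChartAt 𝕀 q q) (toF η) (toF ξ)

/-- The tautological (Liouville) `1`-form on `T^*M`: `λ_q(ξ) = q(dπ(ξ))`, where `π` is the
projection to `M`. -/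
def liouville (q : Cotangent E M) : TC q →L[ℝ] ℂ :=
  ((show E →L[ℂ] ℂ from q.2).restrictScalars ℝ).comp
    (show TC q →L[ℝ] E from
      mfderiv (modelC E) 𝓘(ℝ, E) (fun q : Cotangent E M => q.proj) q)

/-- The canonical holomorphic symplectic form `Ω = dλ` on `T^*M`. -/
def canonicalForm (q : Cotangent E M) (ξ η : TC q) : ℂ :=
  extDerivOne (modelC E) (liouville (E := E) (M := M)) q ξ η

/-! ### Identities on an open neighbourhood and on the formal neighbourhood

The formal objects along `M ⊆ T̄M` (functions, sections of bundles) are the elements of the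
completions of the modules of smooth sections with respect to the powers of the ideal of smooth
functions vanishing on the zero section. By Borel's theorem every element of such a completion is
represented by a smooth section defined near the zero section, and by Taylor's formula a smooth
section represents `0` if and only if all its derivatives vanish at all points of the zero section.
Accordingly formal objects are given by smooth representatives, and an identity between formal
objects is an identity between all derivatives at the points of the zero section.

Identities between sections of bundles are tested on smooth vector fields and smooth functions. -/

/-- Whether identities are meant in the usual sense, at all points of an open set, or in the
formal neighbourhood of the zero section. -/
inductive Mode
  | actual
  | formal

/-- The points at which identities on `U` are to be checked. -/
def Mode.points (mode : Mode) (U : Set (ConjTangent E M)) : Set (ConjTangent E M) :=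
  match mode with
  | .actual => U
  | .formal => zeroSection E M

/-- The function `f` is zero at `p`; in the formal sense, all partial derivatives of `f` of all
orders (including `0`) are zero at `p`. -/
def Mode.Vanishes (mode : Mode) {G : Type*} [NormedAddCommGroup G] [NormedSpace ℝ G]
    (f : ConjTangent E M → G) (p : ConjTangent E M) : Prop :=
  match mode with
  | .actual => f p = 0
  | .formal => ∀ k : ℕ, iteratedFDeriv ℝ k (f ∘ (extChartAt (modelT E) p).symm)
      (extChartAt (modelT E) p p) = 0

/-- The vector field `ξ` along the map `φ : T̄M → N` is zero at `p`; in the formal sense,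
all the functions `dg(ξ)`, for `g` a smooth function near `φ(p)`, are formally zero at `p`. -/
def Mode.VanishesAlong (mode : Mode) {F H N : Type*} [NormedAddCommGroup F] [NormedSpace ℝ F]
    [TopologicalSpace H] (𝕀 : ModelWithCorners ℝ F H) [TopologicalSpace N] [ChartedSpace H N]
    (φ : ConjTangent E M → N) (ξ : ∀ x, TangentSpace 𝕀 (φ x)) (p : ConjTangent E M) : Prop :=
  match mode with
  | .actual => ξ p = 0
  | .formal => ∀ g : N → ℝ, ContMDiffAt 𝕀 𝓘(ℝ, ℝ) ∞ g (φ p) →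
      Mode.formal.Vanishes (fun x => (mfderiv 𝕀 𝓘(ℝ, ℝ) g (φ x) (ξ x) : ℝ)) p

/-- Two maps agree at `p`; in the formal sense, the pull-backs along them of every function `g`
that is smooth near the image of `p` have the same derivatives of all orders at `p`. -/
def Mode.Agree (mode : Mode) (κ κ' : ConjTangent E M → Cotangent E M) (p : ConjTangent E M) :
    Prop :=
  match mode with
  | .actual => κ p = κ' p
  | .formal => κ p = κ' p ∧ ∀ g : Cotangent E M → ℝ, ContMDiffAt (modelC E) 𝓘(ℝ, ℝ) ∞ g (κ p) →
      Mode.formal.Vanishes (fun x => g (κ x) - g (κ' x)) p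

/-- The vector field `V` on `T̄M` is smooth near `p`. -/
def SmoothAt (V : ∀ x : ConjTangent E M, TT x) (p : ConjTangent E M) : Prop :=
  ContMDiffAt (modelT E) (modelT E).tangent ∞
    (fun x => (⟨x, V x⟩ : TangentBundle (modelT E) (ConjTangent E M))) p

/-! ### Hodge manifold structures and polarizations -/

/-- The field `A` of endomorphisms of the tangent spaces of `T̄M` is smooth on `U`. -/
def SmoothEndOn (A : ∀ x : ConjTangent E M, TT x →L[ℝ] TT x) (U : Set (ConjTangent E M)) : Prop :=
  ContMDiffOn (modelT E) ((modelT E).prod 𝓘(ℝ, (E × E) →L[ℝ] (E × E))) ∞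
    (fun x => Bundle.TotalSpace.mk' ((E × E) →L[ℝ] (E × E))
      (E := fun x : ConjTangent E M => TT x →L[ℝ] TT x) x (A x)) U

/-- The field `h` of bilinear forms on the tangent spaces of `T̄M` is smooth on `U`. -/
def SmoothBilinOn (h : ∀ x : ConjTangent E M, TT x →L[ℝ] TT x →L[ℝ] ℝ)
    (U : Set (ConjTangent E M)) : Prop :=
  ContMDiffOn (modelT E) ((modelT E).prod 𝓘(ℝ, (E × E) →L[ℝ] (E × E) →L[ℝ] ℝ)) ∞
    (fun x => Bundle.TotalSpace.mk' ((E × E) →L[ℝ] (E × E) →L[ℝ] ℝ)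
      (E := fun x : ConjTangent E M => TT x →L[ℝ] TT x →L[ℝ] ℝ) x (h x)) U

/-- The differential of the action of `u ∈ U(1)` on `T̄M`. -/
def dRotate (u : Circle) (x : ConjTangent E M) : TT x →L[ℝ] TT (rotate u x) :=
  mfderiv (modelT E) (modelT E) (rotate u) x

/-- A (formal) equivariant quaternionic structure. An action of the algebra of quaternions on the
cotangent bundle is a pair of anticommuting operators with square `-1`; `I` and `J` are
the transposed operators on the tangent bundle, that is, the preferred and the complementary almost
complex structure. For the standard action of `U(1)` on the quaternions, induced by
conjugation by `I(ℂ^*)`, equivariance says that `u = exp(√-1 θ)` preserves `I` and carries `J`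
to `exp(θI)J = cos θ J + sin θ IJ`. -/
structure IsEquivariantQuaternionic (mode : Mode) (U : Set (ConjTangent E M))
    (I J : ∀ x : ConjTangent E M, TT x →L[ℝ] TT x) : Prop where
  smooth_I : SmoothEndOn I U
  smooth_J : SmoothEndOn J U
  I_sq : ∀ p ∈ mode.points U, ∀ V, SmoothAt V p →
    mode.VanishesAlong (modelT E) id (fun x => I x (I x (V x)) + V x) p
  J_sq : ∀ p ∈ mode.points U, ∀ V, SmoothAt V p →
    mode.VanishesAlong (modelT E) id (fun x => J x (J x (V x)) + V x) p
  anticomm : ∀ p ∈ mode.points U, ∀ V, SmoothAt V p →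
    mode.VanishesAlong (modelT E) id (fun x => I x (J x (V x)) + J x (I x (V x))) p
  equivariant_I : ∀ u : Circle, ∀ p ∈ mode.points U, ∀ V, SmoothAt V p →
    mode.VanishesAlong (modelT E) (rotate u)
      (fun x => dRotate u x (I x (V x)) - I (rotate u x) (dRotate u x (V x))) p
  equivariant_J : ∀ u : Circle, ∀ p ∈ mode.points U, ∀ V, SmoothAt V p →
    mode.VanishesAlong (modelT E) (rotate u)
      (fun x => dRotate u x (J x (V x)) -
        ((u : ℂ).re • J (rotate u x) (dRotate u x (V x)) +
          (u : ℂ).im • I (rotate u x) (J (rotate u x) (dRotate u x (V x))))) p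

/-- The Nijenhuis tensor `[AV, AW] - A[AV, W] - A[V, AW] - [V, W]` of an almost complex
structure `A`. -/
def nijenhuis (A : ∀ x : ConjTangent E M, TT x →L[ℝ] TT x) (V W : ∀ x : ConjTangent E M, TT x)
    (x : ConjTangent E M) : TT x :=
  VectorField.mlieBracket (modelT E) (fun y => A y (V y)) (fun y => A y (W y)) x -
    A x (VectorField.mlieBracket (modelT E) (fun y => A y (V y)) W x) -
    A x (VectorField.mlieBracket (modelT E) V (fun y => A y (W y)) x) -
    VectorField.mlieBracket (modelT E) V W x

/-- The (formal) integrability of an almost complex structure. -/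
def IsIntegrable (mode : Mode) (U : Set (ConjTangent E M))
    (A : ∀ x : ConjTangent E M, TT x →L[ℝ] TT x) : Prop :=
  ∀ p ∈ mode.points U, ∀ V W, SmoothAt V p → SmoothAt W p →
    mode.VanishesAlong (modelT E) id (nijenhuis A V W) p

/-- A (formal) Hodge manifold structure: an equivariant quaternionic structure such that the
preferred and the complementary almost complex structures are integrable. -/
structure IsHodge (mode : Mode) (U : Set (ConjTangent E M))
    (I J : ∀ x : ConjTangent E M, TT x →L[ℝ] TT x) : Prop
    extends IsEquivariantQuaternionic mode U I J where
  integrable_I : IsIntegrable mode U I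
  integrable_J : IsIntegrable mode U J

/-- The derivative at `x` of the function `f` along the vector field `V`. -/
def deriveAlong (V : ∀ x : ConjTangent E M, TT x) (f : ConjTangent E M → ℝ)
    (x : ConjTangent E M) : ℝ :=
  mfderiv (modelT E) 𝓘(ℝ, ℝ) f x (V x)

/-- The fundamental form `ω_A(v, w) = h(Av, w)` of an almost complex structure `A` and a
metric `h`. -/
def fundForm (h : ∀ x : ConjTangent E M, TT x →L[ℝ] TT x →L[ℝ] ℝ)
    (A : ∀ x : ConjTangent E M, TT x →L[ℝ] TT x) (x : ConjTangent E M) (v w : TT x) : ℝ :=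
  h x (A x v) w

/-- The exterior derivative `dω(V, W, Z)` of a `2`-form `ω` on `T̄M`, by Cartan's formula. -/
def extDerivTwo (η : ∀ x : ConjTangent E M, TT x → TT x → ℝ) (V W Z : ∀ x : ConjTangent E M, TT x)
    (x : ConjTangent E M) : ℝ :=
  deriveAlong V (fun y => η y (W y) (Z y)) x - deriveAlong W (fun y => η y (V y) (Z y)) x +
    deriveAlong Z (fun y => η y (V y) (W y)) x -
    η x (VectorField.mlieBracket (modelT E) V W x) (Z x) +
    η x (VectorField.mlieBracket (modelT E) V Z x) (W x) -
    η x (VectorField.mlieBracket (modelT E) W Z x) (V x)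

/-- The (formal) closedness of a `2`-form. -/
def IsClosedForm (mode : Mode) (U : Set (ConjTangent E M))
    (η : ∀ x : ConjTangent E M, TT x → TT x → ℝ) : Prop :=
  ∀ p ∈ mode.points U, ∀ V W Z, SmoothAt V p → SmoothAt W p → SmoothAt Z p →
    mode.Vanishes (extDerivTwo η V W Z) p

/-- The (formal) Riemannian metric `h` polarizes the (formal) Hodge manifold structure `(I, J)`: it
is Quaternionic-Hermitian, `U(1)`-invariant, and Kähler for both `I` and `J`. -/
structure IsPolarization (mode : Mode) (U : Set (ConjTangent E M))
    (I J : ∀ x : ConjTangent E M, TT x →L[ℝ] TT x)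
    (h : ∀ x : ConjTangent E M, TT x →L[ℝ] TT x →L[ℝ] ℝ) : Prop where
  smooth : SmoothBilinOn h U
  symm : ∀ p ∈ mode.points U, ∀ V W, SmoothAt V p → SmoothAt W p →
    mode.Vanishes (fun x => h x (V x) (W x) - h x (W x) (V x)) p
  pos : ∀ p ∈ mode.points U, ∀ v : TT p, v ≠ 0 → 0 < h p v v
  hermitian_I : ∀ p ∈ mode.points U, ∀ V W, SmoothAt V p → SmoothAt W p →
    mode.Vanishes (fun x => h x (I x (V x)) (I x (W x)) - h x (V x) (W x)) p
  hermitian_J : ∀ p ∈ mode.points U, ∀ V W, SmoothAt V p → SmoothAt W p →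
    mode.Vanishes (fun x => h x (J x (V x)) (J x (W x)) - h x (V x) (W x)) p
  invariant : ∀ u : Circle, ∀ p ∈ mode.points U, ∀ V W, SmoothAt V p → SmoothAt W p →
    mode.Vanishes
      (fun x => h (rotate u x) (dRotate u x (V x)) (dRotate u x (W x)) - h x (V x) (W x)) p
  kahler_I : IsClosedForm mode U (fundForm h I)
  kahler_J : IsClosedForm mode U (fundForm h J)

/-- The projection `ρ : T̄M → M` is (formally) holomorphic for the almost complex structure `I`. -/
def IsHolomorphicProjection (mode : Mode) (U : Set (ConjTangent E M))
    (I : ∀ x : ConjTangent E M, TT x →L[ℝ] TT x) : Prop :=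
  ∀ p ∈ mode.points U, ∀ V, SmoothAt V p →
    mode.VanishesAlong 𝓘(ℝ, E) (fun x : ConjTangent E M => x.proj)
      (fun x =>
        let dρ : TT x →L[ℝ] E :=
          mfderiv (modelT E) 𝓘(ℝ, E) (fun x : ConjTangent E M => x.proj) x
        (dρ (I x (V x)) - Complex.I • dρ (V x) : E)) p

/-- A (formal) polarized Hodge manifold structure `(I, J, h)` on the neighbourhood `U` of the zero
section such that the projection `ρ : T̄M_I → M` is holomorphic. -/
structure IsPolarizedHodgeOver (mode : Mode) (U : Set (ConjTangent E M))
    (I J : ∀ x : ConjTangent E M, TT x →L[ℝ] TT x)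
    (h : ∀ x : ConjTangent E M, TT x →L[ℝ] TT x →L[ℝ] ℝ) : Prop where
  nhd : IsInvariantNhd U
  hodge : IsHodge mode U I J
  polarization : IsPolarization mode U I J h
  holomorphic : IsHolomorphicProjection mode U I

/-- The `(2,0)`-form `Ω_I = ω_J + √-1 ω_K` on `T̄M_I`, where `K = IJ`. -/
def formI (I J : ∀ x : ConjTangent E M, TT x →L[ℝ] TT x)
    (h : ∀ x : ConjTangent E M, TT x →L[ℝ] TT x →L[ℝ] ℝ) (x : ConjTangent E M) (v w : TT x) : ℂ :=
  (fundForm h J x v w : ℂ) + Complex.I * (fundForm h (fun y => (I y).comp (J y)) x v w : ℂ)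

/-- The (formal) map `κ : T̄M_I → T^*M`, defined on the neighbourhood `U` of the zero section, is a
`U(1)`-equivariant holomorphic map over `M` such that `κ^*Ω = Ω_I`. -/
structure IsCotangentMap (mode : Mode) (U : Set (ConjTangent E M))
    (I J : ∀ x : ConjTangent E M, TT x →L[ℝ] TT x)
    (h : ∀ x : ConjTangent E M, TT x →L[ℝ] TT x →L[ℝ] ℝ)
    (κ : ConjTangent E M → Cotangent E M) : Prop where
  nhd : IsInvariantNhd U
  smooth : ContMDiffOn (modelT E) (modelC E) ∞ κ U
  proj_eq : ∀ x ∈ U, (κ x).proj = x.proj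
  equivariant : ∀ u : Circle, ∀ p ∈ mode.points U,
    mode.Agree (fun x => κ (rotate u x)) (fun x => rotateCot u (κ x)) p
  holomorphic : ∀ p ∈ mode.points U, ∀ V, SmoothAt V p →
    mode.VanishesAlong (modelC E) κ
      (fun x => mfderiv (modelT E) (modelC E) κ x (I x (V x)) -
        mulI (κ x) (mfderiv (modelT E) (modelC E) κ x (V x))) p
  symplectic : ∀ p ∈ mode.points U, ∀ V W, SmoothAt V p → SmoothAt W p →
    mode.Vanishes
      (fun x => canonicalForm (κ x) (mfderiv (modelT E) (modelC E) κ x (V x))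
        (mfderiv (modelT E) (modelC E) κ x (W x)) - formI I J h x (V x) (W x)) p

end

end HodgeCotangent

end

/-! Let φ generate the action of U(1) on T̄M. The form Ω = Ω_I is closed, satisfies Ω(I·,·) = √-1 Ω,
and has weight one: u^*Ω = uΩ (`cForm_I`, `rot_cForm`, `closed_cForm`). Differentiating the weight
condition in u gives L_φ Ω = √-1 Ω. Cartan's formula turns this into Ω = dα with α = -√-1 ι_φ Ω
(`deriv_contraction`).

Uniqueness. In charts, a map κ over M is a function k whose values are complex-linear forms on the
base, and κ^*λ = k ∘ dρ. Equivariance gives D_φ k = √-1 k. Since φ is vertical, contracting dκ^*λ =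
Ω with φ gives (D_φ k) ∘ dρ = ι_φ Ω. Hence κ^*λ = α, so k is determined (`JetEq.eq_contraction`).

Existence. It remains to see that α descends to a complex-linear form on the base; the resulting k
then has all the required properties. Complex linearity follows from the type of Ω and the
holomorphy of ρ (`potential_eq`). Descent means that α kills vertical vectors, and for this it
suffices that the fibres are Lagrangian. This is the heart of the proof. The field X = Iφ is
vertical because ρ is holomorphic, and ι_X Ω = √-1 ι_φ Ω = -α, so L_X Ω = -Ω (`lie_field`). On the
zero section, equivariance forces I = -√-1 on vertical vectors (`I_vert`), so X agrees to first
order with minus the Euler field of the fibres. The restriction T of Ω to the fibres therefore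
satisfies D_X T = L T, where L is the identity along the zero section (`transport_vert`,
`vertOp_fieldDeriv`). In the model case T would be homogeneous of degree -1, and a smooth function
of negative degree is zero. The formal version of this is an induction on the order of the
derivatives (`iteratedFDeriv_eq_zero_of_transport`). The actual version is a maximum principle on a
small ball in the fibre (`eq_zero_of_transport_of_contracting`).

The relation `JetEq` means equality of germs in the actual case and equality of Taylor series in the
formal case. It is stable under products, compositions and derivatives, so nearly all computations
serve both parts at once. Globally, κ is defined at each point by the chart over its own base point.
Covariance of the construction (`potential_covariant`) shows that every other chart gives the same
map. Compactness of U(1) provides an invariant open domain. -/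

open scoped Manifold ContDiff Bundle
noncomputable section
namespace HodgeCotangent
set_option maxSynthPendingDepth 3
set_option linter.unusedSectionVars false

open Filter Topology

/-! ### Smooth germs up to a mode of equality -/

section Jets

variable {Z : Type*} [NormedAddCommGroup Z] [NormedSpace ℝ Z]
  {F : Type*} [NormedAddCommGroup F] [NormedSpace ℝ F]
  {F' : Type*} [NormedAddCommGroup F'] [NormedSpace ℝ F']
  {G : Type*} [NormedAddCommGroup G] [NormedSpace ℝ G]
  {mode : Mode} {z : Z}

/-- Two functions smooth at `z` coincide near `z`, or have the same Taylor series at `z`. -/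
def JetEq (mode : Mode) (z : Z) (f g : Z → F) : Prop :=
  ContDiffAt ℝ ∞ f z ∧ ContDiffAt ℝ ∞ g z ∧
    match mode with
    | .actual => f =ᶠ[𝓝 z] g
    | .formal => ∀ k, iteratedFDeriv ℝ k f z = iteratedFDeriv ℝ k g z

namespace JetEq

lemma left {f g : Z → F} (h : JetEq mode z f g) : ContDiffAt ℝ ∞ f z := h.1

lemma of_eventuallyEq {f g : Z → F} (hf : ContDiffAt ℝ ∞ f z) (h : f =ᶠ[𝓝 z] g) :
    JetEq mode z f g := by
  refine ⟨hf, hf.congr_of_eventuallyEq h.symm, ?_⟩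
  cases mode
  · exact h
  · exact fun k => (h.iteratedFDeriv ℝ k).eq_of_nhds

lemma refl {f : Z → F} (hf : ContDiffAt ℝ ∞ f z) : JetEq mode z f f :=
  of_eventuallyEq hf .rfl

lemma symm {f g : Z → F} (h : JetEq mode z f g) : JetEq mode z g f := by
  refine ⟨h.2.1, h.1, ?_⟩
  cases mode
  · exact h.2.2.symm
  · exact fun k => (h.2.2 k).symm

lemma trans {f g k : Z → F} (h : JetEq mode z f g) (h' : JetEq mode z g k) :
    JetEq mode z f k := by
  refine ⟨h.1, h'.2.1, ?_⟩
  cases mode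
  · exact h.2.2.trans h'.2.2
  · exact fun k => (h.2.2 k).trans (h'.2.2 k)

lemma congr_left {f f' g : Z → F} (h : JetEq mode z f g) (e : f' =ᶠ[𝓝 z] f) :
    JetEq mode z f' g :=
  (of_eventuallyEq h.1 e.symm).symm.trans h

lemma congr_right {f g g' : Z → F} (h : JetEq mode z f g) (e : g' =ᶠ[𝓝 z] g) :
    JetEq mode z f g' :=
  (h.symm.congr_left e).symm

lemma toFormal {f g : Z → F} (h : JetEq mode z f g) : JetEq .formal z f g := by
  cases mode
  · exact of_eventuallyEq h.1 h.2.2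
  · exact h

lemma eq_at {f g : Z → F} (h : JetEq mode z f g) : f z = g z := by
  have := h.toFormal.2.2 0
  simpa using congrArg (fun m => m 0) this

/-- By the Faà di Bruno formula, the derivatives of a composite at a point are universal expressions
in the Taylor series of the two factors. Most other stability properties of `JetEq` follow from this
one. -/
lemma comp_left {f f' : Z → F} (g : F → G) (h : JetEq mode z f f')
    (hg : ContDiffAt ℝ ∞ g (f z)) : JetEq mode z (fun x => g (f x)) (fun x => g (f' x)) := by
  have e := h.eq_at
  refine ⟨hg.comp z h.1, (e ▸ hg : ContDiffAt ℝ ∞ g (f' z)).comp z h.2.1, ?_⟩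
  cases mode
  · exact h.2.2.fun_comp g
  · intro k
    have h1 := iteratedFDeriv_comp (i := k) hg h.1 (by exact_mod_cast le_top)
    have h2 := iteratedFDeriv_comp (i := k) (e ▸ hg : ContDiffAt ℝ ∞ g (f' z)) h.2.1
      (by exact_mod_cast le_top)
    have h3 : ftaylorSeries ℝ f z = ftaylorSeries ℝ f' z := by
      ext1 n; exact h.2.2 n
    rw [← e, ← h3] at h2
    exact h1.trans h2.symm

lemma comp_right {W : Type*} [NormedAddCommGroup W] [NormedSpace ℝ W] {w : W} {φ : W → Z}
    {f f' : Z → F} (h : JetEq mode (φ w) f f') (hφ : ContDiffAt ℝ ∞ φ w) :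
    JetEq mode w (fun x => f (φ x)) (fun x => f' (φ x)) := by
  refine ⟨h.1.comp w hφ, h.2.1.comp w hφ, ?_⟩
  cases mode
  · exact hφ.continuousAt.eventually h.2.2
  · intro k
    have h1 := iteratedFDeriv_comp (i := k) h.1 hφ (by exact_mod_cast le_top)
    have h2 := iteratedFDeriv_comp (i := k) h.2.1 hφ (by exact_mod_cast le_top)
    have h3 : ftaylorSeries ℝ f (φ w) = ftaylorSeries ℝ f' (φ w) := by
      ext1 n; exact h.2.2 n
    rw [← h3] at h2
    exact h1.trans h2.symm

lemma prodMk {f f' : Z → F} {g g' : Z → G} (h : JetEq mode z f f') (h' : JetEq mode z g g') :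
    JetEq mode z (fun x => (f x, g x)) (fun x => (f' x, g' x)) := by
  refine ⟨h.1.prodMk h'.1, h.2.1.prodMk h'.2.1, ?_⟩
  cases mode
  · filter_upwards [h.2.2, h'.2.2] with x h1 h2
    rw [h1, h2]
  · intro k
    have hk : (k : WithTop ℕ∞) ≤ ∞ := by exact_mod_cast le_top
    rw [iteratedFDeriv_prodMk (h.1.of_le hk) (h'.1.of_le hk) le_rfl,
      iteratedFDeriv_prodMk (h.2.1.of_le hk) (h'.2.1.of_le hk) le_rfl, h.2.2 k, h'.2.2 k]

lemma comp₂ {f f' : Z → F} {g g' : Z → F'} (B : F → F' → G)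
    (h : JetEq mode z f f') (h' : JetEq mode z g g')
    (hB : ContDiffAt ℝ ∞ (fun p : F × F' => B p.1 p.2) (f z, g z)) :
    JetEq mode z (fun x => B (f x) (g x)) (fun x => B (f' x) (g' x)) :=
  (h.prodMk h').comp_left (fun p : F × F' => B p.1 p.2) hB

lemma add {f f' g g' : Z → F} (h : JetEq mode z f f') (h' : JetEq mode z g g') :
    JetEq mode z (fun x => f x + g x) (fun x => f' x + g' x) :=
  h.comp₂ (fun a b => a + b) h' (by fun_prop)

lemma sub {f f' g g' : Z → F} (h : JetEq mode z f f') (h' : JetEq mode z g g') :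
    JetEq mode z (fun x => f x - g x) (fun x => f' x - g' x) :=
  h.comp₂ (fun a b => a - b) h' (by fun_prop)

lemma neg {f f' : Z → F} (h : JetEq mode z f f') :
    JetEq mode z (fun x => -f x) (fun x => -f' x) :=
  h.comp_left (fun a => -a) (by fun_prop)

lemma clm {f f' : Z → F} (L : F →L[ℝ] G) (h : JetEq mode z f f') :
    JetEq mode z (fun x => L (f x)) (fun x => L (f' x)) :=
  h.comp_left L L.contDiff.contDiffAt

lemma apply {A A' : Z → F →L[ℝ] G} {v v' : Z → F} (h : JetEq mode z A A')
    (h' : JetEq mode z v v') : JetEq mode z (fun x => A x (v x)) (fun x => A' x (v' x)) :=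
  h.comp₂ (fun a b => a b) h' (by fun_prop)

lemma apply_const {A A' : Z → F →L[ℝ] G} (h : JetEq mode z A A') (v : F) :
    JetEq mode z (fun x => A x v) (fun x => A' x v) :=
  h.apply (refl contDiffAt_const)

lemma comp {A A' : Z → F' →L[ℝ] G} {B B' : Z → F →L[ℝ] F'} (h : JetEq mode z A A')
    (h' : JetEq mode z B B') :
    JetEq mode z (fun x => (A x).comp (B x)) (fun x => (A' x).comp (B' x)) :=
  h.comp₂ (fun a b => a.comp b) h' (by fun_prop)

lemma of_sub {f g : Z → F} (hg : ContDiffAt ℝ ∞ g z)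
    (h : JetEq mode z (fun x => f x - g x) (fun _ => 0)) : JetEq mode z f g :=
  ((h.add (refl hg)).congr_left (.of_forall fun x => by simp)).congr_right
    (.of_forall fun x => by simp)

lemma sub_zero_iff {f g : Z → F} (h : JetEq mode z f g) :
    JetEq mode z (fun x => f x - g x) (fun _ => 0) :=
  (h.sub (refl h.2.1)).congr_right (.of_forall fun x => by simp)

lemma fderiv {f g : Z → F} (h : JetEq mode z f g) :
    JetEq mode z (_root_.fderiv ℝ f) (_root_.fderiv ℝ g) := by
  refine ⟨h.1.fderiv_right (by exact_mod_cast le_top), h.2.1.fderiv_right (by exact_mod_cast le_top), ?_⟩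
  cases mode
  · exact h.2.2.fderiv
  · intro k
    have h1 := h.2.2 (k + 1)
    rw [iteratedFDeriv_succ_eq_comp_right, iteratedFDeriv_succ_eq_comp_right] at h1
    exact (LinearIsometryEquiv.injective _ h1)

/-- A formal identity between functions follows from the identities between their values at `z`
and between their derivatives. -/
lemma iterated_succ_zero {f : Z → F} {k : ℕ}
    (h : iteratedFDeriv ℝ k (_root_.fderiv ℝ f) z = 0) : iteratedFDeriv ℝ (k + 1) f z = 0 := by
  rw [iteratedFDeriv_succ_eq_comp_right, Function.comp_apply, h]
  exact LinearIsometryEquiv.map_zero (continuousMultilinearCurryRightEquiv' ℝ k Z F).symm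

/-- A function into a finite product is the sum of its components placed by the coordinate
inclusions, so stability under sums and linear maps is enough. -/
lemma pi_ext {ι : Type*} [Fintype ι] {f g : Z → ι → F}
    (h : ∀ i, JetEq mode z (fun x => f x i) (fun x => g x i)) : JetEq mode z f g := by
  classical
  have key : ∀ s : Finset ι, JetEq mode z
      (fun x => ∑ i ∈ s, ContinuousLinearMap.single ℝ (fun _ : ι => F) i (f x i))
      (fun x => ∑ i ∈ s, ContinuousLinearMap.single ℝ (fun _ : ι => F) i (g x i)) := by
    intro s
    induction s using Finset.induction_on with
    | empty => simpa using refl contDiffAt_const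
    | insert a s ha ih =>
      simp only [Finset.sum_insert ha]
      exact ((h a).clm _).add ih
  have e : ∀ w : ι → F,
      ∑ i, ContinuousLinearMap.single ℝ (fun _ : ι => F) i (w i) = w := by
    intro w
    simpa using! Finset.univ_sum_single w
  simpa only [e] using key Finset.univ

/-- An identity with values in a finite-dimensional space can be tested on linear functionals. -/
lemma ext_dual [FiniteDimensional ℝ F] {f g : Z → F}
    (h : ∀ ℓ : F →L[ℝ] ℝ, JetEq mode z (fun x => ℓ (f x)) (fun x => ℓ (g x))) :
    JetEq mode z f g := by
  have e := ContinuousLinearEquiv.ofFinrankEq (𝕜 := ℝ) (E := F)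
    (F := Fin (Module.finrank ℝ F) → ℝ) (by simp)
  have h1 : JetEq mode z (fun x => e (f x)) (fun x => e (g x)) :=
    pi_ext fun i => h ((ContinuousLinearMap.proj (R := ℝ) (φ := fun _ => ℝ) i).comp
      (e : F →L[ℝ] (Fin (Module.finrank ℝ F) → ℝ)))
  simpa using h1.clm (e.symm : _ →L[ℝ] F)

/-- An identity between operators on a finite-dimensional space can be tested on vectors. -/
lemma clm_ext [FiniteDimensional ℝ F] {A B : Z → F →L[ℝ] G}
    (h : ∀ v, JetEq mode z (fun x => A x v) (fun x => B x v)) : JetEq mode z A B := by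
  have e := ContinuousLinearEquiv.ofFinrankEq (𝕜 := ℝ) (E := F)
    (F := Fin (Module.finrank ℝ F) → ℝ) (by simp)
  let p (i : Fin (Module.finrank ℝ F)) : F →L[ℝ] ℝ :=
    (ContinuousLinearMap.proj (R := ℝ) (φ := fun _ => ℝ) i).comp
      (e : F →L[ℝ] (Fin (Module.finrank ℝ F) → ℝ))
  -- An operator is the finite sum of p_i ⊗ A(e_i) over a basis e_i with dual basis p_i.
  have key : JetEq mode z
      (fun x => ∑ i, (ContinuousLinearMap.smulRightL ℝ F G (p i)) (A x (e.symm (Pi.single i 1))))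
      (fun x => ∑ i, (ContinuousLinearMap.smulRightL ℝ F G (p i)) (B x (e.symm (Pi.single i 1)))) := by
    have : ∀ s : Finset (Fin (Module.finrank ℝ F)), JetEq mode z
      (fun x => ∑ i ∈ s, (ContinuousLinearMap.smulRightL ℝ F G (p i)) (A x (e.symm (Pi.single i 1))))
      (fun x => ∑ i ∈ s, (ContinuousLinearMap.smulRightL ℝ F G (p i)) (B x (e.symm (Pi.single i 1)))) := by
      intro s
      induction s using Finset.induction_on with
      | empty => simpa using refl contDiffAt_const
      | insert a s ha ih =>
        simp only [Finset.sum_insert ha]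
        exact ((h _).clm _).add ih
    exact this Finset.univ
  have e1 : ∀ A : F →L[ℝ] G,
      ∑ i, (ContinuousLinearMap.smulRightL ℝ F G (p i)) (A (e.symm (Pi.single i 1))) = A := by
    intro A
    ext v
    have h2 : ∑ i, (e v i) • (Pi.single i 1 : Fin (Module.finrank ℝ F) → ℝ) = e v := by
      rw [← pi_eq_sum_univ']
    have h3 := congrArg (fun w => A (e.symm w)) h2
    simpa [p] using h3
  simpa only [e1] using key

end JetEq

end Jets

/-! ### Differentiation in a parameter, and transport equations -/

section Transport

universe u v

lemma two_le_infty : (2 : WithTop ℕ∞) ≤ ∞ := by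
  exact WithTop.coe_le_coe.2 (le_top : (2 : ℕ∞) ≤ ⊤)

/-- Symmetry of second derivatives lets the derivative in the parameter commute with the derivative
in space, so the case k + 1 for F is the case k for the spatial derivative of F. That derivative
takes values in another space, so the induction runs over all target spaces, in a universe closed
under passing to operators from Z. -/
lemma iteratedFDeriv_deriv_param {Z : Type u} [NormedAddCommGroup Z] [NormedSpace ℝ Z] (k : ℕ) :
    ∀ {G : Type (max u v)} [NormedAddCommGroup G] [NormedSpace ℝ G] {z : Z} {F : ℝ → Z → G},
      ContDiffAt ℝ ∞ (fun q : ℝ × Z => F q.1 q.2) (0, z) →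
      (∀ θ, iteratedFDeriv ℝ k (F θ) z = 0) →
      iteratedFDeriv ℝ k (fun w => deriv (fun θ => F θ w) 0) z = 0 := by
  induction k with
  | zero =>
    intro G _ _ z F hF h
    have h0 : ∀ θ, F θ z = 0 := fun θ => by
      simpa using congrArg (fun m => m 0) (h θ)
    ext m
    simp [h0]
  | succ k ih =>
    intro G _ _ z F hF h
    set Φ : ℝ × Z → G := fun q => F q.1 q.2 with hΦ
    have hd : ∀ᶠ q in 𝓝 ((0 : ℝ), z), DifferentiableAt ℝ Φ q :=
      ((hF.of_le (by simp : (1 : WithTop ℕ∞) ≤ ∞)).eventually (by simp)).mono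
        fun q hq => hq.differentiableAt (by simp)
    have h1 : ∀ᶠ q in 𝓝 ((0 : ℝ), z),
        fderiv ℝ (F q.1) q.2 = (fderiv ℝ Φ q).comp (ContinuousLinearMap.inr ℝ ℝ Z) := by
      filter_upwards [hd] with q hq
      exact (HasFDerivAt.comp (g := Φ) (f := fun w => (q.1, w)) q.2
        (by exact hq.hasFDerivAt) (hasFDerivAt_prodMk_right q.1 q.2)).fderiv
    have hF' : ContDiffAt ℝ ∞ (fderiv ℝ Φ) (0, z) := hF.fderiv_right (by simp)
    have hF2 : ContDiffAt ℝ ∞ (fun q : ℝ × Z => fderiv ℝ (F q.1) q.2) (0, z) :=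
      ContDiffAt.congr_of_eventuallyEq (hF'.clm_comp contDiffAt_const) h1
    have h2 := ih (F := fun θ w => fderiv ℝ (F θ) w) hF2 fun θ => by
      have := h θ
      rw [iteratedFDeriv_succ_eq_comp_right] at this
      exact LinearIsometryEquiv.injective (continuousMultilinearCurryRightEquiv' ℝ k Z G).symm
        (this.trans (LinearIsometryEquiv.map_zero _).symm)
    apply JetEq.iterated_succ_zero
    have hj : Tendsto (fun w : Z => ((0 : ℝ), w)) (𝓝 z) (𝓝 (0, z)) :=
      (Continuous.prodMk_right (0 : ℝ)).tendsto z
    have hd' : ∀ᶠ q in 𝓝 ((0 : ℝ), z), ContDiffAt ℝ 2 Φ q :=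
      (hF.of_le two_le_infty).eventually (by simp)
    have h3 : (fun w => deriv (fun θ => F θ w) 0) =ᶠ[𝓝 z] fun w => fderiv ℝ Φ (0, w) (1, 0) := by
      filter_upwards [hj.eventually hd] with w hw
      have := HasFDerivAt.comp_hasDerivAt (l := Φ) (f := fun θ : ℝ => (θ, w)) (0 : ℝ)
        (by exact hw.hasFDerivAt) ((hasDerivAt_id (0 : ℝ)).prodMk (hasDerivAt_const _ w))
      exact this.deriv
    have h4 : fderiv ℝ (fun w => deriv (fun θ => F θ w) 0) =ᶠ[𝓝 z]
        fun w => deriv (fun θ => fderiv ℝ (F θ) w) 0 := by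
      have h1' := h1.eventually_nhds
      filter_upwards [h3.fderiv (𝕜 := ℝ), hj.eventually hd', hj.eventually h1'] with w hw1 hw2 hw3
      rw [hw1]
      have hD : DifferentiableAt ℝ (fderiv ℝ Φ) (0, w) :=
        (hw2.fderiv_right (m := 1) (by norm_num)).differentiableAt (by simp)
      have e1 : HasFDerivAt (fun w => fderiv ℝ Φ (0, w) (1, 0))
          (((ContinuousLinearMap.apply ℝ G ((1 : ℝ), (0 : Z))).comp
            (fderiv ℝ (fderiv ℝ Φ) (0, w))).comp (ContinuousLinearMap.inr ℝ ℝ Z)) w :=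
        HasFDerivAt.comp (g := fun q => fderiv ℝ Φ q (1, 0)) (f := fun w => ((0 : ℝ), w)) w
          (HasFDerivAt.comp (g := ContinuousLinearMap.apply ℝ G ((1 : ℝ), (0 : Z))) _
            (ContinuousLinearMap.hasFDerivAt _) hD.hasFDerivAt)
          (hasFDerivAt_prodMk_right (0 : ℝ) w)
      have e2 : HasDerivAt (fun θ => fderiv ℝ (F θ) w)
          ((fderiv ℝ (fderiv ℝ Φ) (0, w) (1, 0)).comp (ContinuousLinearMap.inr ℝ ℝ Z)) 0 := by
        have e3 : (fun θ => fderiv ℝ (F θ) w) =ᶠ[𝓝 0]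
            fun θ => (fderiv ℝ Φ (θ, w)).comp (ContinuousLinearMap.inr ℝ ℝ Z) := by
          have : Tendsto (fun θ : ℝ => (θ, w)) (𝓝 0) (𝓝 (0, w)) :=
            (Continuous.prodMk_left w).tendsto 0
          exact this.eventually hw3
        refine HasDerivAt.congr_of_eventuallyEq ?_ e3
        have := HasFDerivAt.comp_hasDerivAt (l := fderiv ℝ Φ) (f := fun θ : ℝ => (θ, w)) (0 : ℝ)
          (by exact hD.hasFDerivAt) ((hasDerivAt_id (0 : ℝ)).prodMk (hasDerivAt_const _ w))
        exact ((ContinuousLinearMap.compL ℝ Z (ℝ × Z) G).flip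
          (ContinuousLinearMap.inr ℝ ℝ Z)).hasFDerivAt.comp_hasDerivAt (0 : ℝ) this
      rw [e1.fderiv, e2.deriv]
      ext ξ
      have hs : IsSymmSndFDerivAt ℝ Φ (0, w) := hw2.isSymmSndFDerivAt (by simp)
      exact hs _ _
    rw [(h4.iteratedFDeriv ℝ k).eq_of_nhds]
    exact h2

/-- Identities between two families of germs depending on a parameter can be differentiated in the
parameter. -/
lemma JetEq.deriv_param {Z : Type u} [NormedAddCommGroup Z] [NormedSpace ℝ Z]
    {G : Type v} [NormedAddCommGroup G] [NormedSpace ℝ G] {mode : Mode} {P : Set Z}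
    (hP : mode = .actual → IsOpen P) {F : ℝ → Z → G}
    (hF : ∀ z ∈ P, ContDiffAt ℝ ∞ (fun q : ℝ × Z => F q.1 q.2) (0, z))
    (h : ∀ z ∈ P, ∀ θ, JetEq mode z (F θ) (fun _ => 0)) {F' : Z → G}
    (hF' : ∀ z ∈ P, ∀ᶠ w in 𝓝 z, HasDerivAt (fun θ => F θ w) (F' w) 0)
    {z : Z} (hz : z ∈ P) (hF's : ContDiffAt ℝ ∞ F' z) :
    JetEq mode z F' (fun _ => 0) := by
  refine ⟨hF's, contDiffAt_const, ?_⟩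
  cases mode
  · filter_upwards [(hP rfl).mem_nhds hz, hF' z hz] with w hw hd
    have : ∀ θ, F θ w = 0 := fun θ => (h w hw θ).eq_at
    rw [← hd.deriv]
    simp [this]
  · intro k
    -- The second factor only serves to lift the target to the universe required by
    -- `iteratedFDeriv_deriv_param`; the first projection recovers the statement.
    let ι : G →L[ℝ] G × (Z →L[ℝ] ℝ) := ContinuousLinearMap.inl ℝ G (Z →L[ℝ] ℝ)
    have hι : ∀ j, iteratedFDeriv ℝ j (fun w => ι (F' w)) z = 0 := by
      intro j
      have e : (fun w => ι (F' w)) =ᶠ[𝓝 z] fun w => deriv (fun θ => ι (F θ w)) 0 := by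
        filter_upwards [hF' z hz] with w hw
        exact ((ι.hasFDerivAt.comp_hasDerivAt (0 : ℝ) hw).deriv).symm
      rw [(e.iteratedFDeriv ℝ j).eq_of_nhds]
      refine iteratedFDeriv_deriv_param.{u, v} j (F := fun θ w => ι (F θ w))
        (ι.contDiff.contDiffAt.comp (0, z) (hF z hz)) fun θ => ?_
      rw [(((h z hz θ).toFormal).clm ι).2.2 j]
      simp
    have h1 : JetEq .formal z (fun w => ι (F' w)) (fun _ => 0) :=
      ⟨ι.contDiff.contDiffAt.comp z hF's, contDiffAt_const, fun j => by rw [hι j]; simp⟩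
    exact (h1.clm (ContinuousLinearMap.fst ℝ G (Z →L[ℝ] ℝ))).2.2 k

lemma contDiffAt_clm_of_apply {Z F G : Type*} [NormedAddCommGroup Z] [NormedSpace ℝ Z]
    [NormedAddCommGroup F] [NormedSpace ℝ F] [NormedAddCommGroup G] [NormedSpace ℝ G]
    [FiniteDimensional ℝ F] {A : Z → F →L[ℝ] G} {z : Z}
    (h : ∀ v, ContDiffAt ℝ ∞ (fun x => A x v) z) : ContDiffAt ℝ ∞ A z :=
  (JetEq.clm_ext (mode := .actual) fun v => JetEq.refl (h v)).left

/-! ### The transport equation for a function together with its derivative. -/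

section Lift

variable {Z G : Type*} [NormedAddCommGroup Z] [NormedSpace ℝ Z]
  [NormedAddCommGroup G] [NormedSpace ℝ G]

/-- The operator in the transport equation satisfied by `(f, Df)` when `D_X f = L f`. -/
def transportLift (L : G →L[ℝ] G) (L' : Z →L[ℝ] G →L[ℝ] G) (X' : Z →L[ℝ] Z) :
    (G × (Z →L[ℝ] G)) →L[ℝ] (G × (Z →L[ℝ] G)) :=
  (L.comp (ContinuousLinearMap.fst ℝ G (Z →L[ℝ] G))).prod
    (L'.flip.comp (ContinuousLinearMap.fst ℝ G (Z →L[ℝ] G)) +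
      (ContinuousLinearMap.compL ℝ Z G G L - (ContinuousLinearMap.compL ℝ Z Z G).flip X').comp
        (ContinuousLinearMap.snd ℝ G (Z →L[ℝ] G)))

@[simp] lemma transportLift_apply (L : G →L[ℝ] G) (L' : Z →L[ℝ] G →L[ℝ] G) (X' : Z →L[ℝ] Z)
    (g : G) (T : Z →L[ℝ] G) :
    transportLift L L' X' (g, T) = (L g, L'.flip g + (L.comp T - T.comp X')) := rfl

lemma contDiffAt_transportLift [FiniteDimensional ℝ Z] [FiniteDimensional ℝ G] {z : Z}
    {L : Z → G →L[ℝ] G} {L' : Z → Z →L[ℝ] G →L[ℝ] G}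
    {X' : Z → Z →L[ℝ] Z} (hL : ContDiffAt ℝ ∞ L z) (hL' : ContDiffAt ℝ ∞ L' z)
    (hX : ContDiffAt ℝ ∞ X' z) :
    ContDiffAt ℝ ∞ (fun x => transportLift (L x) (L' x) (X' x)) z := by
  refine contDiffAt_clm_of_apply fun ⟨g, T⟩ => ?_
  simp only [transportLift_apply]
  refine (hL.clm_apply contDiffAt_const).prodMk (ContDiffAt.add ?_
    ((hL.clm_comp contDiffAt_const).sub (contDiffAt_const.clm_comp hX)))
  exact contDiffAt_clm_of_apply fun ξ => (hL'.clm_apply contDiffAt_const).clm_apply contDiffAt_const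

/-- Differentiating D_X f = L f and using symmetry of D²f gives D_X(Df) = (DL) f + L ∘ Df - Df ∘ DX.
So (f, Df) solves an equation of the same kind, and induction on the order of differentiation is
possible. -/
lemma jetEq_transportLift {z : Z} {X : Z → Z} (hX : ContDiffAt ℝ ∞ X z)
    {f : Z → G} {L : Z → G →L[ℝ] G} (hf : ContDiffAt ℝ ∞ f z) (hL : ContDiffAt ℝ ∞ L z)
    {mode : Mode} (h : JetEq mode z (fun x => fderiv ℝ f x (X x)) (fun x => L x (f x))) :
    JetEq mode z
      (fun x => fderiv ℝ (fun y => (f y, fderiv ℝ f y)) x (X x))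
      (fun x => transportLift (L x) (fderiv ℝ L x) (fderiv ℝ X x)
        (f x, fderiv ℝ f x)) := by
  have hf' : ContDiffAt ℝ ∞ (fderiv ℝ f) z := hf.fderiv_right (by simp)
  have hX' : ContDiffAt ℝ ∞ (fderiv ℝ X) z := hX.fderiv_right (by simp)
  have h2 := h.fderiv.sub (JetEq.refl (mode := mode) (hf'.clm_comp hX'))
  refine (h.prodMk h2).congr_left ?_ |>.congr_right ?_
  · filter_upwards [(hf.of_le two_le_infty).eventually (by simp),
      (hf'.of_le two_le_infty).eventually (by simp),
      (hX.of_le two_le_infty).eventually (by simp)] with x h1 h2 h3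
    have d1 := h1.differentiableAt (by simp)
    have d2 := h2.differentiableAt (by simp)
    have d3 := h3.differentiableAt (by simp)
    rw [(d1.hasFDerivAt.prodMk d2.hasFDerivAt).fderiv, fderiv_clm_apply d2 d3]
    refine Prod.ext rfl (ContinuousLinearMap.ext fun ξ => ?_)
    have hs : IsSymmSndFDerivAt ℝ f x := h1.isSymmSndFDerivAt (by simp)
    simpa using hs _ _
  · filter_upwards [(hf.of_le two_le_infty).eventually (by simp),
      (hL.of_le two_le_infty).eventually (by simp)] with x h1 h3
    have d1 := h1.differentiableAt (by simp)
    have d3 := h3.differentiableAt (by simp)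
    rw [fderiv_clm_apply d3 d1]
    refine Prod.ext rfl (ContinuousLinearMap.ext fun ξ => ?_)
    simp
    abel

end Lift

/-- A smooth solution of the equation `D_X f = L f` along a vector field `X` that contracts the
image of a projector `P` and vanishes at `z` to first order elsewhere is flat at `z`. -/
lemma iteratedFDeriv_eq_zero_of_transport {Z : Type u} [NormedAddCommGroup Z] [NormedSpace ℝ Z]
    [FiniteDimensional ℝ Z] {z : Z} {X : Z → Z} (hX : ContDiffAt ℝ ∞ X z) (hX0 : X z = 0) {P : Z →L[ℝ] Z}
    (hXP : fderiv ℝ X z = -P) (hP : ∀ ξ, P (P ξ) = P ξ) (k : ℕ) :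
    ∀ {G : Type u} [NormedAddCommGroup G] [NormedSpace ℝ G] [FiniteDimensional ℝ G]
      {f : Z → G} {L : Z → G →L[ℝ] G},
      ContDiffAt ℝ ∞ f z → ContDiffAt ℝ ∞ L z →
      JetEq .formal z (fun x => fderiv ℝ f x (X x)) (fun x => L x (f x)) →
      (∀ c : ℕ, ∀ g, L z g + (c : ℝ) • g = 0 → g = 0) →
      iteratedFDeriv ℝ k f z = 0 := by
  induction k with
  | zero =>
    intro G _ _ _ f L hf hL h hQ
    have h0 := h.eq_at
    -- Since X vanishes at z, the equation reads L f = 0 there.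
    have : f z = 0 := hQ 0 _ (by simpa [hX0] using h0.symm)
    ext m
    simp [this]
  | succ k ih =>
    intro G _ _ _ f L hf hL h hQ
    have hf' : ContDiffAt ℝ ∞ (fderiv ℝ f) z := hf.fderiv_right (by simp)
    -- The term -T ∘ DX equals T ∘ P. On the kernel of P it leaves c unchanged, and on the image of
    -- P it replaces c by c + 1. This is why the hypothesis is needed for every natural c, and why
    -- it passes to the lifted operator.
    have hQ₁ : ∀ c : ℕ, ∀ g, transportLift (L z) (fderiv ℝ L z) (fderiv ℝ X z) g + (c : ℝ) • g = 0 →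
        g = 0 := by
      rintro c ⟨g, T⟩ hg
      rw [transportLift_apply] at hg
      have g0 : g = 0 := hQ c g (congrArg Prod.fst hg)
      subst g0
      have hT : ∀ ξ, L z (T ξ) + T (P ξ) + (c : ℝ) • T ξ = 0 := by
        intro ξ
        have := congrArg (fun p => p.2 ξ) hg
        simpa [hXP] using this
      have T0 : T = 0 := by
        ext ξ
        have t1 : T (ξ - P ξ) = 0 := hQ c _ (by simpa [hP] using hT (ξ - P ξ))
        have t2 : T (P ξ) = 0 := hQ (c + 1) _ (by
          have := hT (P ξ)
          rw [hP] at this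
          rw [← this]; push_cast; module)
        have : ξ = (ξ - P ξ) + P ξ := by abel
        rw [this, map_add, t1, t2]; simp
      rw [T0]; rfl
    have h3 := ih (hf.prodMk hf') (contDiffAt_transportLift hL (hL.fderiv_right (by simp))
      (hX.fderiv_right (by simp))) (jetEq_transportLift hX hf hL h) hQ₁
    have hk : (k : WithTop ℕ∞) ≤ ∞ := by exact_mod_cast le_top
    rw [iteratedFDeriv_prodMk (hf.of_le hk) (hf'.of_le hk) le_rfl] at h3
    apply JetEq.iterated_succ_zero
    ext m : 1
    exact congrArg (fun t => (t m).2) h3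

/-- A maximum principle: a function on a ball that grows along a contracting vector field
is zero. -/
lemma eq_zero_of_transport_of_contracting {V G : Type*} [NormedAddCommGroup V] [NormedSpace ℝ V]
    [FiniteDimensional ℝ V] [NormedAddCommGroup G] [NormedSpace ℝ G] {r : ℝ}
    {f : V → G} {Y : V → V} (hf : ∀ v, ‖v‖ ≤ r → DifferentiableAt ℝ f v)
    (hfY : ∀ v, ‖v‖ ≤ r → ‖fderiv ℝ f v (Y v) - f v‖ ≤ 1 / 2 * ‖f v‖)
    (hY : ∀ v, ‖v‖ ≤ r → ‖v + Y v‖ ≤ ‖v‖) {v : V} (hv : ‖v‖ ≤ r) : f v = 0 := by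
  have hc : IsCompact (Metric.closedBall (0 : V) r) := isCompact_closedBall 0 r
  -- At a maximum point w of ‖f‖ on the closed ball, a small step along Y stays in the ball, yet it
  -- increases ‖f‖ unless f w = 0.
  obtain ⟨w, hw, hmax⟩ := hc.exists_isMaxOn (f := fun v => ‖f v‖) ⟨v, by simpa using hv⟩
    (fun x hx => (hf x (by simpa using hx)).continuousAt.norm.continuousWithinAt)
  have hw' : ‖w‖ ≤ r := by simpa using hw
  suffices h : ‖f w‖ = 0 by
    have := hmax (show v ∈ Metric.closedBall (0 : V) r by simpa using hv)
    simp only [h] at this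
    exact norm_le_zero_iff.1 this
  have hd : HasDerivAt (fun s : ℝ => f (w + s • Y w)) (fderiv ℝ f w (Y w)) 0 := by
    have h1 : HasDerivAt (fun s : ℝ => w + s • Y w) (Y w) 0 := by
      simpa using ((hasDerivAt_id (0 : ℝ)).smul_const (Y w)).const_add w
    exact HasFDerivAt.comp_hasDerivAt (l := f) (0 : ℝ) (by simpa using (hf w hw').hasFDerivAt) h1
  by_contra hne
  have hpos : 0 < ‖f w‖ := lt_of_le_of_ne (norm_nonneg _) (Ne.symm hne)
  -- The linearization error 1/4 and the deviation 1/2 of D_Y f from f add up to less than 1, which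
  -- leaves a strict gain of a quarter of s‖f w‖.
  have ho := (hasDerivAt_iff_isLittleO.1 hd).def (c := 1 / 4 * ‖f w‖) (by positivity)
  have : ∃ s : ℝ, 0 < s ∧ s ≤ 1 ∧
      ‖f (w + s • Y w) - f w - s • fderiv ℝ f w (Y w)‖ ≤ 1 / 4 * ‖f w‖ * s := by
    have h2 : ∀ᶠ s : ℝ in 𝓝[>] 0, 0 < s ∧ s ≤ 1 := by
      filter_upwards [Ioc_mem_nhdsGT (show (0 : ℝ) < 1 by norm_num)] with s hs using hs
    obtain ⟨s, hs1, hs2⟩ := (h2.and (ho.filter_mono nhdsWithin_le_nhds)).exists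
    refine ⟨s, hs1.1, hs1.2, ?_⟩
    simpa [abs_of_pos hs1.1] using hs2
  obtain ⟨s, hs0, hs1, hs⟩ := this
  have hmem : ‖w + s • Y w‖ ≤ r := by
    -- Convexity: for s ≤ 1 the new point lies on the segment from w to w + Y w, and both ends are
    -- in the ball.
    have e : w + s • Y w = (1 - s) • w + s • (w + Y w) := by module
    calc ‖w + s • Y w‖ ≤ ‖(1 - s) • w‖ + ‖s • (w + Y w)‖ := by rw [e]; exact norm_add_le _ _
      _ = (1 - s) * ‖w‖ + s * ‖w + Y w‖ := by
        rw [norm_smul, norm_smul, Real.norm_of_nonneg (by linarith), Real.norm_of_nonneg hs0.le]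
      _ ≤ (1 - s) * ‖w‖ + s * ‖w‖ := by gcongr; exact hY w hw'
      _ ≤ r := by linarith
  have hle : ‖f (w + s • Y w)‖ ≤ ‖f w‖ :=
    hmax (show w + s • Y w ∈ Metric.closedBall (0 : V) r by simpa using hmem)
  have e2 : (1 + s) • f w = f (w + s • Y w) - (f (w + s • Y w) - f w - s • fderiv ℝ f w (Y w)) -
      s • (fderiv ℝ f w (Y w) - f w) := by module
  have h3 : (1 + s) * ‖f w‖ ≤ ‖f w‖ + 1 / 4 * ‖f w‖ * s + s * (1 / 2 * ‖f w‖) := by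
    calc (1 + s) * ‖f w‖ = ‖(1 + s) • f w‖ := by
          rw [norm_smul, Real.norm_of_nonneg (by linarith)]
      _ ≤ ‖f (w + s • Y w)‖ + ‖f (w + s • Y w) - f w - s • fderiv ℝ f w (Y w)‖ +
          ‖s • (fderiv ℝ f w (Y w) - f w)‖ := by
        rw [e2]; exact (norm_sub_le _ _).trans (by gcongr; exact norm_sub_le _ _)
      _ ≤ _ := by
        rw [norm_smul, Real.norm_of_nonneg hs0.le]
        gcongr
        exact hfY w hw'
  nlinarith [mul_pos hs0 hpos]

end Transport
/-! ### Hodge structures in coordinates -/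

section Local

universe u

variable {E : Type u} [NormedAddCommGroup E] [NormedSpace ℂ E]

/-- Multiplication by a complex number. -/
def mulC (E : Type*) [NormedAddCommGroup E] [NormedSpace ℂ E] (c : ℂ) : E →L[ℝ] E :=
  (c • ContinuousLinearMap.id ℂ E).restrictScalars ℝ

@[simp] lemma mulC_apply (c : ℂ) (v : E) : mulC E c v = c • v := rfl

/-- The action of `u ∈ U(1)` in coordinates. -/
def rot (u : Circle) : E × E →L[ℝ] E × E :=
  (ContinuousLinearMap.id ℝ E).prodMap (mulC E (starRingEnd ℂ (u : ℂ)))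

@[simp] lemma rot_apply (u : Circle) (ξ : E × E) :
    rot u ξ = (ξ.1, starRingEnd ℂ (u : ℂ) • ξ.2) := rfl

/-- The generator of the action of `U(1)` in coordinates. -/
def gen (E : Type*) [NormedAddCommGroup E] [NormedSpace ℂ E] : E × E →L[ℝ] E × E :=
  (0 : E →L[ℝ] E).prodMap (mulC E (-Complex.I))

@[simp] lemma gen_apply (ξ : E × E) : gen E ξ = (0, -Complex.I • ξ.2) := rfl

/-- The exterior derivative of a `2`-form on a vector space. -/
def dTwo {Z G : Type*} [NormedAddCommGroup Z] [NormedSpace ℝ Z] [NormedAddCommGroup G]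
    [NormedSpace ℝ G] (f : Z → Z →L[ℝ] Z →L[ℝ] G) (w ξ η ζ : Z) : G :=
  fderiv ℝ f w ξ η ζ - fderiv ℝ f w η ξ ζ + fderiv ℝ f w ζ ξ η

/-- A Hodge structure with a polarization over the projection to the first factor, in
coordinates. -/
structure LocalHodge (mode : Mode) (P : Set (E × E)) (I J : E × E → (E × E →L[ℝ] E × E))
    (h : E × E → (E × E →L[ℝ] E × E →L[ℝ] ℝ)) : Prop where
  isOpen : mode = .actual → IsOpen P
  rot_mem : ∀ u : Circle, ∀ z ∈ P, rot u z ∈ P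
  smooth_I : ∀ z ∈ P, ContDiffAt ℝ ∞ I z
  smooth_J : ∀ z ∈ P, ContDiffAt ℝ ∞ J z
  smooth_h : ∀ z ∈ P, ContDiffAt ℝ ∞ h z
  I_sq : ∀ z ∈ P, JetEq mode z (fun w => (I w).comp (I w))
    (fun _ => -ContinuousLinearMap.id ℝ (E × E))
  J_sq : ∀ z ∈ P, JetEq mode z (fun w => (J w).comp (J w))
    (fun _ => -ContinuousLinearMap.id ℝ (E × E))
  anticomm : ∀ z ∈ P, JetEq mode z (fun w => (I w).comp (J w)) (fun w => -(J w).comp (I w))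
  rot_I : ∀ u : Circle, ∀ z ∈ P, JetEq mode z (fun w => (rot u).comp (I w))
    (fun w => (I (rot u w)).comp (rot u))
  rot_J : ∀ u : Circle, ∀ z ∈ P, JetEq mode z (fun w => (rot u).comp (J w))
    (fun w => (u : ℂ).re • (J (rot u w)).comp (rot u) +
      (u : ℂ).im • (I (rot u w)).comp ((J (rot u w)).comp (rot u)))
  symm : ∀ z ∈ P, ∀ ξ η, JetEq mode z (fun w => h w ξ η) (fun w => h w η ξ)
  herm_I : ∀ z ∈ P, ∀ ξ η, JetEq mode z (fun w => h w (I w ξ) (I w η)) (fun w => h w ξ η)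
  herm_J : ∀ z ∈ P, ∀ ξ η, JetEq mode z (fun w => h w (J w ξ) (J w η)) (fun w => h w ξ η)
  rot_h : ∀ u : Circle, ∀ z ∈ P, ∀ ξ η,
    JetEq mode z (fun w => h (rot u w) (rot u ξ) (rot u η)) (fun w => h w ξ η)
  closed_J : ∀ z ∈ P, ∀ ξ η ζ,
    JetEq mode z (fun w => dTwo (fun w => (h w).comp (J w)) w ξ η ζ) (fun _ => 0)
  proj : ∀ z ∈ P, JetEq mode z (fun w => (ContinuousLinearMap.fst ℝ E E).comp (I w))
    (fun _ => (mulC E Complex.I).comp (ContinuousLinearMap.fst ℝ E E))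

/-! ### Tensor identities applied to vector fields, and Cartan's formula. -/

section Bilinear

variable {Z F F' G : Type*} [NormedAddCommGroup Z] [NormedSpace ℝ Z]
  [NormedAddCommGroup F] [NormedSpace ℝ F] [NormedAddCommGroup F'] [NormedSpace ℝ F']
  [NormedAddCommGroup G] [NormedSpace ℝ G] [FiniteDimensional ℝ F] [FiniteDimensional ℝ F']
  {mode : Mode} {z : Z}

/-- An identity between operators, tested on constant vectors, may be used on vector-valued
functions. -/
lemma JetEq.subst {A B : Z → F →L[ℝ] G} (h : ∀ ξ, JetEq mode z (fun w => A w ξ) (fun w => B w ξ))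
    {X X' : Z → F} (hX : JetEq mode z X X') :
    JetEq mode z (fun w => A w (X w)) (fun w => B w (X' w)) :=
  (JetEq.clm_ext h).apply hX

lemma JetEq.subst₂ {A B : Z → F →L[ℝ] F' →L[ℝ] G}
    (h : ∀ ξ η, JetEq mode z (fun w => A w ξ η) (fun w => B w ξ η))
    {X X' : Z → F} (hX : JetEq mode z X X') {Y Y' : Z → F'} (hY : JetEq mode z Y Y') :
    JetEq mode z (fun w => A w (X w) (Y w)) (fun w => B w (X' w) (Y' w)) :=
  (JetEq.subst (fun ξ => JetEq.clm_ext (h ξ)) hX).apply hY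

lemma contDiffAt_clm_of_apply₂ {A : Z → F →L[ℝ] F' →L[ℝ] G}
    (h : ∀ ξ η, ContDiffAt ℝ ∞ (fun w => A w ξ η) z) : ContDiffAt ℝ ∞ A z :=
  contDiffAt_clm_of_apply fun ξ => contDiffAt_clm_of_apply (h ξ)

lemma contDiffAt_bilinearComp {F₁ F₂ : Type*} [NormedAddCommGroup F₁] [NormedSpace ℝ F₁]
    [NormedAddCommGroup F₂] [NormedSpace ℝ F₂] [FiniteDimensional ℝ F₁] [FiniteDimensional ℝ F₂]
    {A : Z → F →L[ℝ] F' →L[ℝ] G} {S : Z → F₁ →L[ℝ] F} {T : Z → F₂ →L[ℝ] F'}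
    (hA : ContDiffAt ℝ ∞ A z) (hS : ContDiffAt ℝ ∞ S z) (hT : ContDiffAt ℝ ∞ T z) :
    ContDiffAt ℝ ∞ (fun w => (A w).bilinearComp (S w) (T w)) z :=
  contDiffAt_clm_of_apply₂ fun ξ η => by
    simp only [ContinuousLinearMap.bilinearComp_apply]
    exact (hA.clm_apply (hS.clm_apply contDiffAt_const)).clm_apply (hT.clm_apply contDiffAt_const)

lemma JetEq.dTwo {Ω Ω' : Z → Z →L[ℝ] Z →L[ℝ] G} (h : JetEq mode z Ω Ω') (ξ η ζ : Z) :
    JetEq mode z (fun w => dTwo Ω w ξ η ζ) (fun w => dTwo Ω' w ξ η ζ) :=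
  (((h.fderiv.apply_const ξ).apply_const η).apply_const ζ).sub
    (((h.fderiv.apply_const η).apply_const ξ).apply_const ζ) |>.add
    (((h.fderiv.apply_const ζ).apply_const ξ).apply_const η)

lemma eventually_differentiableAt {f : Z → G} (h : ContDiffAt ℝ ∞ f z) :
    ∀ᶠ w in 𝓝 z, DifferentiableAt ℝ f w :=
  ((h.of_le two_le_infty).eventually (by simp)).mono fun _ hw => hw.differentiableAt (by simp)

lemma fderiv_apply₂ {A : Z → F →L[ℝ] F' →L[ℝ] G} (hA : DifferentiableAt ℝ A z) (ξ : Z) (b : F)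
    (c : F') : fderiv ℝ (fun w => A w b c) z ξ = fderiv ℝ A z ξ b c := by
  rw [fderiv_clm_apply (hA.clm_apply (differentiableAt_const b)) (differentiableAt_const c),
    fderiv_clm_apply hA (differentiableAt_const b)]
  simp

/-- Cartan's formula for the Lie derivative of a closed `2`-form. -/
lemma JetEq.cartan [FiniteDimensional ℝ Z] {Ω : Z → Z →L[ℝ] Z →L[ℝ] G} {Y : Z → Z}
    (hΩ : ContDiffAt ℝ ∞ Ω z) (hY : ContDiffAt ℝ ∞ Y z)
    (halt : ∀ ξ η, JetEq mode z (fun w => Ω w ξ η) (fun w => -Ω w η ξ))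
    (hcl : ∀ ξ η ζ, JetEq mode z (fun w => HodgeCotangent.dTwo Ω w ξ η ζ) (fun _ => 0)) (ξ η : Z) :
    JetEq mode z
      (fun w => _root_.fderiv ℝ (fun w => Ω w (Y w)) w ξ η -
        _root_.fderiv ℝ (fun w => Ω w (Y w)) w η ξ)
      (fun w => _root_.fderiv ℝ Ω w (Y w) ξ η + Ω w (_root_.fderiv ℝ Y w ξ) η +
        Ω w ξ (_root_.fderiv ℝ Y w η)) := by
  have hΩ' : ContDiffAt ℝ ∞ (_root_.fderiv ℝ Ω) z := hΩ.fderiv_right (by simp)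
  have hY' : ContDiffAt ℝ ∞ (_root_.fderiv ℝ Y) z := hY.fderiv_right (by simp)
  -- Closedness is tested on constant vectors only; being linear in each argument, it may be used
  -- with the variable vector Y in one slot.
  have h1 : JetEq mode z
      (fun w => _root_.fderiv ℝ Ω w (Y w) ξ η - _root_.fderiv ℝ Ω w ξ (Y w) η +
        _root_.fderiv ℝ Ω w η (Y w) ξ) (fun _ => 0) := by
    have := JetEq.subst (mode := mode) (z := z)
      (A := fun w => ((_root_.fderiv ℝ Ω w).flip ξ).flip η - (_root_.fderiv ℝ Ω w ξ).flip η +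
        (_root_.fderiv ℝ Ω w η).flip ξ) (B := fun _ => 0) (fun ζ => by
          simpa [HodgeCotangent.dTwo] using hcl ζ ξ η) (JetEq.refl hY)
    simpa using this
  have h2 : JetEq mode z (fun w => Ω w (_root_.fderiv ℝ Y w η) ξ)
      (fun w => -Ω w ξ (_root_.fderiv ℝ Y w η)) := by
    have := JetEq.subst (mode := mode) (z := z) (A := fun w => (Ω w).flip ξ) (B := fun w => -Ω w ξ)
      (fun ζ => by simpa using halt ζ ξ)
      (JetEq.refl (hY'.clm_apply (contDiffAt_const (c := η))))
    simpa using this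
  have h3 : JetEq mode z (fun w => _root_.fderiv ℝ Ω w (Y w) ξ η + Ω w (_root_.fderiv ℝ Y w ξ) η)
      (fun w => _root_.fderiv ℝ Ω w (Y w) ξ η + Ω w (_root_.fderiv ℝ Y w ξ) η) :=
    JetEq.refl ((((hΩ'.clm_apply hY).clm_apply contDiffAt_const).clm_apply contDiffAt_const).add
      ((hΩ.clm_apply (hY'.clm_apply contDiffAt_const)).clm_apply contDiffAt_const))
  have h4 := (h3.sub h1).sub h2
  refine (h4.congr_left ?_).congr_right (.of_forall fun w => by simp)
  filter_upwards [eventually_differentiableAt hΩ, eventually_differentiableAt hY] with w d1 d2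
  rw [fderiv_clm_apply d1 d2]
  simp
  abel

end Bilinear

/-! ### The form ω_J + √-1 ω_K: type, antisymmetry, weight and closedness. -/

section FiniteDim

variable [FiniteDimensional ℂ E]

instance finiteDimensionalReal : FiniteDimensional ℝ E := FiniteDimensional.complexToReal E

variable {mode : Mode} {P : Set (E × E)} {I J : E × E → (E × E →L[ℝ] E × E)}
  {h : E × E → (E × E →L[ℝ] E × E →L[ℝ] ℝ)} {z : E × E}

/-- The form `ω_J + √-1 ω_K`. -/
def cForm {Z : Type*} [NormedAddCommGroup Z] [NormedSpace ℝ Z] (I J : Z →L[ℝ] Z)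
    (h : Z →L[ℝ] Z →L[ℝ] ℝ) : Z →L[ℝ] Z →L[ℝ] ℂ :=
  (ContinuousLinearMap.compL ℝ Z ℝ ℂ Complex.ofRealCLM).comp (h.comp J) +
    (ContinuousLinearMap.compL ℝ Z ℝ ℂ (Complex.I • Complex.ofRealCLM)).comp (h.comp (I.comp J))

@[simp] lemma cForm_apply {Z : Type*} [NormedAddCommGroup Z] [NormedSpace ℝ Z] (I J : Z →L[ℝ] Z)
    (h : Z →L[ℝ] Z →L[ℝ] ℝ) (ξ η : Z) :
    cForm I J h ξ η = (h (J ξ) η : ℂ) + Complex.I * (h (I (J ξ)) η : ℂ) := rfl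

namespace LocalHodge

lemma smooth_cForm (H : LocalHodge mode P I J h) (hz : z ∈ P) :
    ContDiffAt ℝ ∞ (fun w => cForm (I w) (J w) (h w)) z := by
  have h1 := H.smooth_I z hz
  have h2 := H.smooth_J z hz
  have h3 := H.smooth_h z hz
  exact (contDiffAt_const.clm_comp (h3.clm_comp h2)).add
    (contDiffAt_const.clm_comp (h3.clm_comp (h1.clm_comp h2)))

lemma jetEq_cForm {A B A' B' : E × E → ℝ} (hA : JetEq mode z A A')
    (hB : JetEq mode z B B') : JetEq mode z (fun w => (A w : ℂ) + Complex.I * (B w : ℂ))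
      (fun w => (A' w : ℂ) + Complex.I * (B' w : ℂ)) :=
  (hA.clm Complex.ofRealCLM).add (hB.clm (Complex.I • Complex.ofRealCLM))

lemma anticomm' (H : LocalHodge mode P I J h) (hz : z ∈ P) :
    JetEq mode z (fun w => (J w).comp (I w)) (fun w => -(I w).comp (J w)) :=
  ((H.anticomm z hz).neg.congr_right .rfl |>.congr_left .rfl).symm.congr_left
    (.of_forall fun w => by simp)

lemma IJI (H : LocalHodge mode P I J h) (hz : z ∈ P) :
    JetEq mode z (fun w => (I w).comp ((J w).comp (I w))) J := by
  have h1 := (JetEq.refl (H.smooth_I z hz)).comp (H.anticomm' hz)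
  have h2 := ((H.I_sq z hz).comp (JetEq.refl (H.smooth_J z hz))).neg
  refine (h1.trans (h2.congr_left (.of_forall fun w => ?_))).congr_right (.of_forall fun w => ?_)
  · refine ContinuousLinearMap.ext fun ξ => ?_
    simp
  · refine ContinuousLinearMap.ext fun ξ => ?_
    simp

/-- From JI = -IJ and IJI = J, inserting I turns ω_J into -ω_K and ω_K into ω_J, and -ω_K + √-1 ω_J
= √-1 (ω_J + √-1 ω_K). -/
lemma cForm_I (H : LocalHodge mode P I J h) (hz : z ∈ P) (ξ η : E × E) :
    JetEq mode z (fun w => cForm (I w) (J w) (h w) (I w ξ) η)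
      (fun w => Complex.I * cForm (I w) (J w) (h w) ξ η) := by
  have h3 := JetEq.refl (mode := mode) (H.smooth_h z hz)
  have h1 := (h3.apply ((H.anticomm' hz).apply_const ξ)).apply_const η
  have h2 := (h3.apply ((H.IJI hz).apply_const ξ)).apply_const η
  refine (jetEq_cForm h1 h2).congr_left (.of_forall fun w => ?_) |>.congr_right
    (.of_forall fun w => ?_)
  · simp
  · simp only [cForm_apply, ContinuousLinearMap.comp_apply, neg_apply, map_neg,
      Complex.ofReal_neg, mul_add, ← mul_assoc, Complex.I_mul_I]
    ring

lemma cForm_alt (H : LocalHodge mode P I J h) (hz : z ∈ P) (ξ η : E × E) :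
    JetEq mode z (fun w => cForm (I w) (J w) (h w) ξ η)
      (fun w => -cForm (I w) (J w) (h w) η ξ) := by
  have sJ := H.smooth_J z hz
  have sI := H.smooth_I z hz
  have sh := H.smooth_h z hz
  have rh := JetEq.refl (mode := mode) sh
  have hJ : ∀ {X Y : E × E → E × E}, ContDiffAt ℝ ∞ X z → ContDiffAt ℝ ∞ Y z →
      JetEq mode z (fun w => h w (J w (X w)) (J w (Y w))) (fun w => h w (X w) (Y w)) := by
    intro X Y hX hY
    exact JetEq.subst₂ (A := fun w => (h w).bilinearComp (J w) (J w)) (H.herm_J z hz)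
      (.refl hX) (.refl hY)
  have hI : ∀ {X Y : E × E → E × E}, ContDiffAt ℝ ∞ X z → ContDiffAt ℝ ∞ Y z →
      JetEq mode z (fun w => h w (I w (X w)) (I w (Y w))) (fun w => h w (X w) (Y w)) := by
    intro X Y hX hY
    exact JetEq.subst₂ (A := fun w => (h w).bilinearComp (I w) (I w)) (H.herm_I z hz)
      (.refl hX) (.refl hY)
  have hs : ∀ {X Y : E × E → E × E}, ContDiffAt ℝ ∞ X z → ContDiffAt ℝ ∞ Y z →
      JetEq mode z (fun w => h w (X w) (Y w)) (fun w => h w (Y w) (X w)) := by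
    intro X Y hX hY
    exact JetEq.subst₂ (B := fun w => (h w).flip) (H.symm z hz) (.refl hX) (.refl hY)
  have c : ∀ ζ : E × E, ContDiffAt ℝ ∞ (fun _ : E × E => ζ) z := fun ζ => contDiffAt_const
  have cJ : ∀ ζ : E × E, ContDiffAt ℝ ∞ (fun w => J w ζ) z := fun ζ => sJ.clm_apply (c ζ)
  have cI : ∀ ζ : E × E, ContDiffAt ℝ ∞ (fun w => I w ζ) z := fun ζ => sI.clm_apply (c ζ)
  have cIJ : ∀ ζ : E × E, ContDiffAt ℝ ∞ (fun w => I w (J w ζ)) z := fun ζ => sI.clm_apply (cJ ζ)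
  have cJI : ∀ ζ : E × E, ContDiffAt ℝ ∞ (fun w => J w (I w ζ)) z := fun ζ => sJ.clm_apply (cI ζ)
  have aJ : JetEq mode z (fun w => h w (J w ξ) η) (fun w => -h w (J w η) ξ) := by
    have t1 := (hJ (cJ ξ) (c η)).symm
    have t2 := ((rh.apply ((H.J_sq z hz).apply_const ξ)).apply (.refl (cJ η)))
    have t3 := (hs (c ξ) (cJ η)).neg
    exact (t1.trans t2).trans (t3.congr_left (.of_forall fun w => by simp))
  -- The chain is h(IJξ, η) = -h(Jξ, Iη) = h(ξ, JIη) = -h(ξ, IJη) = -h(IJη, ξ), where I and J are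
  -- moved across by the Hermitian property.
  have aK : JetEq mode z (fun w => h w (I w (J w ξ)) η) (fun w => -h w (I w (J w η)) ξ) := by
    have t1 := (hI (cIJ ξ) (c η)).symm
    have t2 := ((rh.apply ((H.I_sq z hz).apply (.refl (cJ ξ)))).apply (.refl (cI η)))
    have t3 := (hJ (cJ ξ) (cI η)).symm.neg
    have t4 := ((rh.apply ((H.J_sq z hz).apply_const ξ)).apply (.refl (cJI η))).neg
    have t5 := (rh.apply_const ξ).apply ((H.anticomm' hz).apply_const η)
    have t6 := (hs (c ξ) (cIJ η)).neg
    refine (t1.trans t2).trans ((t3.congr_left (.of_forall fun w => by simp)).trans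
      (t4.trans (t5.congr_left (.of_forall fun w => by simp)) |>.trans
        (t6.congr_left (.of_forall fun w => by simp))))
  refine (jetEq_cForm aJ aK).congr_right (.of_forall fun w => ?_)
  simp
  ring

lemma smooth_rot (H : LocalHodge mode P I J h) (hz : z ∈ P) (u : Circle) :
    ContDiffAt ℝ ∞ (fun w => I (rot u w)) z ∧ ContDiffAt ℝ ∞ (fun w => J (rot u w)) z ∧
      ContDiffAt ℝ ∞ (fun w => h (rot u w)) z := by
  have hr : ContDiffAt ℝ ∞ (rot (E := E) u) z := (rot (E := E) u).contDiff.contDiffAt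
  have hz' := H.rot_mem u z hz
  exact ⟨(H.smooth_I _ hz').comp z hr, (H.smooth_J _ hz').comp z hr, (H.smooth_h _ hz').comp z hr⟩

/-- Equivariance expresses the transported J as a rotation of J in the plane spanned by J and IJ.
Here this relation is solved for J at the rotated point, the inverse rotation having coefficients c
= re u and -s = -im u. -/
lemma J_rot (H : LocalHodge mode P I J h) (hz : z ∈ P) (u : Circle) :
    JetEq mode z (fun w => (J (rot u w)).comp (rot u))
      (fun w => (rot u).comp ((u : ℂ).re • J w - (u : ℂ).im • (I w).comp (J w))) := by
  obtain ⟨sI, sJ, sh⟩ := H.smooth_rot hz u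
  have hc : (u : ℂ).re * (u : ℂ).re + (u : ℂ).im * (u : ℂ).im = 1 := by
    have := Circle.normSq_coe u
    rwa [Complex.normSq_apply] at this
  have hr : ContDiffAt ℝ ∞ (rot (E := E) u) z := (rot (E := E) u).contDiff.contDiffAt
  have t0 := (H.I_sq _ (H.rot_mem u z hz)).comp_right hr
  have rR : JetEq mode z (fun _ => rot (E := E) u) (fun _ => rot (E := E) u) :=
    .refl contDiffAt_const
  have t1 := H.rot_J u z hz
  have t2 := ((JetEq.refl sI).comp t1)
  have t3 := ((H.rot_I u z hz).comp (JetEq.refl (mode := mode) (H.smooth_J z hz)))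
  have t4 := (t0.comp ((JetEq.refl (mode := mode) sJ).comp rR))
  -- `R (c J - s I J)` becomes `c (c J' + s I' J') R - s I' (c J' + s I' J') R`
  have e1 := (t1.clm ((u : ℂ).re • ContinuousLinearMap.id ℝ (E × E →L[ℝ] E × E))).sub
    ((t3.trans (t2.congr_left (.of_forall fun w => by
      rfl))).clm
        ((u : ℂ).im • ContinuousLinearMap.id ℝ (E × E →L[ℝ] E × E)))
  have e2 := ((JetEq.refl (mode := mode) (sJ.clm_comp (contDiffAt_const (c := rot (E := E) u)))).clm
    (((u : ℂ).re * (u : ℂ).re) • ContinuousLinearMap.id ℝ (E × E →L[ℝ] E × E))).sub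
    (t4.clm (((u : ℂ).im * (u : ℂ).im) • ContinuousLinearMap.id ℝ (E × E →L[ℝ] E × E)))
  refine (e1.trans (e2.congr_left (.of_forall fun w => ?_)) |>.congr_left
    (.of_forall fun w => ?_) |>.congr_right (.of_forall fun w => ?_)).symm
  · refine ContinuousLinearMap.ext fun ξ => ?_
    simp only [sub_apply, smul_apply,
      ContinuousLinearMap.comp_apply, add_apply, ContinuousLinearMap.id_apply,
      map_add, map_smul]
    module
  · refine ContinuousLinearMap.ext fun ξ => ?_
    simp only [sub_apply, smul_apply,
      ContinuousLinearMap.comp_apply, ContinuousLinearMap.id_apply,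
      map_sub, map_smul]
  · refine ContinuousLinearMap.ext fun ξ => ?_
    simp only [sub_apply, smul_apply,
      ContinuousLinearMap.comp_apply, ContinuousLinearMap.id_apply,
      neg_apply, smul_neg, sub_neg_eq_add]
    rw [← add_smul, hc, one_smul]

/-- Inserting `J_rot` into the invariant metric shows that pull-back by the rotation acts on the
pair (ω_J, ω_K) by a rotation matrix. -/
lemma rot_ω (H : LocalHodge mode P I J h) (hz : z ∈ P) (u : Circle) (ξ η : E × E) :
    JetEq mode z (fun w => h (rot u w) (J (rot u w) (rot u ξ)) (rot u η))
      (fun w => (u : ℂ).re * h w (J w ξ) η - (u : ℂ).im * h w (I w (J w ξ)) η) ∧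
    JetEq mode z (fun w => h (rot u w) (I (rot u w) (J (rot u w) (rot u ξ))) (rot u η))
      (fun w => (u : ℂ).re * h w (I w (J w ξ)) η + (u : ℂ).im * h w (J w ξ) η) := by
  obtain ⟨sI, sJ, sh⟩ := H.smooth_rot hz u
  have s1 := H.smooth_I z hz
  have s2 := H.smooth_J z hz
  have rh := JetEq.refl (mode := mode) sh
  have hh : ∀ {X Y : E × E → E × E}, ContDiffAt ℝ ∞ X z → ContDiffAt ℝ ∞ Y z →
      JetEq mode z (fun w => h (rot u w) (rot u (X w)) (rot u (Y w)))
        (fun w => h w (X w) (Y w)) := by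
    intro X Y hX hY
    exact JetEq.subst₂ (A := fun w => (h (rot u w)).bilinearComp (rot u) (rot u))
      (H.rot_h u z hz) (.refl hX) (.refl hY)
  have j := (H.J_rot hz u).apply_const ξ
  have sX : ContDiffAt ℝ ∞ (fun w => ((u : ℂ).re • J w - (u : ℂ).im • (I w).comp (J w)) ξ) z :=
    ((s2.const_smul _).sub ((s1.clm_comp s2).const_smul _)).clm_apply contDiffAt_const
  have sIX := s1.clm_apply sX
  constructor
  · have := ((rh.apply j).apply_const (rot u η)).trans (hh sX contDiffAt_const)
    exact this.congr_right (.of_forall fun w => by simp)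
  · have i := ((JetEq.refl (mode := mode) sI).apply j).trans
      (((H.rot_I u z hz).apply (.refl sX)).symm.congr_left (.of_forall fun w => rfl))
    have := (((rh.apply i).apply_const (rot u η)).congr_right (.of_forall fun w => rfl)).trans
      (hh sIX contDiffAt_const)
    have q := ((JetEq.refl (mode := mode) (H.smooth_h z hz)).apply ((H.I_sq z hz).apply
      (.refl (s2.clm_apply (contDiffAt_const (c := ξ)))))).apply_const η
    have q' := ((JetEq.refl (mode := mode) (((contDiffAt_const (c := (u : ℂ).re)).mul
      (((H.smooth_h z hz).clm_apply (s1.clm_apply (s2.clm_apply (contDiffAt_const (c := ξ))))).clm_apply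
        (contDiffAt_const (c := η)))))).sub (q.clm ((u : ℂ).im • ContinuousLinearMap.id ℝ ℝ)))
    exact this.trans (q'.congr_left (.of_forall fun w => by simp)) |>.congr_right
      (.of_forall fun w => by simp)

/-- The rotation matrix of `rot_ω` is multiplication by u = c + √-1 s on ω_J + √-1 ω_K. -/
lemma rot_cForm (H : LocalHodge mode P I J h) (hz : z ∈ P) (u : Circle) (ξ η : E × E) :
    JetEq mode z
      (fun w => cForm (I (rot u w)) (J (rot u w)) (h (rot u w)) (rot u ξ) (rot u η))
      (fun w => (u : ℂ) * cForm (I w) (J w) (h w) ξ η) := by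
  have := H.rot_ω hz u ξ η
  refine (jetEq_cForm this.1 this.2).congr_right (.of_forall fun w => ?_)
  simp only [cForm_apply]
  conv_lhs => rw [← Complex.re_add_im (u : ℂ)]
  push_cast
  linear_combination ((u : ℂ).im * (h w (I w (J w ξ)) η : ℂ)) * Complex.I_mul_I

/-- Closedness of ω_K follows from that of ω_J, because ω_K is the pull-back of ω_J under one of the
rotations. -/
lemma closed_cForm (H : LocalHodge mode P I J h) (hz : z ∈ P) (ξ η ζ : E × E) :
    JetEq mode z (fun w => dTwo (fun w => cForm (I w) (J w) (h w)) w ξ η ζ) (fun _ => 0) := by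
  have s1 := H.smooth_I z hz
  have s2 := H.smooth_J z hz
  have s3 := H.smooth_h z hz
  -- For u = -√-1 one has c = 0 and s = -1, so that R^*ω_J = ω_K with the right sign.
  let R : E × E →L[ℝ] E × E := rot (Circle.exp (-(Real.pi / 2)))
  have hz' := H.rot_mem (Circle.exp (-(Real.pi / 2))) z hz
  have s4 : ContDiffAt ℝ ∞ (fun w => (h w).comp (J w)) z := s3.clm_comp s2
  have s5 : ContDiffAt ℝ ∞ (fun w => (h w).comp ((I w).comp (J w))) z :=
    s3.clm_comp (s1.clm_comp s2)
  have s6 : ContDiffAt ℝ ∞ (fun w => (h w).comp (J w)) (R z) :=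
    (H.smooth_h _ hz').clm_comp (H.smooth_J _ hz')
  have e : ((Circle.exp (-(Real.pi / 2)) : Circle) : ℂ) = -Complex.I := by
    rw [Circle.coe_exp]
    push_cast
    rw [neg_mul, Complex.exp_neg, Complex.exp_pi_div_two_mul_I, Complex.inv_I]
  have t1 : JetEq mode z (fun w => ((h (R w)).comp (J (R w))).bilinearComp R R)
      (fun w => (h w).comp ((I w).comp (J w))) := by
    refine JetEq.clm_ext fun ξ => JetEq.clm_ext fun η => ?_
    have := (H.rot_ω hz (Circle.exp (-(Real.pi / 2))) ξ η).1
    refine this.congr_right (.of_forall fun w => ?_)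
    simp
  have t2 := (H.closed_J _ hz' (R ξ) (R η) (R ζ)).comp_right (φ := R) R.contDiff.contDiffAt
  have t3 : JetEq mode z (fun w => dTwo (fun w => (h w).comp ((I w).comp (J w))) w ξ η ζ)
      (fun _ => 0) := by
    refine (t1.symm.dTwo ξ η ζ).trans (t2.congr_left ?_)
    have ev := R.continuous.continuousAt.eventually (eventually_differentiableAt s6)
    filter_upwards [ev, eventually_differentiableAt t1.left] with w hw hd
    have d : DifferentiableAt ℝ (fun w => ((h (R w)).comp (J (R w))).bilinearComp R R) w := hd
    have hb : ∀ a b c, fderiv ℝ (fun w => ((h (R w)).comp (J (R w))).bilinearComp R R) w a b c =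
        fderiv ℝ (fun w => (h w).comp (J w)) (R w) (R a) (R b) (R c) := by
      intro a b c
      rw [← fderiv_apply₂ d, ← fderiv_apply₂ hw]
      have := (fderiv_comp w (g := fun w => ((h w).comp (J w)) (R b) (R c)) (f := R)
        ((hw.clm_apply (differentiableAt_const _)).clm_apply (differentiableAt_const _))
        R.differentiableAt)
      rw [R.fderiv] at this
      exact congrArg (fun l => l a) this
    simp only [dTwo, hb]
  have t4 := (H.closed_J z hz ξ η ζ).clm Complex.ofRealCLM
  have t5 := t3.clm (Complex.I • Complex.ofRealCLM)
  refine ((t4.add t5).congr_left ?_).congr_right (.of_forall fun w => by simp)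
  filter_upwards [eventually_differentiableAt s4, eventually_differentiableAt s5,
    eventually_differentiableAt (H.smooth_cForm hz)] with w d4 d5 d6
  have hb : ∀ a b c, fderiv ℝ (fun w => cForm (I w) (J w) (h w)) w a b c =
      (fderiv ℝ (fun w => (h w).comp (J w)) w a b c : ℂ) +
      Complex.I * (fderiv ℝ (fun w => (h w).comp ((I w).comp (J w))) w a b c : ℂ) := by
    intro a b c
    rw [← fderiv_apply₂ d6, ← fderiv_apply₂ d4, ← fderiv_apply₂ d5]
    have e4 := ((d4.clm_apply (differentiableAt_const b)).clm_apply (differentiableAt_const c))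
    have e5 := ((d5.clm_apply (differentiableAt_const b)).clm_apply (differentiableAt_const c))
    have e6 := (Complex.ofRealCLM.hasFDerivAt.comp w e4.hasFDerivAt).add
      ((Complex.I • Complex.ofRealCLM).hasFDerivAt.comp w e5.hasFDerivAt)
    exact congrArg (fun l => l a) e6.fderiv
  simp only [dTwo, hb]
  simp
  ring

end LocalHodge

end FiniteDim

end Local
-- Infinitesimal equivariance, and uniqueness of equivariant primitives.
section LocalMap

universe u

variable {E : Type u} [NormedAddCommGroup E] [NormedSpace ℂ E]

lemma rot_exp_apply (θ : ℝ) (ξ : E × E) :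
    rot (Circle.exp θ) ξ = (ξ.1, Complex.exp (-(θ * Complex.I)) • ξ.2) := by
  rw [rot_apply, Circle.coe_exp, ← Complex.exp_conj]
  simp

lemma contDiff_rot_exp : ContDiff ℝ ∞ (fun q : ℝ × (E × E) => rot (Circle.exp q.1) q.2) := by
  simp only [rot_exp_apply]
  have h1 : ContDiff ℝ ∞ (fun q : ℝ × (E × E) => Complex.exp (-((q.1 : ℂ) * Complex.I))) :=
    (((Complex.ofRealCLM.contDiff.comp contDiff_fst).mul contDiff_const).neg).cexp
  exact (contDiff_fst.comp contDiff_snd).prodMk (h1.smul (contDiff_snd.comp contDiff_snd))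

lemma hasDerivAt_rot_exp (ξ : E × E) :
    HasDerivAt (fun θ : ℝ => rot (Circle.exp θ) ξ) (gen E ξ) 0 := by
  simp only [rot_exp_apply]
  have h1 : HasDerivAt (fun θ : ℝ => Complex.exp (-((θ : ℂ) * Complex.I))) (-Complex.I) 0 := by
    have := ((Complex.ofRealCLM.hasDerivAt (x := (0 : ℝ))).mul_const Complex.I).neg.cexp
    simpa using! this
  exact (hasDerivAt_const (0 : ℝ) ξ.1).prodMk (h1.smul_const ξ.2)

lemma hasDerivAt_circle_exp :
    HasDerivAt (fun θ : ℝ => ((Circle.exp θ : Circle) : ℂ)) Complex.I 0 := by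
  simp only [Circle.coe_exp]
  have := ((Complex.ofRealCLM.hasDerivAt (x := (0 : ℝ))).mul_const Complex.I).cexp
  simpa using! this

lemma contDiff_circle_exp : ContDiff ℝ ∞ (fun θ : ℝ => ((Circle.exp θ : Circle) : ℂ)) := by
  simp only [Circle.coe_exp]
  exact (Complex.ofRealCLM.contDiff.mul contDiff_const).cexp

variable [FiniteDimensional ℂ E]

variable {mode : Mode} {P : Set (E × E)} {z : E × E}

/-- The infinitesimal form of the equivariance of a `2`-form of weight `1`. -/
lemma JetEq.lie_of_rot {Ω : E × E → E × E →L[ℝ] E × E →L[ℝ] ℂ} (hP : mode = .actual → IsOpen P)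
    (hΩ : ∀ z ∈ P, ContDiffAt ℝ ∞ Ω z)
    (hrot : ∀ u : Circle, ∀ z ∈ P, ∀ ξ η,
      JetEq mode z (fun w => Ω (rot u w) (rot u ξ) (rot u η)) (fun w => (u : ℂ) * Ω w ξ η))
    (hz : z ∈ P) (ξ η : E × E) :
    JetEq mode z
      (fun w => _root_.fderiv ℝ Ω w (gen E w) ξ η + Ω w (gen E ξ) η + Ω w ξ (gen E η))
      (fun w => Complex.I * Ω w ξ η) := by
  have c : ∀ ζ : E × E, ContDiffAt ℝ ∞ (fun _ : E × E => ζ) z := fun ζ => contDiffAt_const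
  have hΩ' : ContDiffAt ℝ ∞ (_root_.fderiv ℝ Ω) z := (hΩ z hz).fderiv_right (by simp)
  have sΩ : ∀ {z}, z ∈ P → ContDiffAt ℝ ∞ (fun w => Ω w ξ η) z := fun hz =>
    ((hΩ _ hz).clm_apply contDiffAt_const).clm_apply contDiffAt_const
  -- The family is R_θ^*Ω - exp(√-1 θ)Ω, which is zero for every θ. Its θ-derivative at 0 is L_φ Ω -
  -- √-1 Ω.
  refine JetEq.of_sub ?_ (JetEq.deriv_param hP
    (F := fun θ w => Ω (rot (Circle.exp θ) w) (rot (Circle.exp θ) ξ) (rot (Circle.exp θ) η) -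
      (Circle.exp θ : ℂ) * Ω w ξ η) ?_ (fun z hz θ => (hrot _ z hz ξ η).sub_zero_iff) ?_ hz ?_)
  · exact contDiffAt_const.mul (sΩ hz)
  · intro z hz
    have hr : ContDiffAt ℝ ∞ (fun q : ℝ × (E × E) => rot (Circle.exp q.1) q.2) (0, z) :=
      contDiff_rot_exp.contDiffAt
    have hr' : ∀ ξ : E × E, ContDiffAt ℝ ∞
        (fun q : ℝ × (E × E) => rot (Circle.exp q.1) ξ) (0, z) := fun ξ =>
      (contDiff_rot_exp.comp (contDiff_fst.prodMk contDiff_const)).contDiffAt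
    have h1 : ContDiffAt ℝ ∞ (fun q : ℝ × (E × E) => Ω (rot (Circle.exp q.1) q.2)) (0, z) :=
      ContDiffAt.comp (g := Ω) (0, z) (by simpa using hΩ z hz) hr
    exact ((h1.clm_apply (hr' ξ)).clm_apply (hr' η)).sub
      ((contDiff_circle_exp.contDiffAt.comp (0, z) contDiffAt_fst).mul
        ((sΩ hz).comp (0, z) contDiffAt_snd))
  · intro z hz
    filter_upwards [eventually_differentiableAt (hΩ z hz)] with w hw
    have h1 : HasDerivAt (fun θ : ℝ => Ω (rot (Circle.exp θ) w)) (_root_.fderiv ℝ Ω w (gen E w)) 0 :=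
      HasFDerivAt.comp_hasDerivAt (l := Ω) (0 : ℝ) (by simpa using hw.hasFDerivAt)
        (hasDerivAt_rot_exp w)
    have h2 := (((h1.clm_apply (hasDerivAt_rot_exp ξ)).clm_apply (hasDerivAt_rot_exp η))).sub
      (hasDerivAt_circle_exp.mul_const (Ω w ξ η))
    refine h2.congr_deriv ?_
    simp
  · have hΩz := hΩ z hz
    have hg : ContDiffAt ℝ ∞ (fun w => gen E w) z := (gen E).contDiff.contDiffAt
    exact (((((hΩ'.clm_apply hg).clm_apply (c ξ)).clm_apply (c η)).add
      ((hΩz.clm_apply (c _)).clm_apply (c η))).add ((hΩz.clm_apply (c ξ)).clm_apply (c _))).sub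
      (contDiffAt_const.mul (sΩ hz))

/-- The infinitesimal form of the equivariance of a function of weight `1`. -/
lemma JetEq.deriv_gen_of_rot {G : Type*} [NormedAddCommGroup G] [NormedSpace ℂ G]
    {k : E × E → G} (hP : mode = .actual → IsOpen P)
    (hk : ∀ z ∈ P, ContDiffAt ℝ ∞ k z)
    (hrot : ∀ u : Circle, ∀ z ∈ P, JetEq mode z (fun w => k (rot u w)) (fun w => (u : ℂ) • k w))
    (hz : z ∈ P) :
    JetEq mode z (fun w => _root_.fderiv ℝ k w (gen E w)) (fun w => Complex.I • k w) := by
  have hk' : ContDiffAt ℝ ∞ (_root_.fderiv ℝ k) z := (hk z hz).fderiv_right (by simp)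
  refine JetEq.of_sub (contDiffAt_const.smul (hk z hz)) (JetEq.deriv_param hP
    (F := fun θ w => k (rot (Circle.exp θ) w) - (Circle.exp θ : ℂ) • k w) ?_
    (fun z hz θ => (hrot _ z hz).sub_zero_iff) ?_ hz ?_)
  · intro z hz
    exact (ContDiffAt.comp (g := k) (0, z) (by simpa using hk z hz)
      contDiff_rot_exp.contDiffAt).sub
      ((contDiff_circle_exp.contDiffAt.comp (0, z) contDiffAt_fst).smul
        ((hk z hz).comp (0, z) contDiffAt_snd))
  · intro z hz
    filter_upwards [eventually_differentiableAt (hk z hz)] with w hw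
    have h1 : HasDerivAt (fun θ : ℝ => k (rot (Circle.exp θ) w)) (_root_.fderiv ℝ k w (gen E w)) 0 :=
      HasFDerivAt.comp_hasDerivAt (l := k) (0 : ℝ) (by simpa using hw.hasFDerivAt)
        (hasDerivAt_rot_exp w)
    exact h1.sub (hasDerivAt_circle_exp.smul_const (k w))
  · exact (hk'.clm_apply (gen E).contDiff.contDiffAt).sub (contDiffAt_const.smul (hk z hz))

/-- The form `-√-1 ι_φ Ω`, where `φ` generates the action of `U(1)`. -/
def contraction (Ω : E × E → E × E →L[ℝ] E × E →L[ℝ] ℂ) (w : E × E) : E × E →L[ℝ] ℂ :=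
  -Complex.I • Ω w (gen E w)

/-- Equivariant primitives are unique. -/
lemma JetEq.eq_contraction {Ω : E × E → E × E →L[ℝ] E × E →L[ℝ] ℂ} {k : E × E → E →L[ℂ] ℂ}
    (hP : mode = .actual → IsOpen P)
    (hk : ∀ z ∈ P, ContDiffAt ℝ ∞ k z)
    (hrot : ∀ u : Circle, ∀ z ∈ P, JetEq mode z (fun w => k (rot u w)) (fun w => (u : ℂ) • k w))
    (hs : ∀ z ∈ P, ∀ ξ η, JetEq mode z
      (fun w => _root_.fderiv ℝ k w ξ η.1 - _root_.fderiv ℝ k w η ξ.1) (fun w => Ω w ξ η))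
    (hz : z ∈ P) (η : E × E) :
    JetEq mode z (fun w => k w η.1) (fun w => contraction Ω w η) := by
  let ev : E → (E →L[ℂ] ℂ) →L[ℝ] ℂ := fun a => (ContinuousLinearMap.apply ℂ ℂ a).restrictScalars ℝ
  have h1 := ((JetEq.deriv_gen_of_rot hP hk hrot hz).clm (ev η.1))
  -- Put ξ = φ. The second term of the exterior derivative disappears because φ has no base
  -- component, so √-1 k = D_φ k is the contraction of Ω with φ.
  have h2 := JetEq.subst (mode := mode) (z := z)
    (A := fun w => (ev η.1).comp (_root_.fderiv ℝ k w) -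
      ((_root_.fderiv ℝ k w η).restrictScalars ℝ).comp (ContinuousLinearMap.fst ℝ E E))
    (B := fun w => (Ω w).flip η) (fun ξ => hs z hz ξ η)
    (JetEq.refl (gen E).contDiff.contDiffAt)
  have h3 := (h1.symm.trans (h2.congr_left (.of_forall fun w => by simp [ev]))).clm
    (-Complex.I • ContinuousLinearMap.id ℝ ℂ)
  refine (h3.congr_left (.of_forall fun w => ?_)).congr_right (.of_forall fun w => ?_)
  · simp [ev, ← mul_assoc]
  · simp [contraction]

end LocalMap
-- The fibres of the projection are Lagrangian.
section Vertical

universe u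

variable {E : Type u} [NormedAddCommGroup E] [NormedSpace ℂ E] [FiniteDimensional ℂ E]

variable {mode : Mode} {P : Set (E × E)} {I J : E × E → (E × E →L[ℝ] E × E)}
  {h : E × E → (E × E →L[ℝ] E × E →L[ℝ] ℝ)} {z : E × E}

/-- The operator governing the growth of the vertical part of a `2`-form along a vector field
with vertical derivative `N`. -/
def vertOp (N : E →L[ℝ] E) : (E →L[ℝ] E →L[ℝ] ℂ) →L[ℝ] (E →L[ℝ] E →L[ℝ] ℂ) :=
  LinearMap.toContinuousLinearMap
    { toFun := fun T => -T - T.comp N - (T.flip.comp N).flip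
      map_add' := fun S T => by
        ext v v'
        simp
        ring
      map_smul' := fun c T => by
        ext v v'
        simp
        ring }

@[simp] lemma vertOp_apply (N : E →L[ℝ] E) (T : E →L[ℝ] E →L[ℝ] ℂ) (v v' : E) :
    vertOp N T v v' = -T v v' - T (N v) v' - T v (N v') := rfl

/-- The restriction of a `2`-form to vertical vectors. -/
def vert (Ω : E × E → E × E →L[ℝ] E × E →L[ℝ] ℂ) (w : E × E) : E →L[ℝ] E →L[ℝ] ℂ :=
  (Ω w).bilinearComp (ContinuousLinearMap.inr ℝ E E) (ContinuousLinearMap.inr ℝ E E)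

@[simp] lemma vert_apply (Ω : E × E → E × E →L[ℝ] E × E →L[ℝ] ℂ) (w : E × E) (v v' : E) :
    vert Ω w v v' = Ω w (0, v) (0, v') := rfl

/-- The form `ω_J + √-1 ω_K` in coordinates. -/
def locForm (I J : E × E → (E × E →L[ℝ] E × E)) (h : E × E → (E × E →L[ℝ] E × E →L[ℝ] ℝ))
    (w : E × E) : E × E →L[ℝ] E × E →L[ℝ] ℂ :=
  cForm (I w) (J w) (h w)

lemma smooth_vert {Ω : E × E → E × E →L[ℝ] E × E →L[ℝ] ℂ} (hΩ : ContDiffAt ℝ ∞ Ω z) :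
    ContDiffAt ℝ ∞ (vert Ω) z :=
  contDiffAt_bilinearComp hΩ contDiffAt_const contDiffAt_const

lemma smooth_contraction {Ω : E × E → E × E →L[ℝ] E × E →L[ℝ] ℂ} (hΩ : ContDiffAt ℝ ∞ Ω z) :
    ContDiffAt ℝ ∞ (contraction Ω) z :=
  (hΩ.clm_apply (gen E).contDiff.contDiffAt).const_smul _

namespace LocalHodge

lemma smooth_locForm (H : LocalHodge mode P I J h) (hz : z ∈ P) :
    ContDiffAt ℝ ∞ (locForm I J h) z :=
  H.smooth_cForm hz

lemma lie (H : LocalHodge mode P I J h) (hz : z ∈ P) (ξ η : E × E) :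
    JetEq mode z
      (fun w => fderiv ℝ (locForm I J h) w (gen E w) ξ η + locForm I J h w (gen E ξ) η +
        locForm I J h w ξ (gen E η))
      (fun w => Complex.I * locForm I J h w ξ η) :=
  JetEq.lie_of_rot H.isOpen (fun _ hz => H.smooth_locForm hz)
    (fun u _ hz ξ η => H.rot_cForm hz u ξ η) hz ξ η

/-- The form `-√-1 ι_φ Ω` is a primitive of `Ω`. -/
lemma deriv_contraction (H : LocalHodge mode P I J h) (hz : z ∈ P) (ξ η : E × E) :
    JetEq mode z
      (fun w => fderiv ℝ (contraction (locForm I J h)) w ξ η -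
        fderiv ℝ (contraction (locForm I J h)) w η ξ)
      (fun w => locForm I J h w ξ η) := by
  have hΩ := H.smooth_locForm hz
  have hg : ContDiffAt ℝ ∞ (fun w => gen E w) z := (gen E).contDiff.contDiffAt
  -- For closed Ω, Cartan's formula reads d ι_φ Ω = L_φ Ω, and L_φ Ω = √-1 Ω. Multiplication by -√-1
  -- gives the claim.
  have h1 := JetEq.cartan (mode := mode) hΩ hg (H.cForm_alt hz) (H.closed_cForm hz) ξ η
  have hfg : ∀ w, fderiv ℝ (fun w => gen E w) w = gen E := fun w => (gen E).fderiv
  simp only [hfg] at h1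
  have h2 := (h1.trans (H.lie hz ξ η)).clm (-Complex.I • ContinuousLinearMap.id ℝ ℂ)
  refine (h2.congr_left ?_).congr_right (.of_forall fun w => ?_)
  · filter_upwards [eventually_differentiableAt (hΩ.clm_apply hg)] with w hw
    have : fderiv ℝ (contraction (locForm I J h)) w =
        -Complex.I • fderiv ℝ (fun w => locForm I J h w (gen E w)) w :=
      (hw.hasFDerivAt.const_smul (-Complex.I)).fderiv
    rw [this]
    simp
    ring
  · simp [← mul_assoc]

/-- The vector field `Iφ`. -/
def field (I : E × E → (E × E →L[ℝ] E × E)) (w : E × E) : E × E := I w (gen E w)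

lemma smooth_field (H : LocalHodge mode P I J h) (hz : z ∈ P) : ContDiffAt ℝ ∞ (field I) z :=
  (H.smooth_I z hz).clm_apply (gen E).contDiff.contDiffAt

/-- By the type of Ω, contracting with Iφ gives √-1 ι_φ Ω, which is minus the primitive of Ω. Hence
L_{Iφ} Ω = d ι_{Iφ} Ω = -Ω. -/
lemma lie_field (H : LocalHodge mode P I J h) (hz : z ∈ P) (ξ η : E × E) :
    JetEq mode z
      (fun w => fderiv ℝ (locForm I J h) w (field I w) ξ η +
        locForm I J h w (fderiv ℝ (field I) w ξ) η + locForm I J h w ξ (fderiv ℝ (field I) w η))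
      (fun w => -locForm I J h w ξ η) := by
  have hΩ := H.smooth_locForm hz
  have hg : ContDiffAt ℝ ∞ (fun w => gen E w) z := (gen E).contDiff.contDiffAt
  have h1 := JetEq.cartan (mode := mode) hΩ (H.smooth_field hz) (H.cForm_alt hz)
    (H.closed_cForm hz) ξ η
  have h2 : JetEq mode z (fun w => locForm I J h w (field I w))
      (fun w => -contraction (locForm I J h) w) := by
    refine JetEq.clm_ext fun η => ?_
    have := JetEq.subst (mode := mode) (z := z)
      (A := fun w => ((locForm I J h w).comp (I w)).flip η)
      (B := fun w => Complex.I • (locForm I J h w).flip η)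
      (fun ξ => H.cForm_I hz ξ η) (JetEq.refl hg)
    refine (this.congr_left (.of_forall fun w => rfl)).congr_right (.of_forall fun w => ?_)
    simp [contraction]
  have h3 := h2.fderiv
  have h4 := (((h3.apply_const ξ).apply_const η).sub ((h3.apply_const η).apply_const ξ))
  refine (h1.symm.trans h4).trans ((H.deriv_contraction hz ξ η).neg.congr_left
    (.of_forall fun w => ?_))
  have : fderiv ℝ (fun w => -contraction (locForm I J h) w) w =
      -fderiv ℝ (contraction (locForm I J h)) w := fderiv_neg
  simp only [this, neg_apply]
  ring

/-- Holomorphy of the projection gives dρ(Iφ) = √-1 dρ(φ), and φ is vertical. -/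
lemma field_fst (H : LocalHodge mode P I J h) (hz : z ∈ P) :
    JetEq mode z (fun w => (field I w).1) (fun _ => 0) := by
  have := (H.proj z hz).apply (JetEq.refl (gen E).contDiff.contDiffAt)
  exact (this.congr_left (.of_forall fun w => rfl)).congr_right (.of_forall fun w => by simp)

/-- The vertical part of the derivative of the field `Iφ` in vertical directions. -/
def fieldDeriv (I : E × E → (E × E →L[ℝ] E × E)) (w : E × E) : E →L[ℝ] E :=
  (ContinuousLinearMap.snd ℝ E E).comp
    ((fderiv ℝ (field I) w).comp (ContinuousLinearMap.inr ℝ E E))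

lemma smooth_fieldDeriv (H : LocalHodge mode P I J h) (hz : z ∈ P) :
    ContDiffAt ℝ ∞ (fieldDeriv I) z :=
  contDiffAt_const.clm_comp
    (((H.smooth_field hz).fderiv_right (m := ∞) (by simp)).clm_comp contDiffAt_const)

lemma smooth_vertOp {N : E × E → E →L[ℝ] E} (hN : ContDiffAt ℝ ∞ N z) :
    ContDiffAt ℝ ∞ (fun w => vertOp (N w)) z := by
  refine contDiffAt_clm_of_apply fun T => contDiffAt_clm_of_apply₂ fun v v' => ?_
  simp only [vertOp_apply]
  have c : ∀ ζ : E, ContDiffAt ℝ ∞ (fun _ : E × E => ζ) z := fun ζ => contDiffAt_const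
  have cT : ContDiffAt ℝ ∞ (fun _ : E × E => T) z := contDiffAt_const
  exact (contDiffAt_const.sub ((cT.clm_apply (hN.clm_apply (c v))).clm_apply (c v'))).sub
    ((cT.clm_apply (c v)).clm_apply (hN.clm_apply (c v')))

/-- Since Iφ is vertical, its derivative maps vertical vectors to vertical ones. Restricting L_{Iφ}
Ω = -Ω to vertical vectors therefore gives an equation that involves only the vertical part of Ω. -/
lemma transport_vert (H : LocalHodge mode P I J h) (hz : z ∈ P) :
    JetEq mode z (fun w => fderiv ℝ (vert (locForm I J h)) w (field I w))
      (fun w => vertOp (fieldDeriv I w) (vert (locForm I J h) w)) := by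
  have hΩ := H.smooth_locForm hz
  have hX := H.smooth_field hz
  have hX' : ContDiffAt ℝ ∞ (fderiv ℝ (field I)) z := hX.fderiv_right (by simp)
  have rΩ := JetEq.refl (mode := mode) hΩ
  have hv : ∀ v : E, JetEq mode z (fun w => fderiv ℝ (field I) w (0, v))
      (fun w => ((0 : E), fieldDeriv I w v)) := by
    intro v
    have h1 := (H.field_fst hz).fderiv.apply_const ((0 : E), v)
    have h2 : JetEq mode z (fun w => (fderiv ℝ (field I) w (0, v)).1) (fun _ => 0) := by
      refine (h1.congr_left ?_).congr_right (.of_forall fun w => by simp)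
      filter_upwards [eventually_differentiableAt hX] with w hw
      rw [hw.hasFDerivAt.fst.fderiv]
      rfl
    exact (h2.prodMk (JetEq.refl ((H.smooth_fieldDeriv hz).clm_apply
      (contDiffAt_const (c := v))))).congr_left (.of_forall fun w => rfl)
  refine JetEq.clm_ext fun v => JetEq.clm_ext fun v' => ?_
  have h1 := H.lie_field hz (0, v) (0, v')
  have h2 := (rΩ.apply (hv v)).apply_const ((0 : E), v')
  have h3 := (rΩ.apply_const ((0 : E), v)).apply (hv v')
  refine ((h1.sub h2).sub h3).congr_left ?_ |>.congr_right (.of_forall fun w => ?_)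
  · filter_upwards [eventually_differentiableAt hΩ,
      eventually_differentiableAt (smooth_vert hΩ)] with w h1 h2
    rw [← fderiv_apply₂ h2, ← fderiv_apply₂ h1]
    simp only [vert_apply]
    ring
  · simp

/-- Points of the zero section are fixed by U(1), so equivariance there is plain linear algebra. The
elements u = -1 and u = √-1 suffice. -/
lemma I_vert (H : LocalHodge mode P I J h) (hz : z ∈ P) (h0 : z.2 = 0) (v : E) :
    I z (0, v) = (0, -Complex.I • v) ∧ Function.Bijective fun v : E => (J z (0, v)).1 := by
  have hr : ∀ u : Circle, rot u z = z := fun u => by ext <;> simp [h0]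
  have hJJ : ∀ ξ, J z (J z ξ) = -ξ := fun ξ => by
    simpa using congrArg (fun A => A ξ) (H.J_sq z hz).eq_at
  -- For u = -1 the rotation fixes base vectors, negates vertical ones and anticommutes with J. So J
  -- maps base vectors to vertical vectors.
  have hJ1 : ∀ a : E, (J z (a, 0)).1 = 0 := by
    intro a
    have := congrArg (fun A => (A (a, (0 : E))).1) (H.rot_J (Circle.exp Real.pi) z hz).eq_at
    have h2 : (J z (a, 0)).1 = -(J z (a, 0)).1 := by simpa [hr] using this
    have h3 : (2 : ℝ) • (J z (a, 0)).1 = 0 := by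
      rw [two_smul]; nth_rewrite 1 [h2]; simp
    simpa using h3
  have inj : Function.Injective fun a : E => (J z (a, 0)).2 := by
    intro a b hab
    have : J z (a, 0) = J z (b, 0) := Prod.ext (by rw [hJ1, hJ1]) hab
    have h2 := congrArg (J z) this
    rw [hJJ, hJJ] at h2
    simpa using congrArg Prod.fst h2
  let L : E →L[ℝ] E := (ContinuousLinearMap.snd ℝ E E).comp ((J z).comp
    (ContinuousLinearMap.inl ℝ E E))
  have surj : Function.Surjective fun a : E => (J z (a, 0)).2 :=
    (LinearMap.injective_iff_surjective (f := (L : E →ₗ[ℝ] E))).1 inj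
  constructor
  -- Every vertical vector is J(a, 0) for some a. For u = √-1 the relation RJ = IJR, applied to (a,
  -- 0), says that I acts on J(a, 0) as the rotation does, that is, by -√-1.
  · obtain ⟨a, rfl⟩ := surj v
    have e : ((0 : E), (J z (a, 0)).2) = J z (a, 0) := Prod.ext (hJ1 a).symm rfl
    have := congrArg (fun A => A (a, (0 : E))) (H.rot_J (Circle.exp (Real.pi / 2)) z hz).eq_at
    simp only [hr, ContinuousLinearMap.comp_apply, add_apply, smul_apply] at this
    have hu : ((Circle.exp (Real.pi / 2) : Circle) : ℂ) = Complex.I := by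
      rw [Circle.coe_exp]; push_cast; rw [Complex.exp_pi_div_two_mul_I]
    rw [rot_apply, rot_apply, hu] at this
    simp only [Complex.I_re, Complex.I_im, zero_smul, one_smul, zero_add, smul_zero,
      Complex.conj_I, hJ1] at this
    beta_reduce
    rw [e, ← this]
  · let L' : E →L[ℝ] E := (ContinuousLinearMap.fst ℝ E E).comp ((J z).comp
      (ContinuousLinearMap.inr ℝ E E))
    have inj' : Function.Injective L' := by
      rw [injective_iff_map_eq_zero]
      intro v hv
      obtain ⟨a, rfl⟩ := surj v
      have e : ((0 : E), (J z (a, 0)).2) = J z (a, 0) := Prod.ext (hJ1 a).symm rfl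
      have h2 : L' (J z (a, 0)).2 = -a := by
        change (J z (0, (J z (a, 0)).2)).1 = -a
        rw [e, hJJ]; rfl
      beta_reduce at hv
      rw [h2, neg_eq_zero] at hv
      subst hv
      beta_reduce
      have : ((0 : E), (0 : E)) = 0 := rfl
      rw [this, map_zero]; rfl
    exact ⟨inj', (LinearMap.injective_iff_surjective (f := (L' : E →ₗ[ℝ] E))).1 inj'⟩

/-- Because φ vanishes on the zero section, the derivative of Iφ is I ∘ Dφ there. On vertical
vectors both factors are multiplication by -√-1, and their product is -1. -/
lemma fderiv_field (H : LocalHodge mode P I J h) (hz : z ∈ P) (h0 : z.2 = 0) :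
    fderiv ℝ (field I) z = -((ContinuousLinearMap.inr ℝ E E).comp
      (ContinuousLinearMap.snd ℝ E E)) := by
  have hI := (H.smooth_I z hz).differentiableAt (by simp)
  have hg : gen E z = 0 := by simp [h0]
  refine ContinuousLinearMap.ext fun ξ => ?_
  have : fderiv ℝ (field I) z = _ :=
    fderiv_clm_apply hI (gen E).differentiableAt
  rw [this]
  simp only [hg, ContinuousLinearMap.comp_apply, ContinuousLinearMap.fderiv,
    map_zero, add_zero, gen_apply, neg_apply]
  rw [(H.I_vert hz h0 _).1]
  simp [smul_smul]

lemma fieldDeriv_eq (H : LocalHodge mode P I J h) (hz : z ∈ P) (h0 : z.2 = 0) :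
    fieldDeriv I z = -ContinuousLinearMap.id ℝ E := by
  ext v
  simp [fieldDeriv, H.fderiv_field hz h0]

/-- The sign count is -T + T + T = T: the contraction of the two vertical arguments outweighs the
factor -1 from L_{Iφ} Ω = -Ω. -/
lemma vertOp_fieldDeriv (H : LocalHodge mode P I J h) (hz : z ∈ P) (h0 : z.2 = 0) :
    vertOp (fieldDeriv I z) = ContinuousLinearMap.id ℝ _ := by
  refine ContinuousLinearMap.ext fun T => ?_
  ext v v'
  simp [H.fieldDeriv_eq hz h0]

/-- In the formal sense, the fibres are Lagrangian. -/
lemma vert_formal (H : LocalHodge .formal P I J h) (hz : z ∈ P) (h0 : z.2 = 0) :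
    JetEq .formal z (vert (locForm I J h)) (fun _ => 0) := by
  refine ⟨smooth_vert (H.smooth_locForm hz), contDiffAt_const, fun k => ?_⟩
  rw [iteratedFDeriv_eq_zero_of_transport (H.smooth_field hz)
    (by rw [field, gen_apply, h0, smul_zero]; exact map_zero _)
    (H.fderiv_field hz h0) (fun ξ => by simp) k (smooth_vert (H.smooth_locForm hz))
    (smooth_vertOp (H.smooth_fieldDeriv hz)) (H.transport_vert hz)]
  · simp
  -- The operator is the identity at z, so adding c gives 1 + c, which is never zero.
  · intro c g hg
    rw [H.vertOp_fieldDeriv hz h0, ContinuousLinearMap.id_apply] at hg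
    have : ((1 : ℝ) + c) • g = 0 := by rw [add_smul, one_smul, hg]
    exact (smul_eq_zero.1 this).resolve_left (by positivity)

/-- Near the zero section, the fibres are Lagrangian. -/
lemma vert_actual (H : LocalHodge .actual P I J h) (hz : z ∈ P) (h0 : z.2 = 0) :
    JetEq .actual z (vert (locForm I J h)) (fun _ => 0) := by
  refine ⟨smooth_vert (H.smooth_locForm hz), contDiffAt_const, ?_⟩
  -- M is chosen so that M v is the sum of v and the vertical part of Iφ. It vanishes on the zero
  -- section, so its norm is at most 1 nearby, which is the contraction needed for the maximum
  -- principle.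
  let M : E × E → E →L[ℝ] E := fun w => ContinuousLinearMap.id ℝ E +
    (ContinuousLinearMap.snd ℝ E E).comp ((I w).comp ((gen E).comp (ContinuousLinearMap.inr ℝ E E)))
  have hM : ContinuousAt M z := by
    have := (H.smooth_I z hz).continuousAt
    exact continuousAt_const.add
      (continuousAt_const.clm_comp (this.clm_comp continuousAt_const))
  have hM0 : M z = 0 := by
    ext v
    simp [M, (H.I_vert hz h0 _).1, smul_smul]
  have e1 : ∀ᶠ w in 𝓝 z, ‖M w‖ ≤ 1 := by
    have := hM.norm
    simp only [ContinuousAt, hM0, norm_zero] at this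
    exact this.eventually (Iic_mem_nhds (by norm_num))
  have hL : ContinuousAt (fun w => vertOp (fieldDeriv I w) - ContinuousLinearMap.id ℝ _) z :=
    (smooth_vertOp (H.smooth_fieldDeriv hz)).continuousAt.sub continuousAt_const
  have e2 : ∀ᶠ w in 𝓝 z, ‖vertOp (fieldDeriv I w) - ContinuousLinearMap.id ℝ _‖ ≤ 1 / 2 := by
    have := hL.norm
    simp only [ContinuousAt, H.vertOp_fieldDeriv hz h0, sub_self, norm_zero] at this
    exact this.eventually (Iic_mem_nhds (by norm_num))
  have e3 := eventually_differentiableAt (smooth_vert (H.smooth_locForm hz))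
  have e4 := (H.field_fst hz).2.2
  have e5 := (H.transport_vert hz).2.2
  obtain ⟨r, hr, hball⟩ := Metric.eventually_nhds_iff_ball.1
    (e1.and (e2.and (e3.and (e4.and e5))))
  filter_upwards [Metric.ball_mem_nhds z (half_pos hr)] with w hw
  -- Over each base point within r / 2 of z, the whole fibre ball of radius r / 2 around the zero
  -- section lies in the region where the estimates hold.
  have hmem : ∀ v : E, ‖v‖ ≤ r / 2 → (w.1, v) ∈ Metric.ball z r := by
    intro v hv
    rw [Metric.mem_ball, Prod.dist_eq, max_lt_iff]
    have := (max_lt_iff.1 (by simpa [Prod.dist_eq] using hw : max (dist w.1 z.1) (dist w.2 z.2) < r / 2))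
    refine ⟨by linarith [this.1], ?_⟩
    change dist v z.2 < r
    rw [h0, dist_zero_right]; linarith
  have hfst : ∀ v : E, ‖v‖ ≤ r / 2 → field I (w.1, v) = (0, (field I (w.1, v)).2) := fun v hv =>
    Prod.ext (hball _ (hmem v hv)).2.2.2.1 rfl
  have hder : ∀ v : E, ‖v‖ ≤ r / 2 → HasFDerivAt (fun v => vert (locForm I J h) (w.1, v))
      ((fderiv ℝ (vert (locForm I J h)) (w.1, v)).comp (ContinuousLinearMap.inr ℝ E E)) v :=
    fun v hv => HasFDerivAt.comp (g := vert (locForm I J h)) v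
      (hball _ (hmem v hv)).2.2.1.hasFDerivAt (hasFDerivAt_prodMk_right w.1 v)
  refine eq_zero_of_transport_of_contracting (r := r / 2) (v := w.2)
    (f := fun v => vert (locForm I J h) (w.1, v)) (Y := fun v => (field I (w.1, v)).2)
    (fun v hv => (hder v hv).differentiableAt) ?_ ?_ ?_
  · intro v hv
    rw [(hder v hv).fderiv]
    obtain ⟨-, b2, -, -, b5⟩ := hball _ (hmem v hv)
    have : ((fderiv ℝ (vert (locForm I J h)) (w.1, v)).comp (ContinuousLinearMap.inr ℝ E E))
        (field I (w.1, v)).2 = vertOp (fieldDeriv I (w.1, v)) (vert (locForm I J h) (w.1, v)) := by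
      refine Eq.trans ?_ b5
      beta_reduce
      rw [hfst v hv]; rfl
    rw [this]
    exact (ContinuousLinearMap.le_opNorm (vertOp (fieldDeriv I (w.1, v)) -
      ContinuousLinearMap.id ℝ _) (vert (locForm I J h) (w.1, v))).trans
      (mul_le_mul_of_nonneg_right b2 (norm_nonneg _))
  · intro v hv
    have := (hball _ (hmem v hv)).1
    have e : v + (field I (w.1, v)).2 = M (w.1, v) v := by simp [M, field]
    rw [e]
    exact ((M (w.1, v)).le_opNorm v).trans (mul_le_of_le_one_left (norm_nonneg _) this)
  · have := (max_lt_iff.1 (by simpa [Prod.dist_eq] using hw : max (dist w.1 z.1) (dist w.2 z.2) < r / 2)).2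
    rw [h0, dist_zero_right] at this
    exact this.le

end LocalHodge

end Vertical
-- The contraction of Ω with φ as a complex-linear form on the base.
section Potential

universe u

variable {E : Type u} [NormedAddCommGroup E] [NormedSpace ℂ E] [FiniteDimensional ℂ E]

variable {mode : Mode} {P : Set (E × E)} {I J : E × E → (E × E →L[ℝ] E × E)}
  {h : E × E → (E × E →L[ℝ] E × E →L[ℝ] ℝ)} {z : E × E}

/-- The complex-linear part of a real-linear form. -/
def complexPart (E : Type*) [NormedAddCommGroup E] [NormedSpace ℂ E] [FiniteDimensional ℂ E] :
    (E →L[ℝ] ℂ) →L[ℝ] (E →L[ℂ] ℂ) :=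
  LinearMap.toContinuousLinearMap
    { toFun := fun r => LinearMap.toContinuousLinearMap
        { toFun := fun a => (1 / 2 : ℂ) * (r a - Complex.I * r (Complex.I • a))
          map_add' := fun a b => by simp only [smul_add, map_add]; ring
          map_smul' := fun c a => by
            have h1 : ∀ b : E, r (c • b) = c.re * r b + c.im * r (Complex.I • b) := fun b => by
              conv_lhs => rw [← Complex.re_add_im c]
              rw [add_smul, mul_smul, map_add]
              have := r.map_smul c.re b
              have h2 := r.map_smul c.im (Complex.I • b)
              simp only [Complex.real_smul] at this h2
              rw [← this, ← h2]
              rfl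
            have h3 : Complex.I • c • a = c • Complex.I • a := smul_comm _ _ _
            rw [h3, h1, h1, smul_smul, Complex.I_mul_I, neg_one_smul, map_neg]
            simp only [RingHom.id_apply, smul_eq_mul]
            conv_rhs => rw [← Complex.re_add_im c]
            linear_combination ((c.im : ℂ) * r (Complex.I • a) / 2) * Complex.I_mul_I }
      map_add' := fun r s => by
        ext a
        simp
        ring
      map_smul' := fun c r => by
        ext a
        simp
        ring }

@[simp] lemma complexPart_apply (r : E →L[ℝ] ℂ) (a : E) :
    complexPart E r a = (1 / 2 : ℂ) * (r a - Complex.I * r (Complex.I • a)) := rfl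

lemma complexPart_restrictScalars (k : E →L[ℂ] ℂ) : complexPart E (k.restrictScalars ℝ) = k := by
  ext a
  simp only [complexPart_apply, ContinuousLinearMap.coe_restrictScalars', map_smul, smul_eq_mul]
  linear_combination (-(k a) / 2) * Complex.I_mul_I

/-- An identity between complex-linear forms can be tested on vectors. -/
lemma JetEq.complexLinear_ext {Z : Type*} [NormedAddCommGroup Z] [NormedSpace ℝ Z] {z : Z}
    {f g : Z → E →L[ℂ] ℂ} (h : ∀ a, JetEq mode z (fun w => f w a) (fun w => g w a)) :
    JetEq mode z f g := by
  have h1 : JetEq mode z (fun w => (f w).restrictScalars ℝ) (fun w => (g w).restrictScalars ℝ) :=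
    JetEq.clm_ext h
  simpa only [complexPart_restrictScalars] using h1.clm (complexPart E)

/-- The inclusion of the complex-linear forms into the real-linear ones. -/
def complexRestrict (E : Type*) [NormedAddCommGroup E] [NormedSpace ℂ E] [FiniteDimensional ℂ E] :
    (E →L[ℂ] ℂ) →L[ℝ] (E →L[ℝ] ℂ) :=
  LinearMap.toContinuousLinearMap
    { toFun := fun k => k.restrictScalars ℝ
      map_add' := fun _ _ => rfl
      map_smul' := fun _ _ => rfl }

@[simp] lemma complexRestrict_apply (k : E →L[ℂ] ℂ) (a : E) : complexRestrict E k a = k a := rfl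

/-- Evaluation of complex-linear forms at a vector. -/
def evC (a : E) : (E →L[ℂ] ℂ) →L[ℝ] ℂ := (ContinuousLinearMap.apply ℂ ℂ a).restrictScalars ℝ

@[simp] lemma evC_apply (a : E) (k : E →L[ℂ] ℂ) : evC a k = k a := rfl

/-- The projection of `J` applied to vertical vectors. -/
def baseMap (A : E × E →L[ℝ] E × E) : E →L[ℝ] E :=
  (ContinuousLinearMap.fst ℝ E E).comp (A.comp (ContinuousLinearMap.inr ℝ E E))

@[simp] lemma baseMap_apply (A : E × E →L[ℝ] E × E) (v : E) : baseMap A v = (A (0, v)).1 := rfl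

/-- The horizontal lift that sends vectors of the base to the image under `J` of vertical ones. -/
def lift (A : E × E →L[ℝ] E × E) : E →L[ℝ] E × E :=
  A.comp ((ContinuousLinearMap.inr ℝ E E).comp (baseMap A).inverse)

lemma lift_fst {A : E × E →L[ℝ] E × E} (hA : (baseMap A).IsInvertible) (a : E) :
    (lift A a).1 = a := by
  have : (baseMap A) ((baseMap A).inverse a) = a := hA.self_apply_inverse a
  exact this

/-- The complex-linear form on the base that corresponds to the contraction of a `2`-form with the
generator of the action of `U(1)`. -/
def potential (A : E × E →L[ℝ] E × E) (Ω : E × E →L[ℝ] E × E →L[ℝ] ℂ) (v : E) : E →L[ℂ] ℂ :=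
  complexPart E ((-Complex.I • Ω (0, -Complex.I • v)).comp (lift A))

lemma contDiffAt_inverse {Z F : Type*} [NormedAddCommGroup Z] [NormedSpace ℝ Z]
    [NormedAddCommGroup F] [NormedSpace ℝ F] [CompleteSpace F] {A : Z → F →L[ℝ] F} {z : Z}
    (hA : ContDiffAt ℝ ∞ A z) (hz : (A z).IsInvertible) :
    ContDiffAt ℝ ∞ (fun w => (A w).inverse) z := by
  obtain ⟨e, he⟩ := hz
  exact ContDiffAt.comp (g := ContinuousLinearMap.inverse) z
    (by rw [← he]; exact contDiffAt_map_inverse e) hA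

lemma isInvertible_nhds {Z F : Type*} [TopologicalSpace Z]
    [NormedAddCommGroup F] [NormedSpace ℝ F] [CompleteSpace F] {A : Z → F →L[ℝ] F} {z : Z}
    (hA : ContinuousAt A z) (hz : (A z).IsInvertible) : ∀ᶠ w in 𝓝 z, (A w).IsInvertible := by
  obtain ⟨e, he⟩ := hz
  have := ContinuousLinearEquiv.nhds e
  rw [he] at this
  filter_upwards [hA this] with w hw
  obtain ⟨e', he'⟩ := hw
  exact ⟨e', he'⟩

lemma smooth_baseMap (hJ : ContDiffAt ℝ ∞ J z) : ContDiffAt ℝ ∞ (fun w => baseMap (J w)) z :=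
  contDiffAt_const.clm_comp (hJ.clm_comp contDiffAt_const)

instance completeSpaceOfFiniteDimensional : CompleteSpace E := FiniteDimensional.complete ℂ E

lemma smooth_lift (hJ : ContDiffAt ℝ ∞ J z) (hB : (baseMap (J z)).IsInvertible) :
    ContDiffAt ℝ ∞ (fun w => lift (J w)) z :=
  hJ.clm_comp (contDiffAt_const.clm_comp (contDiffAt_inverse (smooth_baseMap hJ) hB))

namespace LocalHodge

lemma isInvertible_baseMap (H : LocalHodge mode P I J h) (hz : z ∈ P) (h0 : z.2 = 0) :
    (baseMap (J z)).IsInvertible := by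
  have hb : Function.Bijective (baseMap (J z)) := (H.I_vert hz h0 0).2
  exact ⟨ContinuousLinearEquiv.ofBijective (baseMap (J z)) (LinearMap.ker_eq_bot.2 hb.1)
    (LinearMap.range_eq_top.2 hb.2), rfl⟩

/-- The potential, pulled back to the total space, is the contraction of `Ω` with the generator. -/
lemma potential_eq (H : LocalHodge mode P I J h) (hz : z ∈ P)
    (hB : (baseMap (J z)).IsInvertible)
    (hv : JetEq mode z (vert (locForm I J h)) (fun _ => 0)) (ξ : E × E) :
    JetEq mode z (fun w => potential (J w) (locForm I J h w) w.2 ξ.1)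
      (fun w => contraction (locForm I J h) w ξ) := by
  have sJ := H.smooth_J z hz
  have sI := H.smooth_I z hz
  have sα := smooth_contraction (H.smooth_locForm hz)
  have rα := JetEq.refl (mode := mode) sα
  have ss := smooth_lift sJ hB
  have hBn := isInvertible_nhds (smooth_baseMap sJ).continuousAt hB
  -- Both φ and (0, v) are vertical, so this is the Lagrangian property of the fibres.
  have hvert : ∀ v, JetEq mode z (fun w => contraction (locForm I J h) w (0, v)) (fun _ => 0) := by
    intro v
    have hg : ContDiffAt ℝ ∞ (fun w : E × E => -Complex.I • w.2) z :=
      contDiffAt_snd.const_smul _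
    have := ((hv.apply (JetEq.refl hg)).apply_const v).clm
      (-Complex.I • ContinuousLinearMap.id ℝ ℂ)
    exact (this.congr_left (.of_forall fun w => rfl)).congr_right (.of_forall fun w => by simp)
  have hvert' : ∀ {Y : E × E → E}, ContDiffAt ℝ ∞ Y z →
      JetEq mode z (fun w => contraction (locForm I J h) w (0, Y w)) (fun _ => 0) := fun hY =>
    JetEq.subst (A := fun w => (contraction (locForm I J h) w).comp (ContinuousLinearMap.inr ℝ E E))
      (B := fun _ => 0) hvert (JetEq.refl hY)
  -- The contraction only depends on the projection of the vector.
  have hr : ∀ {Y : E × E → E × E} {a : E × E → E}, ContDiffAt ℝ ∞ Y z →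
      JetEq mode z (fun w => (Y w).1) a →
      JetEq mode z (fun w => contraction (locForm I J h) w (lift (J w) (a w)))
        (fun w => contraction (locForm I J h) w (Y w)) := by
    intro Y a hY ha
    refine (rα.apply ((JetEq.refl ss).apply ha.symm)).trans (JetEq.of_sub (sα.clm_apply hY) ?_)
    have hY1 : ContDiffAt ℝ ∞ (fun w => (Y w).1) z := contDiffAt_fst.comp z hY
    refine (hvert' (Y := fun w => (lift (J w) (Y w).1 - Y w).2)
      (contDiffAt_snd.comp z ((ss.clm_apply hY1).sub hY))).congr_left ?_
    filter_upwards [hBn] with w hw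
    rw [← map_sub]
    congr 1
    exact Prod.ext (by simp [lift_fst hw]) rfl
  have hI : JetEq mode z (fun w => contraction (locForm I J h) w (lift (J w) (Complex.I • ξ.1)))
      (fun w => Complex.I * contraction (locForm I J h) w ξ) := by
    have h1 : JetEq mode z (fun w => (I w ξ).1) (fun _ => Complex.I • ξ.1) :=
      (H.proj z hz).apply_const ξ
    refine (hr (sI.clm_apply contDiffAt_const) h1).trans ?_
    -- `Ω(φ, Iξ) = -Ω(Iξ, φ) = -√-1 Ω(ξ, φ) = √-1 Ω(φ, ξ)`
    have a1 : ∀ {X Y : E × E → E × E}, ContDiffAt ℝ ∞ X z → ContDiffAt ℝ ∞ Y z →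
        JetEq mode z (fun w => locForm I J h w (X w) (Y w))
          (fun w => -locForm I J h w (Y w) (X w)) := fun hX hY =>
      JetEq.subst₂ (B := fun w => -(locForm I J h w).flip) (H.cForm_alt hz) (.refl hX) (.refl hY)
    have hg : ContDiffAt ℝ ∞ (fun w => gen E w) z := (gen E).contDiff.contDiffAt
    have b1 := a1 hg (sI.clm_apply (contDiffAt_const (c := ξ)))
    have b2 : JetEq mode z (fun w => locForm I J h w (I w ξ) (gen E w))
        (fun w => Complex.I * locForm I J h w ξ (gen E w)) :=
      JetEq.subst (A := fun w => locForm I J h w (I w ξ))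
        (B := fun w => Complex.I • locForm I J h w ξ) (fun η => H.cForm_I hz ξ η) (.refl hg)
    have b3 := (a1 (contDiffAt_const (c := ξ)) hg).clm (Complex.I • ContinuousLinearMap.id ℝ ℂ)
    have b4 := (b1.trans ((b2.trans (b3.congr_left (.of_forall fun w => by
      simp))).neg)).clm (-Complex.I • ContinuousLinearMap.id ℝ ℂ)
    refine (b4.congr_left (.of_forall fun w => rfl)).congr_right (.of_forall fun w => ?_)
    simp [contraction]
  have h1 := hr (Y := fun _ => ξ) contDiffAt_const (JetEq.refl contDiffAt_const)
  -- The descended form is already complex-linear: α(√-1 ·) = √-1 α gives (α - √-1 · √-1 α)/2 = α,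
  -- so `complexPart` does not change it.
  have h2 := (h1.sub (hI.clm (Complex.I • ContinuousLinearMap.id ℝ ℂ))).clm
    ((1 / 2 : ℂ) • ContinuousLinearMap.id ℝ ℂ)
  refine (h2.congr_left (.of_forall fun w => rfl)).congr_right (.of_forall fun w => ?_)
  simp [← mul_assoc]
  ring

variable {k : E × E → E →L[ℂ] ℂ}

/-- A potential is a primitive of `Ω`. -/
lemma primitive (H : LocalHodge mode P I J h) (hz : z ∈ P) (hk : ContDiffAt ℝ ∞ k z)
    (hkα : ∀ ξ : E × E,
      JetEq mode z (fun w => k w ξ.1) (fun w => contraction (locForm I J h) w ξ)) (ξ η : E × E) :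
    JetEq mode z (fun w => fderiv ℝ k w ξ η.1 - fderiv ℝ k w η ξ.1)
      (fun w => locForm I J h w ξ η) := by
  have sα := smooth_contraction (H.smooth_locForm hz)
  have h1 : ∀ ξ η : E × E, JetEq mode z (fun w => fderiv ℝ k w ξ η.1)
      (fun w => fderiv ℝ (contraction (locForm I J h)) w ξ η) := by
    intro ξ η
    refine ((hkα η).fderiv.apply_const ξ).congr_left ?_ |>.congr_right ?_
    · filter_upwards [eventually_differentiableAt hk] with w hw
      have := ((evC η.1).hasFDerivAt.comp w hw.hasFDerivAt).fderiv
      exact (congrArg (fun l => l ξ) this).symm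
    · filter_upwards [eventually_differentiableAt sα] with w hw
      rw [fderiv_clm_apply hw (differentiableAt_const η)]
      simp
  exact ((h1 ξ η).sub (h1 η ξ)).trans (H.deriv_contraction hz ξ η)

/-- A potential is holomorphic. -/
lemma holomorphic (H : LocalHodge mode P I J h) (hz : z ∈ P) (hk : ContDiffAt ℝ ∞ k z)
    (hp : ∀ ξ η : E × E, JetEq mode z (fun w => fderiv ℝ k w ξ η.1 - fderiv ℝ k w η ξ.1)
      (fun w => locForm I J h w ξ η)) (ξ : E × E) :
    JetEq mode z (fun w => fderiv ℝ k w (I w ξ)) (fun w => Complex.I • fderiv ℝ k w ξ) := by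
  have hk' : ContDiffAt ℝ ∞ (fderiv ℝ k) z := hk.fderiv_right (by simp)
  have sI := H.smooth_I z hz
  refine JetEq.complexLinear_ext fun a => ?_
  let η : E × E := (a, 0)
  have rη : JetEq mode z (fun w => fderiv ℝ k w η) (fun w => fderiv ℝ k w η) :=
    JetEq.refl (hk'.clm_apply contDiffAt_const)
  -- With η lifting a, the primitive identity at (Iξ, η) has right side Ω(Iξ, η) = √-1 Ω(ξ, η). By
  -- complex linearity of k and holomorphy of the projection, its second term on the left is also
  -- √-1 times the one for ξ, so the first term is too.
  have h1 := JetEq.subst (mode := mode) (z := z)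
    (A := fun w => (evC a).comp (fderiv ℝ k w) -
      ((fderiv ℝ k w η).restrictScalars ℝ).comp (ContinuousLinearMap.fst ℝ E E))
    (B := fun w => (locForm I J h w).flip η) (fun ξ => hp ξ η)
    (JetEq.refl (sI.clm_apply (contDiffAt_const (c := ξ))))
  have h2 : JetEq mode z (fun w => fderiv ℝ k w η (I w ξ).1)
      (fun w => Complex.I * fderiv ℝ k w η ξ.1) := by
    have := ((complexRestrict E).contDiff.contDiffAt.comp z
      (hk'.clm_apply (contDiffAt_const (c := η))))
    have := (JetEq.refl (mode := mode) this).apply ((H.proj z hz).apply_const ξ)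
    refine (this.congr_left (.of_forall fun w => rfl)).congr_right (.of_forall fun w => ?_)
    simp
  have h3 := H.cForm_I hz ξ η
  have h4 := (hp ξ η).symm.clm (Complex.I • ContinuousLinearMap.id ℝ ℂ)
  have h5 := ((h1.trans (h3.congr_left (.of_forall fun w => rfl))).trans
    (h4.congr_left (.of_forall fun w => rfl))).add h2
  refine (h5.congr_left (.of_forall fun w => ?_)).congr_right (.of_forall fun w => ?_)
  · simp
  · simp [η]
    ring

/-- A potential is equivariant. -/
lemma equivariant (H : LocalHodge mode P I J h) (hz : z ∈ P) (u : Circle)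
    (hkα : ∀ ξ : E × E,
      JetEq mode z (fun w => k w ξ.1) (fun w => contraction (locForm I J h) w ξ))
    (hkα' : ∀ ξ : E × E,
      JetEq mode (rot u z) (fun w => k w ξ.1) (fun w => contraction (locForm I J h) w ξ)) :
    JetEq mode z (fun w => k (rot u w)) (fun w => (u : ℂ) • k w) := by
  refine JetEq.complexLinear_ext fun a => ?_
  have h1 := (hkα' (rot u (a, 0))).comp_right (φ := rot u) (rot (E := E) u).contDiff.contDiffAt
  have h2 : JetEq mode z (fun w => locForm I J h (rot u w) (rot u (gen E w)) (rot u (a, 0)))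
      (fun w => (u : ℂ) * locForm I J h w (gen E w) (a, 0)) :=
    JetEq.subst (A := fun w => ((locForm I J h (rot u w)).comp (rot u)).flip (rot u (a, 0)))
      (B := fun w => (u : ℂ) • (locForm I J h w).flip (a, 0))
      (fun ξ => H.rot_cForm hz u ξ (a, 0)) (JetEq.refl (gen E).contDiff.contDiffAt)
  have h3 := h2.clm (-Complex.I • ContinuousLinearMap.id ℝ ℂ)
  have h4 := ((hkα (a, 0)).symm.clm ((u : ℂ) • ContinuousLinearMap.id ℝ ℂ))
  refine (h1.congr_left (.of_forall fun w => rfl)).trans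
    ((h3.congr_left (.of_forall fun w => ?_)).trans (h4.congr_left (.of_forall fun w => ?_))) |>.congr_right
      (.of_forall fun w => ?_)
  -- The generator is itself invariant under U(1), so the contraction inherits the weight of Ω.
  · have : gen E (rot u w) = rot u (gen E w) := by
      simp only [gen_apply, rot_apply]
      rw [smul_comm]
    simp only [contraction, this]
    rfl
  · simp [contraction]
    ring
  · simp

end LocalHodge

end Potential
/-! ### Derivatives of charts -/

section Charts

variable {F H N : Type*} [NormedAddCommGroup F] [NormedSpace ℝ F] [TopologicalSpace H]
  (𝕀 : ModelWithCorners ℝ F H) [𝕀.Boundaryless] [TopologicalSpace N] [ChartedSpace H N]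
  {F' H' N' : Type*} [NormedAddCommGroup F'] [NormedSpace ℝ F'] [TopologicalSpace H']
  (𝕀' : ModelWithCorners ℝ F' H') [𝕀'.Boundaryless] [TopologicalSpace N'] [ChartedSpace H' N']

/-- The derivative at `x` of the chart at `q`. -/
def dChart (q x : N) : TangentSpace 𝕀 x →L[ℝ] F :=
  mfderiv 𝕀 𝓘(ℝ, F) (extChartAt 𝕀 q) x

variable {q x : N} {q' : N'}

lemma extChartAt_symm_tendsto (hx : x ∈ (extChartAt 𝕀 q).source) :
    Tendsto (extChartAt 𝕀 q).symm (𝓝 (extChartAt 𝕀 q x)) (𝓝 x) := by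
  have := continuousAt_extChartAt_symm'' (I := 𝕀) (x := q) ((extChartAt 𝕀 q).map_source hx)
  have h := this.tendsto
  rwa [(extChartAt 𝕀 q).left_inv hx] at h

lemma extChartAt_target_nhds (hx : x ∈ (extChartAt 𝕀 q).source) :
    (extChartAt 𝕀 q).target ∈ 𝓝 (extChartAt 𝕀 q x) :=
  extChartAt_target_mem_nhds' ((extChartAt 𝕀 q).map_source hx)

lemma eventually_chart {p : N → Prop} (hx : x ∈ (extChartAt 𝕀 q).source) (h : ∀ᶠ y in 𝓝 x, p y) :
    ∀ᶠ z in 𝓝 (extChartAt 𝕀 q x), p ((extChartAt 𝕀 q).symm z) :=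
  (extChartAt_symm_tendsto 𝕀 hx).eventually h

variable [IsManifold 𝕀 ∞ N] [IsManifold 𝕀' ∞ N']

lemma dChart_self : dChart 𝕀 q q = ContinuousLinearMap.id ℝ F := by
  have : IsManifold 𝕀 1 N := .of_le (n := ∞) (by simp)
  exact mfderiv_extChartAt_self

lemma isInvertible_dChart (hx : x ∈ (extChartAt 𝕀 q).source) : (dChart 𝕀 q x).IsInvertible := by
  have : IsManifold 𝕀 1 N := .of_le (n := ∞) (by simp)
  exact isInvertible_mfderiv_extChartAt hx

lemma mdifferentiableAt_chart (hx : x ∈ (extChartAt 𝕀 q).source) :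
    MDifferentiableAt 𝕀 𝓘(ℝ, F) (extChartAt 𝕀 q) x := by
  have : IsManifold 𝕀 1 N := .of_le (n := ∞) (by simp)
  exact mdifferentiableAt_extChartAt (by rwa [extChartAt_source] at hx)

lemma contMDiffAt_chart_symm {z : F} (hz : z ∈ (extChartAt 𝕀 q).target) :
    ContMDiffAt 𝓘(ℝ, F) 𝕀 ∞ (extChartAt 𝕀 q).symm z :=
  (contMDiffOn_extChartAt_symm q z hz).contMDiffAt (extChartAt_target_mem_nhds' hz)

lemma mdifferentiableAt_chart_symm {z : F} (hz : z ∈ (extChartAt 𝕀 q).target) :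
    MDifferentiableAt 𝓘(ℝ, F) 𝕀 (extChartAt 𝕀 q).symm z :=
  (contMDiffAt_chart_symm 𝕀 hz).mdifferentiableAt (by simp)

/-- Smoothness of a vector-valued function in a chart. -/
lemma contMDiffAt_iff_chart {f : N → F'} (hx : x ∈ (extChartAt 𝕀 q).source) :
    ContMDiffAt 𝕀 𝓘(ℝ, F') ∞ f x ↔
      ContDiffAt ℝ ∞ (fun z => f ((extChartAt 𝕀 q).symm z)) (extChartAt 𝕀 q x) := by
  rw [← contMDiffAt_iff_contDiffAt]
  constructor
  · intro h
    have h' : ContMDiffAt 𝕀 𝓘(ℝ, F') ∞ f ((extChartAt 𝕀 q).symm (extChartAt 𝕀 q x)) := by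
      rwa [(extChartAt 𝕀 q).left_inv hx]
    exact h'.comp _ (contMDiffAt_chart_symm 𝕀 ((extChartAt 𝕀 q).map_source hx))
  · intro h
    have h1 := h.comp x (contMDiffAt_extChartAt' (n := ∞) (by rwa [extChartAt_source] at hx))
    refine h1.congr_of_eventuallyEq ?_
    filter_upwards [extChartAt_source_mem_nhds' (I := 𝕀) hx] with y hy
    simp only [Function.comp_apply, (extChartAt 𝕀 q).left_inv hy]

/-- The derivative of a map in charts. -/
lemma dChart_mfderiv {φ : N → N'} (hφ : MDifferentiableAt 𝕀 𝕀' φ x)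
    (hx : x ∈ (extChartAt 𝕀 q).source) (hφx : φ x ∈ (extChartAt 𝕀' q').source)
    (v : TangentSpace 𝕀 x) :
    dChart 𝕀' q' (φ x) (mfderiv 𝕀 𝕀' φ x v) =
      fderiv ℝ (fun z => extChartAt 𝕀' q' (φ ((extChartAt 𝕀 q).symm z))) (extChartAt 𝕀 q x)
        (dChart 𝕀 q x v) := by
  have h1 : mfderiv 𝕀 𝓘(ℝ, F') (extChartAt 𝕀' q' ∘ φ) x =
      (dChart 𝕀' q' (φ x)).comp (mfderiv 𝕀 𝕀' φ x) :=
    mfderiv_comp x (mdifferentiableAt_chart 𝕀' hφx) hφ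
  have h2 : MDifferentiableAt 𝓘(ℝ, F) 𝓘(ℝ, F')
      (fun z => extChartAt 𝕀' q' (φ ((extChartAt 𝕀 q).symm z))) (extChartAt 𝕀 q x) := by
    have h3 : MDifferentiableAt 𝕀 𝓘(ℝ, F') (extChartAt 𝕀' q' ∘ φ)
        ((extChartAt 𝕀 q).symm (extChartAt 𝕀 q x)) := by
      rw [(extChartAt 𝕀 q).left_inv hx]
      exact (mdifferentiableAt_chart 𝕀' hφx).comp x hφ
    exact h3.comp _ (mdifferentiableAt_chart_symm 𝕀 ((extChartAt 𝕀 q).map_source hx))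
  have h4 := mfderiv_comp x h2 (mdifferentiableAt_chart 𝕀 hx)
  have h5 : mfderiv 𝕀 𝓘(ℝ, F')
      ((fun z => extChartAt 𝕀' q' (φ ((extChartAt 𝕀 q).symm z))) ∘ extChartAt 𝕀 q) x =
      mfderiv 𝕀 𝓘(ℝ, F') (extChartAt 𝕀' q' ∘ φ) x := by
    refine Filter.EventuallyEq.mfderiv_eq ?_
    filter_upwards [extChartAt_source_mem_nhds' (I := 𝕀) hx] with y hy
    simp only [Function.comp_apply, (extChartAt 𝕀 q).left_inv hy]
  rw [h5, h1, mfderiv_eq_fderiv] at h4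
  exact congrArg (fun l => l v) h4

/-- The derivative of a vector-valued map in a chart. -/
lemma mfderiv_eq_fderiv_chart {f : N → F'} (hf : MDifferentiableAt 𝕀 𝓘(ℝ, F') f x)
    (hx : x ∈ (extChartAt 𝕀 q).source) (v : TangentSpace 𝕀 x) :
    mfderiv 𝕀 𝓘(ℝ, F') f x v =
      fderiv ℝ (fun z => f ((extChartAt 𝕀 q).symm z)) (extChartAt 𝕀 q x) (dChart 𝕀 q x v) := by
  have h := dChart_mfderiv (q' := f x) 𝕀 𝓘(ℝ, F') hf hx (mem_extChartAt_source _) v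
  rw [dChart_self] at h
  simp only [extChartAt_model_space_eq_id, PartialEquiv.refl_coe, id] at h
  exact h

/-- Smoothness of a vector field in a chart. -/
lemma contMDiffAt_field_iff {V : ∀ x : N, TangentSpace 𝕀 x} (hx : x ∈ (extChartAt 𝕀 q).source) :
    ContMDiffAt 𝕀 𝕀.tangent ∞ (fun x => (⟨x, V x⟩ : TangentBundle 𝕀 N)) x ↔
      ContDiffAt ℝ ∞ (fun z => dChart 𝕀 q ((extChartAt 𝕀 q).symm z) (V ((extChartAt 𝕀 q).symm z)))
        (extChartAt 𝕀 q x) := by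
  have : IsManifold 𝕀 1 N := .of_le (n := ∞) (by simp)
  rw [← contMDiffAt_iff_chart (𝕀 := 𝕀) (f := fun x => dChart 𝕀 q x (V x)) hx]
  have hx' : x ∈ (chartAt H q).source := by rwa [extChartAt_source] at hx
  refine ((trivializationAt F (TangentSpace 𝕀) q).contMDiffAt_section_iff (IB := 𝕀) (n := ∞) (s := V)
    (x₀ := x) hx').trans ?_
  refine Filter.EventuallyEq.contMDiffAt_iff ?_
  filter_upwards [(chartAt H q).open_source.mem_nhds hx'] with y hy
  have := TangentBundle.continuousLinearMapAt_trivializationAt (I := 𝕀) (x₀ := q) hy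
  rw [dChart, ← this]
  rw [Bundle.Trivialization.continuousLinearMapAt_apply, Bundle.Trivialization.linearMapAt_apply]
  exact (if_pos hy).symm

end Charts
/-! ### Charts of the two total spaces -/

section TotalSpaces

variable {E : Type*} [NormedAddCommGroup E] [NormedSpace ℂ E]
  {M : Type*} [TopologicalSpace M] [ChartedSpace E M] [IsManifold 𝓘(ℂ, E) ω M]

/-- The transition maps are those of the complex manifold, with scalars restricted to ℝ. -/
instance isManifoldCotangent : IsManifold (modelC E) ω (Cotangent E M) := by
  refine isManifold_of_contDiffOn _ _ _ fun e e' he he' => ?_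
  have h := (contDiffGroupoid ω (𝓘(ℂ, E).prod 𝓘(ℂ, E →L[ℂ] ℂ))).compatible he he'
  rw [contDiffGroupoid, mem_groupoid_of_pregroupoid] at h
  have h1 : ContDiffOn ℂ ω _ _ := h.1
  exact h1.restrict_scalars ℝ

/-- The chart of `T̄M` over the chart of `M` at `m`. -/
abbrev tc (m : M) : PartialEquiv (ConjTangent E M) (E × E) :=
  extChartAt (modelT E) (⟨m, 0⟩ : ConjTangent E M)

/-- The chart of `T^*M` over the chart of `M` at `m`. -/
abbrev cc (m : M) : PartialEquiv (Cotangent E M) (E × (E →L[ℂ] ℂ)) :=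
  extChartAt (modelC E) (⟨m, 0⟩ : Cotangent E M)

/-- The derivative of the chart `tc m`. -/
def dT (m : M) (x : ConjTangent E M) : TT x →L[ℝ] E × E :=
  dChart (modelT E) (⟨m, 0⟩ : ConjTangent E M) x

/-- The derivative of the chart `cc m`. -/
def dC (m : M) (q : Cotangent E M) : TC q →L[ℝ] E × (E →L[ℂ] ℂ) :=
  dChart (modelC E) (⟨m, 0⟩ : Cotangent E M) q

/-- The complex derivative at `y` of the chart of `M` at `m`. -/
def dB (E : Type*) [NormedAddCommGroup E] [NormedSpace ℂ E]
    {M : Type*} [TopologicalSpace M] [ChartedSpace E M] (m y : M) : E →L[ℂ] E :=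
  mfderiv 𝓘(ℂ, E) 𝓘(ℂ, E) (extChartAt 𝓘(ℂ, E) m) y

variable {m y : M} {x : ConjTangent E M} {q : Cotangent E M}

lemma mem_tc_source : x ∈ (tc m).source ↔ x.1 ∈ (chartAt E m).source := by
  rw [extChartAt_source, TangentBundle.mem_chart_source_iff]

lemma mem_cc_source : q ∈ (cc m).source ↔ q.1 ∈ (chartAt E m).source := by
  rw [extChartAt_source, FiberBundle.chartedSpace_chartAt]
  simp only [mfld_simps]
  constructor
  · exact fun h => h.1.1
  · refine fun h => ⟨⟨h, trivial⟩, ?_⟩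
    rwa [Bundle.Trivialization.coe_fst']
    exact ⟨h, trivial⟩

lemma dChart_eq_dB (hy : y ∈ (chartAt E m).source) :
    dChart 𝓘(ℝ, E) m y = (dB E m y).restrictScalars ℝ := by
  have : IsManifold 𝓘(ℂ, E) 1 M := .of_le (n := ω) (by simp)
  have h : MDifferentiableAt 𝓘(ℂ, E) 𝓘(ℂ, E) (extChartAt 𝓘(ℂ, E) m) y :=
    mdifferentiableAt_extChartAt hy
  have h' : HasMFDerivAt 𝓘(ℝ, E) 𝓘(ℝ, E) (extChartAt 𝓘(ℝ, E) m) y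
      ((dB E m y).restrictScalars ℝ) :=
    ⟨h.hasMFDerivAt.1, h.hasMFDerivAt.2.restrictScalars ℝ⟩
  exact h'.mfderiv

lemma isInvertible_dB (hy : y ∈ (chartAt E m).source) : (dB E m y).IsInvertible := by
  have : IsManifold 𝓘(ℂ, E) 1 M := .of_le (n := ω) (by simp)
  exact isInvertible_mfderiv_extChartAt (I := 𝓘(ℂ, E)) (by rwa [extChartAt_source])

lemma dB_self : dB E m m = ContinuousLinearMap.id ℂ E := by
  have : IsManifold 𝓘(ℂ, E) 1 M := .of_le (n := ω) (by simp)
  exact mfderiv_extChartAt_self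

lemma tc_apply (hx : x.1 ∈ (chartAt E m).source) :
    tc m x = (extChartAt 𝓘(ℝ, E) m x.1, dB E m x.1 (show E from x.2)) := by
  have h1 := mfderiv_chartAt_eq_tangentCoordChange (I := 𝓘(ℝ, E)) hx
  have h2 := (dChart_eq_dB hx).symm.trans h1
  have h3 : tc m x = (extChartAt 𝓘(ℝ, E) m x.1,
    tangentCoordChange 𝓘(ℝ, E) x.1 m x.1 (show E from x.2)) := rfl
  rw [h3, ← h2]
  rfl

lemma tc_self (x : ConjTangent E M) :
    tc x.1 x = (extChartAt 𝓘(ℝ, E) x.1 x.1, (show E from x.2)) := by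
  rw [tc_apply (mem_chart_source E x.1), dB_self]
  rfl

lemma tc_rotate (u : Circle) (hx : x.1 ∈ (chartAt E m).source) :
    tc m (rotate u x) = rot u (tc m x) := by
  rw [tc_apply hx, tc_apply (x := rotate u x) hx]
  refine Prod.ext rfl ?_
  exact (dB E m x.1).map_smul _ _

lemma cc_fst : (cc m q).1 = extChartAt 𝓘(ℝ, E) m q.1 := rfl

/-- The fibre coordinate of a covector is formed by precomposing with the inverse of the tangent
trivialization, which is the derivative of the base chart. Composing with that derivative undoes
this. -/
lemma cc_comp (hq : q.1 ∈ (chartAt E m).source) :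
    ((cc m q).2).comp (dB E m q.1) = (show E →L[ℂ] ℂ from q.2) := by
  have : IsManifold 𝓘(ℂ, E) 1 M := .of_le (n := ω) (by simp)
  have h1 : (cc m q).2 = ContinuousLinearMap.inCoordinates E (fun m : M => TangentSpace 𝓘(ℂ, E) m) ℂ
    (Bundle.Trivial M ℂ) m q.1 m q.1 q.2 := rfl
  have h2 : dB E m q.1 = Bundle.Trivialization.continuousLinearMapAt ℂ
      (trivializationAt E (TangentSpace 𝓘(ℂ, E)) m) q.1 :=
    (TangentBundle.continuousLinearMapAt_trivializationAt (I := 𝓘(ℂ, E)) hq).symm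
  rw [h1, h2]
  refine ContinuousLinearMap.ext fun v => ?_
  have h3 := (trivializationAt E (TangentSpace 𝓘(ℂ, E)) m).symmL_continuousLinearMapAt (R := ℂ) hq v
  have h4 : ∀ w : E, (ContinuousLinearMap.inCoordinates E (fun m : M => TangentSpace 𝓘(ℂ, E) m) ℂ
    (Bundle.Trivial M ℂ) m q.1 m q.1 q.2) w = (Bundle.Trivialization.continuousLinearMapAt ℂ
      (trivializationAt ℂ (Bundle.Trivial M ℂ) m) q.1) (q.2 (Bundle.Trivialization.symmL ℂ
      (trivializationAt E (TangentSpace 𝓘(ℂ, E)) m) q.1 w)) := fun w => rfl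
  have h5 : ∀ w : ℂ, (Bundle.Trivialization.continuousLinearMapAt ℂ
      (trivializationAt ℂ (Bundle.Trivial M ℂ) m) q.1) w = w := fun w => by
    simp
  exact (h4 _).trans ((h5 _).trans (congrArg q.2 h3))

lemma mdifferentiableAt_proj (x : ConjTangent E M) :
    MDifferentiableAt (modelT E) 𝓘(ℝ, E) (fun x : ConjTangent E M => x.proj) x :=
  (Bundle.contMDiffAt_proj (n := ∞) (TangentSpace 𝓘(ℝ, E))).mdifferentiableAt (by simp)

lemma tc_symm_proj {z : E × E} (hz : z ∈ (tc (E := E) m).target) :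
    ((tc m).symm z).1 ∈ (chartAt E m).source := mem_tc_source.1 ((tc m).map_target hz)

lemma cc_symm_proj {z : E × (E →L[ℂ] ℂ)} (hz : z ∈ (cc (E := E) m).target) :
    ((cc m).symm z).1 ∈ (chartAt E m).source := mem_cc_source.1 ((cc m).map_target hz)

lemma dB_mfderiv_proj (hx : x.1 ∈ (chartAt E m).source) (v : TT x) :
    dB E m x.1 (show E from mfderiv (modelT E) 𝓘(ℝ, E) (fun x : ConjTangent E M => x.proj) x v) =
      (dT m x v).1 := by
  have hx' := mem_tc_source.2 hx
  have h := dChart_mfderiv (q := (⟨m, 0⟩ : ConjTangent E M)) (q' := m) (modelT E) 𝓘(ℝ, E)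
    (mdifferentiableAt_proj x) hx' (by rwa [extChartAt_source]) v
  rw [dChart_eq_dB hx] at h
  refine h.trans ?_
  have e : (fun z => extChartAt 𝓘(ℝ, E) m ((tc m).symm z).proj) =ᶠ[𝓝 (tc m x)]
      (ContinuousLinearMap.fst ℝ E E) := by
    filter_upwards [extChartAt_target_nhds (modelT E) hx'] with z hz
    exact congrArg Prod.fst ((tc m).right_inv hz)
  rw [e.fderiv_eq, ContinuousLinearMap.fderiv]
  rfl

lemma dT_self (x : ConjTangent E M) (v : TT x) : dT x.1 x v = v := by
  have h : dChart (modelT E) x x = ContinuousLinearMap.id ℝ (E × E) := dChart_self (modelT E)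
  exact congrArg (fun l => l v) h

lemma mfderiv_proj (x : ConjTangent E M) (v : TT x) :
    (mfderiv (modelT E) 𝓘(ℝ, E) (fun x : ConjTangent E M => x.proj) x v : E) = (v : E × E).1 := by
  have h := dB_mfderiv_proj (mem_chart_source E x.1) v
  rw [dT_self, dB_self] at h
  exact h

lemma dT_fst (hx : x.1 ∈ (chartAt E m).source) (v : TT x) :
    (dT m x v).1 = dB E m x.1 (v : E × E).1 := by
  rw [← dB_mfderiv_proj hx, ← mfderiv_proj]

lemma tc_symm_apply (hy : y ∈ (chartAt E m).source) (v : E) :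
    (tc m).symm (extChartAt 𝓘(ℝ, E) m y, dB E m y v) = ⟨y, v⟩ := by
  have := (tc m).left_inv ((mem_tc_source (x := (⟨y, v⟩ : ConjTangent E M))).2 hy)
  rwa [tc_apply hy] at this

/-- Change of chart is linear along each fibre, so its derivative in vertical directions is this
linear map itself. -/
lemma dT_vertical (hx : x.1 ∈ (chartAt E m).source) (v : E) :
    dT m x (show TT x from ((0, v) : E × E)) = (0, dB E m x.1 v) := by
  have hx' := mem_tc_source.2 hx
  have hs := mem_tc_source.2 (mem_chart_source E x.1)
  have h := mfderiv_eq_fderiv_chart (q := (⟨x.1, 0⟩ : ConjTangent E M)) (modelT E)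
    (mdifferentiableAt_chart (modelT E) hx') hs ((0, v) : E × E)
  have h0 : dChart (modelT E) (⟨x.1, 0⟩ : ConjTangent E M) x ((0, v) : E × E) = ((0, v) : E × E) :=
    dT_self x _
  rw [h0] at h
  refine h.trans ?_
  have hd : DifferentiableAt ℝ (fun z => tc m ((tc x.1).symm z)) (tc x.1 x) := by
    have := (contMDiffAt_iff_chart (modelT E) (f := tc m) hs).1
      (contMDiffAt_extChartAt' (n := ∞) (by rwa [extChartAt_source] at hx'))
    exact this.differentiableAt (by simp)
  have h1 : HasFDerivAt (fun w : E => (extChartAt 𝓘(ℝ, E) x.1 x.1, w))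
      (ContinuousLinearMap.inr ℝ E E) (show E from x.2) :=
    (hasFDerivAt_prodMk_right _ _)
  rw [tc_self] at hd ⊢
  have h2 := hd.hasFDerivAt.comp (show E from x.2) h1
  have h3 : (fun z => tc m ((tc x.1).symm z)) ∘ (fun w : E => (extChartAt 𝓘(ℝ, E) x.1 x.1, w)) =
      fun w => (extChartAt 𝓘(ℝ, E) m x.1, dB E m x.1 w) := by
    funext w
    have := tc_symm_apply (mem_chart_source E x.1) w
    rw [dB_self] at this
    have e : (tc x.1).symm (extChartAt 𝓘(ℝ, E) x.1 x.1, w) = (⟨x.1, w⟩ : ConjTangent E M) := this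
    simp only [Function.comp_apply, e]
    exact tc_apply hx
  rw [h3] at h2
  have h4 : HasFDerivAt (fun w : E => (extChartAt 𝓘(ℝ, E) m x.1, dB E m x.1 w))
      ((0 : E →L[ℝ] E).prod ((dB E m x.1).restrictScalars ℝ)) (show E from x.2) :=
    (hasFDerivAt_const _ _).prodMk ((dB E m x.1).restrictScalars ℝ).hasFDerivAt
  exact congrArg (fun l => l v) (h2.unique h4)

lemma mem_rot_target (u : Circle) {z : E × E} (hz : z ∈ (tc (E := E) m).target) :
    rot u z ∈ (tc (E := E) m).target ∧ (tc m).symm (rot u z) = rotate u ((tc m).symm z) := by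
  have h := tc_symm_proj hz
  have h1 := tc_rotate u h
  rw [(tc m).right_inv hz] at h1
  have h2 := (mem_tc_source (x := rotate u ((tc m).symm z))).2 h
  rw [← h1]
  exact ⟨(tc m).map_source h2, (tc m).left_inv h2⟩

lemma contMDiffAt_rotate (u : Circle) (x : ConjTangent E M) :
    ContMDiffAt (modelT E) (modelT E) ∞ (rotate u) x := by
  have hs := mem_tc_source.2 (mem_chart_source E x.1)
  have h1 : ContMDiffAt (modelT E) 𝓘(ℝ, E × E) ∞ (tc x.1) x :=
    contMDiffAt_extChartAt' (by rwa [extChartAt_source] at hs)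
  have h2 : ContMDiffAt 𝓘(ℝ, E × E) 𝓘(ℝ, E × E) ∞ (rot (E := E) u) (tc x.1 x) :=
    (rot (E := E) u).contMDiff.contMDiffAt
  have h3 := contMDiffAt_chart_symm (modelT E) (mem_rot_target u ((tc x.1).map_source hs)).1
  refine ((h3.comp _ h2).comp x h1).congr_of_eventuallyEq ?_
  filter_upwards [extChartAt_source_mem_nhds' (I := modelT E) hs] with y hy
  have := (mem_rot_target u ((tc x.1).map_source hy)).2
  rw [(tc x.1).left_inv hy] at this
  exact this.symm

lemma dT_dRotate (u : Circle) (hx : x.1 ∈ (chartAt E m).source) (v : TT x) :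
    dT m (rotate u x) (dRotate u x v) = rot u (dT m x v) := by
  have hx' := mem_tc_source.2 hx
  have h := dChart_mfderiv (q := (⟨m, 0⟩ : ConjTangent E M)) (q' := (⟨m, 0⟩ : ConjTangent E M))
    (modelT E) (modelT E) ((contMDiffAt_rotate u x).mdifferentiableAt (by simp)) hx'
    ((mem_tc_source (x := rotate u x)).2 hx) v
  refine h.trans ?_
  have e : (fun z => tc m (rotate u ((tc m).symm z))) =ᶠ[𝓝 (tc m x)] (rot u) := by
    filter_upwards [extChartAt_target_nhds (modelT E) hx'] with z hz
    obtain ⟨h1, h2⟩ := mem_rot_target u hz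
    rw [← h2, (tc m).right_inv h1]
  rw [e.fderiv_eq, ContinuousLinearMap.fderiv]
  rfl

end TotalSpaces
/-! ### The canonical symplectic form in charts -/

section Symplectic

variable {E : Type*} [NormedAddCommGroup E] [NormedSpace ℂ E] [FiniteDimensional ℂ E]
  {M : Type*} [TopologicalSpace M] [ChartedSpace E M] [IsManifold 𝓘(ℂ, E) ω M]
  {m : M} {q : Cotangent E M}

lemma mdifferentiableAt_projC (q : Cotangent E M) :
    MDifferentiableAt (modelC E) 𝓘(ℝ, E) (fun q : Cotangent E M => q.proj) q := by
  have h1 : MDifferentiableAt (modelC E) 𝓘(ℝ, E × (E →L[ℂ] ℂ)) (cc q.1) q :=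
    mdifferentiableAt_chart (modelC E) (mem_cc_source.2 (mem_chart_source E q.1))
  have h2 : MDifferentiableAt 𝓘(ℝ, E × (E →L[ℂ] ℂ)) 𝓘(ℝ, E)
      (ContinuousLinearMap.fst ℝ E (E →L[ℂ] ℂ)) (cc q.1 q) :=
    (ContinuousLinearMap.fst ℝ E (E →L[ℂ] ℂ)).mdifferentiableAt
  have h3 : MDifferentiableAt 𝓘(ℝ, E) 𝓘(ℝ, E) (extChartAt 𝓘(ℝ, E) q.1).symm (cc q.1 q).1 :=
    mdifferentiableAt_chart_symm 𝓘(ℝ, E) (by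
      rw [cc_fst]; exact (extChartAt 𝓘(ℝ, E) q.1).map_source (mem_extChartAt_source _))
  refine ((h3.comp _ h2).comp q h1).congr_of_eventuallyEq ?_
  filter_upwards [extChartAt_source_mem_nhds' (I := modelC E)
    (mem_cc_source.2 (mem_chart_source E q.1))] with q' hq'
  have := (extChartAt 𝓘(ℝ, E) q.1).left_inv (by
    rw [extChartAt_source]; exact mem_cc_source.1 hq' : q'.1 ∈ _)
  exact this.symm

lemma dB_mfderiv_projC (hq : q.1 ∈ (chartAt E m).source) (v : TC q) :
    dB E m q.1 (show E from mfderiv (modelC E) 𝓘(ℝ, E) (fun q : Cotangent E M => q.proj) q v) =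
      (dC m q v).1 := by
  have hq' := mem_cc_source.2 hq
  have h := dChart_mfderiv (q := (⟨m, 0⟩ : Cotangent E M)) (q' := m) (modelC E) 𝓘(ℝ, E)
    (mdifferentiableAt_projC q) hq' (by rwa [extChartAt_source]) v
  rw [dChart_eq_dB hq] at h
  refine h.trans ?_
  have e : (fun z => extChartAt 𝓘(ℝ, E) m ((cc m).symm z).proj) =ᶠ[𝓝 (cc m q)]
      (ContinuousLinearMap.fst ℝ E (E →L[ℂ] ℂ)) := by
    filter_upwards [extChartAt_target_nhds (modelC E) hq'] with z hz
    exact congrArg Prod.fst ((cc m).right_inv hz)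
  rw [e.fderiv_eq, ContinuousLinearMap.fderiv]
  rfl

/-- This is the local expression p dx, valid in every chart; the derivatives of the base chart
cancel between the covector and the projected vector. -/
lemma liouville_apply (hq : q.1 ∈ (chartAt E m).source) (v : TC q) :
    liouville q v = (cc m q).2 (dC m q v).1 := by
  rw [← dB_mfderiv_projC hq]
  exact (congrArg (fun l : E →L[ℂ] ℂ => l (show E from mfderiv (modelC E) 𝓘(ℝ, E)
    (fun q : Cotangent E M => q.proj) q v)) (cc_comp hq)).symm

lemma dC_self (q : Cotangent E M) (v : TC q) : dC q.1 q v = v := by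
  have h : dChart (modelC E) q q = ContinuousLinearMap.id ℝ (E × (E →L[ℂ] ℂ)) :=
    dChart_self (modelC E)
  exact congrArg (fun l => l v) h

lemma isInvertible_dC (hq : q.1 ∈ (chartAt E m).source) : (dC m q).IsInvertible :=
  isInvertible_dChart (modelC E) (mem_cc_source.2 hq)

/-- The tautological form in coordinates. -/
def taut (E : Type*) [NormedAddCommGroup E] [NormedSpace ℂ E] [FiniteDimensional ℂ E] :
    E × (E →L[ℂ] ℂ) →L[ℝ] (E × (E →L[ℂ] ℂ) →L[ℝ] ℂ) :=
  ((ContinuousLinearMap.compL ℝ (E × (E →L[ℂ] ℂ)) E ℂ).flip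
    (ContinuousLinearMap.fst ℝ E (E →L[ℂ] ℂ))).comp
    ((complexRestrict E).comp (ContinuousLinearMap.snd ℝ E (E →L[ℂ] ℂ)))

/-- The tautological form written in the chart `cc m`. -/
def tautChart (m : M) (y : E × (E →L[ℂ] ℂ)) : E × (E →L[ℂ] ℂ) →L[ℝ] ℂ :=
  (liouville ((cc m).symm y)).comp
    (mfderiv 𝓘(ℝ, E × (E →L[ℂ] ℂ)) (modelC E) (cc m).symm y)

lemma tautChart_eq {y : E × (E →L[ℂ] ℂ)} (hy : (cc (E := E) m).target ∈ 𝓝 y) :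
    tautChart m y = taut E y := by
  have hy' := mem_of_mem_nhds hy
  refine ContinuousLinearMap.ext fun v => ?_
  have h1 := liouville_apply (cc_symm_proj hy')
    (mfderiv 𝓘(ℝ, E × (E →L[ℂ] ℂ)) (modelC E) (cc m).symm y v)
  rw [(cc m).right_inv hy'] at h1
  refine h1.trans ?_
  have h2 : mfderiv 𝓘(ℝ, E × (E →L[ℂ] ℂ)) 𝓘(ℝ, E × (E →L[ℂ] ℂ)) (cc m ∘ (cc m).symm) y =
      (dC m ((cc m).symm y)).comp
        (mfderiv 𝓘(ℝ, E × (E →L[ℂ] ℂ)) (modelC E) (cc m).symm y) :=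
    mfderiv_comp y (mdifferentiableAt_chart (modelC E) ((cc m).map_target hy'))
      (mdifferentiableAt_chart_symm (modelC E) hy')
  have h3 : cc m ∘ (cc m).symm =ᶠ[𝓝 y] id := by
    filter_upwards [hy] with w hw using (cc m).right_inv hw
  rw [h3.mfderiv_eq, mfderiv_id] at h2
  have h4 := congrArg (fun l => l v) h2
  exact congrArg (fun w : E × (E →L[ℂ] ℂ) => y.2 w.1) h4.symm

lemma canonicalForm_def (q : Cotangent E M) (ξ η : TC q) :
    canonicalForm q ξ η = fderiv ℝ (tautChart q.1) (cc q.1 q) (dC q.1 q ξ) (dC q.1 q η) -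
      fderiv ℝ (tautChart q.1) (cc q.1 q) (dC q.1 q η) (dC q.1 q ξ) := rfl

/-- The definition uses the chart at q, whose derivative at q is the identity. In it the
tautological form has linear coefficients, with constant derivative dp ∧ dx. -/
lemma canonicalForm_apply (q : Cotangent E M) (ξ η : TC q) :
    canonicalForm q ξ η = (ξ : E × (E →L[ℂ] ℂ)).2 (η : E × (E →L[ℂ] ℂ)).1 -
      (η : E × (E →L[ℂ] ℂ)).2 (ξ : E × (E →L[ℂ] ℂ)).1 := by
  have hs := mem_cc_source.2 (mem_chart_source E q.1)
  have e : tautChart q.1 =ᶠ[𝓝 (cc q.1 q)] fun w => taut E w := by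
    filter_upwards [eventually_mem_nhds_iff.2 (extChartAt_target_nhds (modelC E) hs)] with y hy
      using tautChart_eq hy
  have h := e.fderiv_eq (𝕜 := ℝ)
  rw [(taut E).fderiv] at h
  rw [canonicalForm_def, h, dC_self, dC_self]
  rfl

/-- The canonical symplectic form in the chart at any point. -/
lemma canonicalForm_chart (hq : q.1 ∈ (chartAt E m).source) (ξ η : TC q) :
    canonicalForm q ξ η = (dC m q ξ).2 (dC m q η).1 - (dC m q η).2 (dC m q ξ).1 := by
  have hs := mem_cc_source.2 (mem_chart_source E q.1)
  have hq' := mem_cc_source.2 hq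
  set ψ : E × (E →L[ℂ] ℂ) → E × (E →L[ℂ] ℂ) := fun z => cc m ((cc q.1).symm z) with hψ
  have sψ : ContDiffAt ℝ ∞ ψ (cc q.1 q) :=
    (contMDiffAt_iff_chart (modelC E) (f := cc m) hs).1
      (contMDiffAt_extChartAt' (n := ∞) (by rwa [extChartAt_source] at hq'))
  have hd : ∀ q' : Cotangent E M, q'.1 ∈ (chartAt E m).source → q'.1 ∈ (chartAt E q.1).source →
      ∀ v : TC q', dC m q' v = fderiv ℝ ψ (cc q.1 q') (dC q.1 q' v) := fun q' h h' v =>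
    mfderiv_eq_fderiv_chart (modelC E) (mdifferentiableAt_chart (modelC E) (mem_cc_source.2 h))
      (mem_cc_source.2 h') v
  -- The transition map ψ preserves the tautological form, since p dx represents λ in both charts.
  have e : (fun w => (taut E (ψ w)).comp (fderiv ℝ ψ w)) =ᶠ[𝓝 (cc q.1 q)] fun w => taut E w := by
    have h1 : ∀ᶠ q' in 𝓝 q, q' ∈ (cc (E := E) m).source := extChartAt_source_mem_nhds' hq'
    filter_upwards [extChartAt_target_nhds (modelC E) hs, eventually_chart (modelC E) hs h1]
      with y hy hy'
    refine ContinuousLinearMap.ext fun v => ?_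
    obtain ⟨L, hL⟩ := isInvertible_dC (cc_symm_proj hy)
    have hv : dC q.1 ((cc q.1).symm y) (L.symm v) = v := by
      rw [← hL]; exact L.apply_symm_apply v
    have t1 := liouville_apply (mem_cc_source.1 hy') (L.symm v)
    have t2 := liouville_apply (cc_symm_proj hy) (L.symm v)
    have t3 := hd _ (mem_cc_source.1 hy') (cc_symm_proj hy) (L.symm v)
    rw [hv, (cc q.1).right_inv hy] at t2 t3
    rw [t3] at t1
    exact t1.symm.trans t2
  have hf := e.fderiv_eq (𝕜 := ℝ)
  have sψ' : ContDiffAt ℝ ∞ (fderiv ℝ ψ) (cc q.1 q) := sψ.fderiv_right (by simp)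
  have d1 : DifferentiableAt ℝ ψ (cc q.1 q) := sψ.differentiableAt (by simp)
  have d2 : DifferentiableAt ℝ (fderiv ℝ ψ) (cc q.1 q) := sψ'.differentiableAt (by simp)
  have d3 := (taut E).hasFDerivAt.comp (cc q.1 q) d1.hasFDerivAt
  have d4 := d3.clm_comp d2.hasFDerivAt
  have hf' := (d4.fderiv).symm.trans hf
  rw [(taut E).fderiv] at hf'
  -- Differentiate this invariance by the product rule. The term with the second derivative of ψ is
  -- symmetric in a and b, so it cancels after antisymmetrization.
  have key : ∀ a b : E × (E →L[ℂ] ℂ), a.2 b.1 = (ψ (cc q.1 q)).2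
      (fderiv ℝ (fderiv ℝ ψ) (cc q.1 q) a b).1 +
      (fderiv ℝ ψ (cc q.1 q) a).2 (fderiv ℝ ψ (cc q.1 q) b).1 := fun a b =>
    (congrArg (fun l => l a b) hf').symm
  have hsym := sψ.isSymmSndFDerivAt (by simpa using two_le_infty)
  have h1 := hd q hq (mem_chart_source E q.1) ξ
  have h2 := hd q hq (mem_chart_source E q.1) η
  rw [dC_self] at h1 h2
  rw [canonicalForm_apply, h1, h2, key ξ η, key η ξ, hsym.eq ξ η]
  ring

/-- The same chart is complex differentiable on the complex manifold T^*M, so its real derivative is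
complex-linear. -/
lemma dC_mulI (hq : q.1 ∈ (chartAt E m).source) (ξ : TC q) :
    dC m q (mulI q ξ) = Complex.I • dC m q ξ := by
  have : IsManifold (𝓘(ℂ, E).prod 𝓘(ℂ, E →L[ℂ] ℂ)) 1 (Cotangent E M) := .of_le (n := ω) (by simp)
  have hq' := mem_cc_source.2 hq
  rw [extChartAt_source] at hq'
  have h : MDifferentiableAt (𝓘(ℂ, E).prod 𝓘(ℂ, E →L[ℂ] ℂ)) 𝓘(ℂ, E × (E →L[ℂ] ℂ))
      (extChartAt (𝓘(ℂ, E).prod 𝓘(ℂ, E →L[ℂ] ℂ)) (⟨m, 0⟩ : Cotangent E M)) q :=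
    mdifferentiableAt_extChartAt hq'
  set L : E × (E →L[ℂ] ℂ) →L[ℂ] E × (E →L[ℂ] ℂ) :=
    mfderiv (𝓘(ℂ, E).prod 𝓘(ℂ, E →L[ℂ] ℂ)) 𝓘(ℂ, E × (E →L[ℂ] ℂ))
      (extChartAt (𝓘(ℂ, E).prod 𝓘(ℂ, E →L[ℂ] ℂ)) (⟨m, 0⟩ : Cotangent E M)) q with hL
  have h' : HasMFDerivAt (modelC E) 𝓘(ℝ, E × (E →L[ℂ] ℂ)) (cc m) q (L.restrictScalars ℝ) :=
    ⟨h.hasMFDerivAt.1, h.hasMFDerivAt.2.restrictScalars ℝ⟩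
  have e : dC m q = L.restrictScalars ℝ := h'.mfderiv
  rw [e]
  exact L.map_smul _ _

lemma cc_rotateCot (u : Circle) (hq : q.1 ∈ (chartAt E m).source) :
    cc m (rotateCot u q) = ((cc m q).1, (u : ℂ) • (cc m q).2) := by
  refine Prod.ext rfl ?_
  have h1 := cc_comp (q := rotateCot u q) hq
  have h2 := cc_comp hq
  obtain ⟨L, hL⟩ := isInvertible_dB (E := E) hq
  refine ContinuousLinearMap.ext fun v => ?_
  have hv : dB E m q.1 (L.symm v) = v := by rw [← hL]; exact L.apply_symm_apply v
  have h3 := congrArg (fun l => l (L.symm v)) h1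
  have h4 := congrArg (fun l => l (L.symm v)) h2
  simp only [ContinuousLinearMap.comp_apply] at h3 h4
  have h5 : dB E m (rotateCot u q).1 (L.symm v) = v := hv
  rw [h5] at h3
  rw [hv] at h4
  rw [h3]
  show _ = (u : ℂ) • (cc m q).2 v
  rw [h4]
  rfl

end Symplectic
/-! ### Fields on the total space in coordinates -/

section Fields

universe u v

variable {E : Type u} [NormedAddCommGroup E] [NormedSpace ℂ E] [FiniteDimensional ℂ E]
  {M : Type v} [TopologicalSpace M] [ChartedSpace E M] [IsManifold 𝓘(ℂ, E) ω M]
  {m : M} {x : ConjTangent E M} {mode : Mode} {U : Set (ConjTangent E M)} {z : E × E}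

/-- The coordinate vector fields of the chart `tc m`. -/
def coordField (m : M) (ξ : E × E) (x : ConjTangent E M) : TT x := (dT m x).inverse ξ

/-- A field of endomorphisms in the chart `tc m`. -/
def locEnd (A : ∀ x : ConjTangent E M, TT x →L[ℝ] TT x) (m : M) (z : E × E) :
    E × E →L[ℝ] E × E :=
  (dT m ((tc m).symm z)).comp ((A ((tc m).symm z)).comp (dT m ((tc m).symm z)).inverse)

/-- A field of bilinear forms in the chart `tc m`. -/
def locBil (h : ∀ x : ConjTangent E M, TT x →L[ℝ] TT x →L[ℝ] ℝ) (m : M) (z : E × E) :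
    E × E →L[ℝ] E × E →L[ℝ] ℝ :=
  ContinuousLinearMap.bilinearComp (E := E × E) (F := E × E) (E' := E × E) (F' := E × E)
    (h ((tc m).symm z)) (dT m ((tc m).symm z)).inverse (dT m ((tc m).symm z)).inverse

lemma isInvertible_dT (hx : x.1 ∈ (chartAt E m).source) : (dT m x).IsInvertible :=
  isInvertible_dChart (modelT E) (mem_tc_source.2 hx)

lemma dT_inverse (hx : x.1 ∈ (chartAt E m).source) (ξ : E × E) :
    dT m x ((dT m x).inverse ξ) = ξ := (isInvertible_dT hx).self_apply_inverse ξ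

lemma inverse_dT (hx : x.1 ∈ (chartAt E m).source) (v : TT x) :
    (dT m x).inverse (dT m x v) = v := (isInvertible_dT hx).inverse_apply_self v

lemma dT_coordField (hx : x.1 ∈ (chartAt E m).source) (ξ : E × E) :
    dT m x (coordField m ξ x) = ξ := dT_inverse hx ξ

lemma locEnd_apply (A : ∀ x : ConjTangent E M, TT x →L[ℝ] TT x) (hx : x.1 ∈ (chartAt E m).source)
    (v : TT x) : locEnd A m (tc m x) (dT m x v) = dT m x (A x v) := by
  rw [locEnd, (tc m).left_inv (mem_tc_source.2 hx)]
  show dT m x (A x ((dT m x).inverse (dT m x v))) = _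
  rw [inverse_dT hx]

lemma locBil_apply (h : ∀ x : ConjTangent E M, TT x →L[ℝ] TT x →L[ℝ] ℝ)
    (hx : x.1 ∈ (chartAt E m).source) (v w : TT x) :
    locBil h m (tc m x) (dT m x v) (dT m x w) = h x v w := by
  rw [locBil, (tc m).left_inv (mem_tc_source.2 hx)]
  show h x ((dT m x).inverse (dT m x v)) ((dT m x).inverse (dT m x w)) = _
  rw [inverse_dT hx, inverse_dT hx]

lemma smoothAt_iff {V : ∀ x : ConjTangent E M, TT x} (hx : x.1 ∈ (chartAt E m).source) :
    SmoothAt V x ↔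
      ContDiffAt ℝ ∞ (fun z => dT m ((tc m).symm z) (V ((tc m).symm z))) (tc m x) :=
  contMDiffAt_field_iff (modelT E) (mem_tc_source.2 hx)

lemma smoothAt_coordField (hx : x.1 ∈ (chartAt E m).source) (ξ : E × E) :
    SmoothAt (coordField m ξ) x := by
  refine (smoothAt_iff hx).2 ((contDiffAt_const (c := ξ)).congr_of_eventuallyEq ?_)
  filter_upwards [extChartAt_target_nhds (modelT E) (mem_tc_source.2 hx)] with w hw
  exact dT_coordField (tc_symm_proj hw) ξ

lemma SmoothEndOn.apply {A : ∀ x : ConjTangent E M, TT x →L[ℝ] TT x} (hA : SmoothEndOn A U)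
    (hU : IsOpen U) (hx : x ∈ U) {V : ∀ x : ConjTangent E M, TT x} (hV : SmoothAt V x) :
    SmoothAt (fun x => A x (V x)) x :=
  ((hA x hx).contMDiffAt (hU.mem_nhds hx)).clm_bundle_apply hV

lemma SmoothBilinOn.apply {h : ∀ x : ConjTangent E M, TT x →L[ℝ] TT x →L[ℝ] ℝ}
    (hh : SmoothBilinOn h U) (hU : IsOpen U) (hx : x ∈ U) {V W : ∀ x : ConjTangent E M, TT x}
    (hV : SmoothAt V x) (hW : SmoothAt W x) :
    ContMDiffAt (modelT E) 𝓘(ℝ, ℝ) ∞ (fun x => h x (V x) (W x)) x := by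
  have := ContMDiffAt.clm_bundle_apply₂ (F₃ := ℝ) (E₃ := Bundle.Trivial (ConjTangent E M) ℝ)
    ((hh x hx).contMDiffAt (hU.mem_nhds hx)) hV hW
  exact (Bundle.contMDiffAt_totalSpace.1 this).2

lemma contDiffAt_locEnd {A : ∀ x : ConjTangent E M, TT x →L[ℝ] TT x} (hA : SmoothEndOn A U)
    (hU : IsOpen U) (hx : x ∈ U) (hxm : x.1 ∈ (chartAt E m).source) :
    ContDiffAt ℝ ∞ (locEnd A m) (tc m x) :=
  contDiffAt_clm_of_apply fun ξ =>
    (smoothAt_iff hxm).1 (hA.apply hU hx (smoothAt_coordField hxm ξ))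

lemma contDiffAt_locBil {h : ∀ x : ConjTangent E M, TT x →L[ℝ] TT x →L[ℝ] ℝ}
    (hh : SmoothBilinOn h U) (hU : IsOpen U) (hx : x ∈ U) (hxm : x.1 ∈ (chartAt E m).source) :
    ContDiffAt ℝ ∞ (locBil h m) (tc m x) :=
  contDiffAt_clm_of_apply₂ fun ξ η => (contMDiffAt_iff_chart (modelT E) (mem_tc_source.2 hxm)).1
    (hh.apply hU hx (smoothAt_coordField hxm ξ) (smoothAt_coordField hxm η))

/-- Coordinate fields are pull-backs of constant fields by the chart, and pull-back commutes with
brackets. This removes the bracket terms from Cartan's formula. -/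
lemma mlieBracket_coordField (hx : x.1 ∈ (chartAt E m).source) (ξ η : E × E) :
    VectorField.mlieBracket (modelT E) (coordField m ξ) (coordField m η) x = 0 := by
  have hx' := mem_tc_source.2 hx
  have hc : ∀ (c : E × E) (z : E × E), MDifferentiableAt 𝓘(ℝ, E × E) 𝓘(ℝ, E × E).tangent
      (fun z => (⟨z, c⟩ : TangentBundle 𝓘(ℝ, E × E) (E × E))) z := fun c z =>
    (contMDiffAt_vectorSpace_iff_contDiffAt (n := ∞) (V := fun _ => c)).2 contDiffAt_const
      |>.mdifferentiableAt (by simp)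
  have := VectorField.mpullback_mlieBracket (I := modelT E) (I' := 𝓘(ℝ, E × E)) (n := ∞)
    (f := tc m) (V := fun _ => ξ) (W := fun _ => η) (x₀ := x) (hc ξ _) (hc η _)
    (contMDiffAt_extChartAt' (by rwa [extChartAt_source] at hx')) (by simpa using two_le_infty)
  refine Eq.trans this.symm ?_
  rw [VectorField.mpullback_apply]
  have h1 : ∀ (V W : ∀ z : E × E, TangentSpace 𝓘(ℝ, E × E) z) (z : E × E),
      VectorField.mlieBracket 𝓘(ℝ, E × E) V W z =
        VectorField.lieBracketWithin ℝ (E := E × E) V W Set.univ z := fun V W z => by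
    rw [← VectorField.mlieBracketWithin_univ, VectorField.mlieBracketWithin_eq_lieBracketWithin]
  have h0 : VectorField.mlieBracket 𝓘(ℝ, E × E) (fun _ : E × E => ξ) (fun _ : E × E => η)
      (tc m x) = 0 :=
    (h1 _ _ _).trans (by simp [VectorField.lieBracketWithin]; rfl)
  rw [h0, map_zero]

/-- The exterior derivative of a fundamental form along coordinate vector fields. -/
lemma extDerivTwo_coordField {A : ∀ x : ConjTangent E M, TT x →L[ℝ] TT x}
    {h : ∀ x : ConjTangent E M, TT x →L[ℝ] TT x →L[ℝ] ℝ} (hA : SmoothEndOn A U)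
    (hh : SmoothBilinOn h U) (hU : IsOpen U) (hx : x ∈ U) (hxm : x.1 ∈ (chartAt E m).source)
    (ξ η ζ : E × E) :
    extDerivTwo (fundForm h A) (coordField m ξ) (coordField m η) (coordField m ζ) x =
      dTwo (fun w => (locBil h m w).comp (locEnd A m w)) (tc m x) ξ η ζ := by
  have hs := mem_tc_source.2 hxm
  have d : DifferentiableAt ℝ (fun w => (locBil h m w).comp (locEnd A m w)) (tc m x) :=
    ((contDiffAt_locBil hh hU hx hxm).clm_comp (contDiffAt_locEnd hA hU hx hxm)).differentiableAt
      (by simp)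
  have key : ∀ a b c : E × E, deriveAlong (coordField m a)
      (fun y => fundForm h A y (coordField m b y) (coordField m c y)) x =
      fderiv ℝ (fun w => (locBil h m w).comp (locEnd A m w)) (tc m x) a b c := by
    intro a b c
    have h1 : MDifferentiableAt (modelT E) 𝓘(ℝ, ℝ)
        (fun y => fundForm h A y (coordField m b y) (coordField m c y)) x :=
      (hh.apply hU hx (hA.apply hU hx (smoothAt_coordField hxm b))
        (smoothAt_coordField hxm c)).mdifferentiableAt (by simp)
    have h2 := mfderiv_eq_fderiv_chart (modelT E) h1 hs (coordField m a x)
    have h3 : dChart (modelT E) (⟨m, 0⟩ : ConjTangent E M) x (coordField m a x) = a :=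
      dT_coordField hxm a
    rw [h3] at h2
    refine h2.trans ?_
    rw [← fderiv_apply₂ d]
    refine congrArg (fun l : E × E →L[ℝ] ℝ => l a) (Filter.EventuallyEq.fderiv_eq ?_)
    filter_upwards [extChartAt_target_nhds (modelT E) hs] with w hw
    have hw' := tc_symm_proj hw
    have e1 := locEnd_apply A hw' (coordField m b _)
    have e2 := locBil_apply h hw' (A _ (coordField m b ((tc m).symm w))) (coordField m c _)
    rw [← e1, (tc m).right_inv hw, dT_coordField hw', dT_coordField hw'] at e2
    exact e2.symm
  have z1 : ∀ (v w : TT x), v = 0 → fundForm h A x v w = 0 := fun v w hv => by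
    simp [fundForm, hv]
  rw [extDerivTwo, key, key, key, z1 _ _ (mlieBracket_coordField hxm _ _),
    z1 _ _ (mlieBracket_coordField hxm _ _), z1 _ _ (mlieBracket_coordField hxm _ _)]
  simp [dTwo]

end Fields
/-! ### Hodge structures on the total space in coordinates -/

section Transfer

universe u v

variable {E : Type u} [NormedAddCommGroup E] [NormedSpace ℂ E] [FiniteDimensional ℂ E]
  {M : Type v} [TopologicalSpace M] [ChartedSpace E M] [IsManifold 𝓘(ℂ, E) ω M]
  {m : M} {x : ConjTangent E M} {mode : Mode} {U : Set (ConjTangent E M)} {z : E × E}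

/-- The points at which identities on `U` are to be checked, in the chart `tc m`. In the formal
case only the centre of the chart is used. -/
def domain (mode : Mode) (U : Set (ConjTangent E M)) (m : M) : Set (E × E) :=
  match mode with
  | .actual => (tc m).target ∩ (tc m).symm ⁻¹' U
  | .formal => {tc m ⟨m, 0⟩}

lemma mem_domain (hx : x ∈ mode.points U) : tc x.1 x ∈ domain mode U x.1 := by
  have hs := mem_tc_source.2 (mem_chart_source E x.1)
  cases mode
  · refine ⟨(tc x.1).map_source hs, ?_⟩
    rw [Set.mem_preimage, (tc x.1).left_inv hs]
    exact hx
  · have h : x.2 = 0 := hx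
    have e : x = ⟨x.1, 0⟩ := by rw [← h]
    exact congrArg (tc x.1) e

lemma exists_of_mem_domain (hU : IsInvariantNhd U) (hz : z ∈ domain mode U m) :
    ∃ x : ConjTangent E M, x ∈ mode.points U ∧ x ∈ U ∧ x.1 ∈ (chartAt E m).source ∧ tc m x = z := by
  cases mode
  · exact ⟨(tc m).symm z, hz.2, hz.2, tc_symm_proj hz.1, (tc m).right_inv hz.1⟩
  · exact ⟨⟨m, 0⟩, rfl, hU.zero_subset rfl, mem_chart_source E m, hz.symm⟩

lemma isOpen_domain (hU : IsInvariantNhd U) (h : mode = .actual) : IsOpen (domain mode U m) := by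
  subst h
  exact (continuousOn_extChartAt_symm _).isOpen_inter_preimage (isOpen_extChartAt_target _) hU.isOpen

lemma rotate_zero (u : Circle) (m : M) : rotate u (⟨m, 0⟩ : ConjTangent E M) = ⟨m, 0⟩ := by
  have : (starRingEnd ℂ (u : ℂ) • (0 : E) : E) = 0 := smul_zero _
  exact congrArg (fun v : E => (⟨m, v⟩ : ConjTangent E M)) this

lemma rot_mem_domain (hU : IsInvariantNhd U) (u : Circle) (hz : z ∈ domain mode U m) :
    rot u z ∈ domain mode U m := by
  cases mode
  · obtain ⟨h1, h2⟩ := mem_rot_target u hz.1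
    refine ⟨h1, ?_⟩
    rw [Set.mem_preimage, h2]
    exact hU.rotate_mem u _ hz.2
  · have h : z = tc m ⟨m, 0⟩ := hz
    have := tc_rotate (m := m) (x := (⟨m, 0⟩ : ConjTangent E M)) u (mem_chart_source E m)
    rw [rotate_zero] at this
    rw [h, ← this]
    rfl

lemma eventually_tc (hx : x.1 ∈ (chartAt E m).source) {p : ConjTangent E M → Prop}
    (h : ∀ᶠ y in 𝓝 x, p y) :
    ∀ᶠ w in 𝓝 (tc m x), ∃ y : ConjTangent E M, y.1 ∈ (chartAt E m).source ∧ p y ∧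
      (tc m).symm w = y ∧ tc m y = w := by
  have hs := mem_tc_source.2 hx
  filter_upwards [extChartAt_target_nhds (modelT E) hs, eventually_chart (modelT E) hs h] with w h1 h2
  exact ⟨_, tc_symm_proj h1, h2, rfl, (tc m).right_inv h1⟩

/-- Functions that vanish at the points of `U`, in coordinates. -/
lemma jetEq_of_vanishes {G : Type*} [NormedAddCommGroup G] [NormedSpace ℝ G]
    (hU : IsInvariantNhd U) (hz : z ∈ domain mode U m) {f : ConjTangent E M → G} {F F' : E × E → G}
    (hF : ContDiffAt ℝ ∞ F z) (hF' : ContDiffAt ℝ ∞ F' z)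
    (e : ∀ x ∈ U, x.1 ∈ (chartAt E m).source → f x = F (tc m x) - F' (tc m x))
    (hv : ∀ p ∈ mode.points U, p.1 ∈ (chartAt E m).source → mode.Vanishes f p) :
    JetEq mode z F F' := by
  cases mode
  · refine ⟨hF, hF', ?_⟩
    filter_upwards [(isOpen_domain hU rfl).mem_nhds hz] with w hw
    have h1 := e _ hw.2 (tc_symm_proj hw.1)
    have h2 : f ((tc m).symm w) = 0 := hv _ hw.2 (tc_symm_proj hw.1)
    rw [(tc m).right_inv hw.1, h2] at h1
    exact sub_eq_zero.1 h1.symm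
  · have h : z = tc m ⟨m, 0⟩ := hz
    subst h
    refine JetEq.of_sub hF' ⟨hF.sub hF', contDiffAt_const, fun k => ?_⟩
    have h0 := hv ⟨m, 0⟩ rfl (mem_chart_source E m) k
    have h1 : (fun w => F w - F' w) =ᶠ[𝓝 (tc m ⟨m, 0⟩)] f ∘ (tc m).symm := by
      filter_upwards [eventually_tc (m := m) (mem_chart_source E m)
        (hU.isOpen.mem_nhds (hU.zero_subset
          (show (⟨m, 0⟩ : ConjTangent E M) ∈ zeroSection E M from rfl)))] with w hw
      obtain ⟨y, h1, h2, h3, h4⟩ := hw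
      rw [Function.comp_apply, h3, e y h2 h1, h4]
    rw [(h1.iteratedFDeriv ℝ k).eq_of_nhds]
    exact h0.trans (by simp)

/-- Formal vanishing at x is defined by the chart at x, which depends only on the base point of x.
Hence the chart `tc x.1`. -/
lemma vanishes_of_jetEq {G : Type*} [NormedAddCommGroup G] [NormedSpace ℝ G]
    (hx : x ∈ mode.points U) {f : ConjTangent E M → G}
    {F F' : E × E → G} (h : JetEq mode (tc x.1 x) F F')
    (e : ∀ᶠ y in 𝓝 x, y.1 ∈ (chartAt E x.1).source → f y = F (tc x.1 y) - F' (tc x.1 y)) :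
    mode.Vanishes f x := by
  cases mode
  · have h1 := e.self_of_nhds (mem_chart_source E x.1)
    show f x = 0
    rw [h1, h.eq_at, sub_self]
  · intro k
    have h1 : f ∘ (tc x.1).symm =ᶠ[𝓝 (tc x.1 x)] fun w => F w - F' w := by
      filter_upwards [eventually_tc (mem_chart_source E x.1) e] with w hw
      obtain ⟨y, h1, h2, h3, h4⟩ := hw
      rw [Function.comp_apply, h3, h2 h1, h4]
    have h2 := h.sub_zero_iff.2.2 k
    refine ((h1.iteratedFDeriv ℝ k).eq_of_nhds).trans (h2.trans ?_)
    simp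

/-! ### Vector fields along maps, in coordinates. -/

section Along

variable {F₀ H N : Type*} [NormedAddCommGroup F₀] [NormedSpace ℝ F₀] [TopologicalSpace H]
  (𝕀 : ModelWithCorners ℝ F₀ H) [𝕀.Boundaryless] [TopologicalSpace N] [ChartedSpace H N]
  [IsManifold 𝕀 ∞ N] {φ : ConjTangent E M → N} {ξ : ∀ x, TangentSpace 𝕀 (φ x)} {n : N}

/-- Vector fields along a map that vanish at the points of `U`, in coordinates. -/
lemma jetEq_of_vanishesAlong [FiniteDimensional ℝ F₀]
    (hU : IsInvariantNhd U) (hz : z ∈ domain mode U m) {F F' : E × E → F₀}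
    (hF : ContDiffAt ℝ ∞ F z) (hF' : ContDiffAt ℝ ∞ F' z)
    (hφ : ∀ x, x.1 ∈ (chartAt E m).source → φ x ∈ (extChartAt 𝕀 n).source)
    (e : ∀ x ∈ U, x.1 ∈ (chartAt E m).source →
      dChart 𝕀 n (φ x) (ξ x) = F (tc m x) - F' (tc m x))
    (hv : ∀ p ∈ mode.points U, p.1 ∈ (chartAt E m).source → mode.VanishesAlong 𝕀 φ ξ p) :
    JetEq mode z F F' := by
  cases mode
  · refine jetEq_of_vanishes hU hz hF hF' e fun p hp hpm => ?_
    have : ξ p = 0 := hv p hp hpm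
    show dChart 𝕀 n (φ p) (ξ p) = 0
    rw [this, map_zero]
  -- The test functions are linear functionals of the chart of N; their differentials read off the
  -- components of the field.
  · refine JetEq.ext_dual fun ℓ => ?_
    have hd : ∀ x : ConjTangent E M, x.1 ∈ (chartAt E m).source → ∀ v,
        mfderiv 𝕀 𝓘(ℝ, ℝ) (ℓ ∘ extChartAt 𝕀 n) (φ x) v = ℓ (dChart 𝕀 n (φ x) v) := by
      intro x hx v
      have h1 := mfderiv_comp (φ x) (ℓ.mdifferentiableAt (x := extChartAt 𝕀 n (φ x)))
        (mdifferentiableAt_chart 𝕀 (hφ x hx))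
      rw [ℓ.mfderiv_eq] at h1
      exact congrArg (fun l => l v) h1
    refine jetEq_of_vanishes hU hz
      (f := fun x => (mfderiv 𝕀 𝓘(ℝ, ℝ) (ℓ ∘ extChartAt 𝕀 n) (φ x) (ξ x) : ℝ))
      (ℓ.contDiff.contDiffAt.comp z hF) (ℓ.contDiff.contDiffAt.comp z hF')
      (fun x hx hxm => ?_) fun p hp hpm => ?_
    · refine (hd x hxm _).trans ?_
      rw [e x hx hxm, map_sub]
    · have hs := hφ p hpm
      rw [extChartAt_source] at hs
      exact hv p hp hpm _ (ℓ.contMDiff.contMDiffAt.comp (φ p) (contMDiffAt_extChartAt' hs))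

/-- For a test function g, dg(ξ) is a smooth operator-valued coefficient, the derivative of g in the
chart along Φ, applied to F - F'. If F - F' is flat, so is the product. -/
lemma vanishesAlong_of_jetEq (hx : x ∈ mode.points U) {F F' : E × E → F₀}
    (h : JetEq mode (tc x.1 x) F F') {Φ : E × E → F₀} (hΦ : ContDiffAt ℝ ∞ Φ (tc x.1 x))
    (hφ : ∀ᶠ y in 𝓝 x, y.1 ∈ (chartAt E x.1).source →
      φ y ∈ (extChartAt 𝕀 n).source ∧ extChartAt 𝕀 n (φ y) = Φ (tc x.1 y) ∧
      dChart 𝕀 n (φ y) (ξ y) = F (tc x.1 y) - F' (tc x.1 y)) :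
    mode.VanishesAlong 𝕀 φ ξ x := by
  have hφx := hφ.self_of_nhds (mem_chart_source E x.1)
  cases mode
  · have h1 := hφx.2.2
    rw [h.eq_at, sub_self] at h1
    obtain ⟨L, hL⟩ := isInvertible_dChart 𝕀 hφx.1
    show ξ x = 0
    rw [← hL] at h1
    exact L.map_eq_zero_iff.1 h1
  · intro g hg
    have hg' := (contMDiffAt_iff_chart 𝕀 hφx.1).1 hg
    rw [hφx.2.1] at hg'
    have hdg : ∀ᶠ w in 𝓝 (tc x.1 x), ContDiffAt ℝ 1 (fun z => g ((extChartAt 𝕀 n).symm z)) (Φ w) :=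
      hΦ.continuousAt.eventually ((hg'.of_le (m := 1) (by simp)).eventually (by simp))
    have hdg' : ∀ᶠ y in 𝓝 x, ContDiffAt ℝ 1 (fun z => g ((extChartAt 𝕀 n).symm z))
        (Φ (tc x.1 y)) :=
      (continuousAt_extChartAt' (mem_tc_source.2 (mem_chart_source E x.1))).eventually hdg
    have hs : ContDiffAt ℝ ∞ (fun w => fderiv ℝ (fun z => g ((extChartAt 𝕀 n).symm z)) (Φ w))
        (tc x.1 x) := (hg'.fderiv_right (by simp)).comp _ hΦ
    have h1 := (JetEq.refl hs).apply h.sub_zero_iff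
    refine vanishes_of_jetEq (mode := .formal) hx h1 ?_
    filter_upwards [hφ, hdg'] with y h2 h3 hy
    obtain ⟨h4, h5, h6⟩ := h2 hy
    have hgm : MDifferentiableAt 𝕀 𝓘(ℝ, ℝ) g (φ y) := by
      have h7 : MDifferentiableAt 𝓘(ℝ, F₀) 𝓘(ℝ, ℝ) (fun z => g ((extChartAt 𝕀 n).symm z))
        (extChartAt 𝕀 n (φ y)) := by
          rw [h5]; exact (h3.differentiableAt (by simp)).mdifferentiableAt
      refine (h7.comp (φ y) (mdifferentiableAt_chart 𝕀 h4)).congr_of_eventuallyEq ?_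
      filter_upwards [extChartAt_source_mem_nhds' (I := 𝕀) h4] with q hq
      simp only [Function.comp_apply, (extChartAt 𝕀 n).left_inv hq]
    have h8 := mfderiv_eq_fderiv_chart 𝕀 hgm h4 (ξ y)
    rw [h6, h5] at h8
    refine h8.trans ?_
    simp only [map_zero, sub_zero]
    rfl

end Along

variable {I J : ∀ x : ConjTangent E M, TT x →L[ℝ] TT x}
  {h : ∀ x : ConjTangent E M, TT x →L[ℝ] TT x →L[ℝ] ℝ}

lemma IsPolarizedHodgeOver.contDiffAt (H : IsPolarizedHodgeOver mode U I J h)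
    (hz : z ∈ domain mode U m) : ContDiffAt ℝ ∞ (locEnd I m) z ∧ ContDiffAt ℝ ∞ (locEnd J m) z ∧
      ContDiffAt ℝ ∞ (locBil h m) z := by
  obtain ⟨x, -, hx, hxm, rfl⟩ := exists_of_mem_domain H.nhd hz
  have hU := H.nhd.isOpen
  exact ⟨contDiffAt_locEnd H.hodge.smooth_I hU hx hxm, contDiffAt_locEnd H.hodge.smooth_J hU hx hxm,
    contDiffAt_locBil H.polarization.smooth hU hx hxm⟩

/-- A polarized Hodge manifold structure in the chart `tc m`. -/
theorem IsPolarizedHodgeOver.localHodge (H : IsPolarizedHodgeOver mode U I J h) (m : M) :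
    LocalHodge mode (domain mode U m) (locEnd I m) (locEnd J m) (locBil h m) := by
  have hid : ∀ x : ConjTangent E M, x.1 ∈ (chartAt E m).source →
      id x ∈ (extChartAt (modelT E) (⟨m, 0⟩ : ConjTangent E M)).source := fun x hx =>
    mem_tc_source.2 hx
  have hro : ∀ u : Circle, ∀ x : ConjTangent E M, x.1 ∈ (chartAt E m).source →
      rotate u x ∈ (extChartAt (modelT E) (⟨m, 0⟩ : ConjTangent E M)).source := fun u x hx =>
    (mem_tc_source (x := rotate u x)).2 hx
  have sc : ∀ (ξ : E × E) (p : ConjTangent E M), p.1 ∈ (chartAt E m).source →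
      SmoothAt (coordField m ξ) p := fun ξ p hp =>
    smoothAt_coordField hp ξ
  have sI : ∀ z ∈ domain mode U m, ContDiffAt ℝ ∞ (locEnd I m) z := fun z hz => (H.contDiffAt hz).1
  have sJ : ∀ z ∈ domain mode U m, ContDiffAt ℝ ∞ (locEnd J m) z := fun z hz => (H.contDiffAt hz).2.1
  have sh : ∀ z ∈ domain mode U m, ContDiffAt ℝ ∞ (locBil h m) z := fun z hz => (H.contDiffAt hz).2.2
  have hrot : ∀ u : Circle, ∀ z ∈ domain mode U m, rot u z ∈ domain mode U m := fun u z hz =>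
    rot_mem_domain H.nhd u hz
  have sr : ∀ (u : Circle) (z : E × E), ContDiffAt ℝ ∞ (rot (E := E) u) z := fun u z =>
    (rot (E := E) u).contDiff.contDiffAt
  have c : ∀ {ξ z : E × E}, ContDiffAt ℝ ∞ (fun _ : E × E => ξ) z := contDiffAt_const
  have eA : ∀ (A : ∀ x : ConjTangent E M, TT x →L[ℝ] TT x) (ξ : E × E) (x : ConjTangent E M),
      x.1 ∈ (chartAt E m).source → dT m x (A x (coordField m ξ x)) = locEnd A m (tc m x) ξ :=
    fun A ξ x hx => by rw [← locEnd_apply A hx, dT_coordField hx]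
  have eAA : ∀ (A B : ∀ x : ConjTangent E M, TT x →L[ℝ] TT x) (ξ : E × E) (x : ConjTangent E M),
      x.1 ∈ (chartAt E m).source → dT m x (A x (B x (coordField m ξ x))) =
        locEnd A m (tc m x) (locEnd B m (tc m x) ξ) :=
    fun A B ξ x hx => by rw [← locEnd_apply A hx, eA B ξ x hx]
  have eR : ∀ (A : ∀ x : ConjTangent E M, TT x →L[ℝ] TT x) (u : Circle) (x : ConjTangent E M)
      (v : TT (rotate u x)), x.1 ∈ (chartAt E m).source →
      dT m (rotate u x) (A (rotate u x) v) = locEnd A m (rot u (tc m x)) (dT m (rotate u x) v) :=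
    fun A u x v hx => by
      rw [← tc_rotate u hx]
      exact (locEnd_apply A (x := rotate u x) hx v).symm
  have eB : ∀ (x : ConjTangent E M) (v w : TT x), x.1 ∈ (chartAt E m).source →
      h x v w = locBil h m (tc m x) (dT m x v) (dT m x w) :=
    fun x v w hx => (locBil_apply h hx v w).symm
  -- All identities are tested on the coordinate fields of the chart, whose coordinate expressions
  -- are constant vectors.
  refine
    { isOpen := isOpen_domain H.nhd
      rot_mem := hrot
      smooth_I := sI
      smooth_J := sJ
      smooth_h := sh
      I_sq := fun z hz => JetEq.clm_ext fun ξ => ?_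
      J_sq := fun z hz => JetEq.clm_ext fun ξ => ?_
      anticomm := fun z hz => JetEq.clm_ext fun ξ => ?_
      rot_I := fun u z hz => JetEq.clm_ext fun ξ => ?_
      rot_J := fun u z hz => JetEq.clm_ext fun ξ => ?_
      symm := fun z hz ξ η => ?_
      herm_I := fun z hz ξ η => ?_
      herm_J := fun z hz ξ η => ?_
      rot_h := fun u z hz ξ η => ?_
      closed_J := fun z hz ξ η ζ => ?_
      proj := fun z hz => JetEq.clm_ext fun ξ => ?_ }
  · refine jetEq_of_vanishesAlong (modelT E) H.nhd hz
      (((sI z hz).clm_comp (sI z hz)).clm_apply c) c hid (fun x hx hxm => ?_)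
      (fun p hp hpm => H.hodge.I_sq p hp _ (sc ξ p hpm))
    show dT m x (I x (I x (coordField m ξ x)) + coordField m ξ x) = _
    rw [map_add, eAA I I ξ x hxm, dT_coordField hxm]
    simp
  · refine jetEq_of_vanishesAlong (modelT E) H.nhd hz
      (((sJ z hz).clm_comp (sJ z hz)).clm_apply c) c hid (fun x hx hxm => ?_)
      (fun p hp hpm => H.hodge.J_sq p hp _ (sc ξ p hpm))
    show dT m x (J x (J x (coordField m ξ x)) + coordField m ξ x) = _
    rw [map_add, eAA J J ξ x hxm, dT_coordField hxm]
    simp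
  · refine jetEq_of_vanishesAlong (modelT E) H.nhd hz
      (((sI z hz).clm_comp (sJ z hz)).clm_apply c) (((sJ z hz).clm_comp (sI z hz)).neg.clm_apply c)
      hid (fun x hx hxm => ?_) (fun p hp hpm => H.hodge.anticomm p hp _ (sc ξ p hpm))
    show dT m x (I x (J x (coordField m ξ x)) + J x (I x (coordField m ξ x))) = _
    rw [map_add, eAA I J ξ x hxm, eAA J I ξ x hxm]
    simp
  · refine jetEq_of_vanishesAlong (modelT E) H.nhd hz
      ((contDiffAt_const.clm_comp (sI z hz)).clm_apply c)
      ((((sI _ (hrot u z hz)).comp z (sr u z)).clm_comp contDiffAt_const).clm_apply c)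
      (hro u) (fun x hx hxm => ?_) (fun p hp hpm => H.hodge.equivariant_I u p hp _ (sc ξ p hpm))
    show dT m (rotate u x) (dRotate u x (I x (coordField m ξ x)) -
      I (rotate u x) (dRotate u x (coordField m ξ x))) = _
    rw [map_sub, eR I u x _ hxm, dT_dRotate u hxm, dT_dRotate u hxm, eA I ξ x hxm,
      dT_coordField hxm]
    rfl
  · refine jetEq_of_vanishesAlong (modelT E) H.nhd hz
      ((contDiffAt_const.clm_comp (sJ z hz)).clm_apply c)
      ((((((sJ _ (hrot u z hz)).comp z (sr u z)).clm_comp contDiffAt_const).const_smul _).add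
        ((((sI _ (hrot u z hz)).comp z (sr u z)).clm_comp
          (((sJ _ (hrot u z hz)).comp z (sr u z)).clm_comp contDiffAt_const)).const_smul _)).clm_apply c)
      (hro u) (fun x hx hxm => ?_) (fun p hp hpm => H.hodge.equivariant_J u p hp _ (sc ξ p hpm))
    show dT m (rotate u x) (dRotate u x (J x (coordField m ξ x)) -
        ((u : ℂ).re • J (rotate u x) (dRotate u x (coordField m ξ x)) +
          (u : ℂ).im • I (rotate u x) (J (rotate u x) (dRotate u x (coordField m ξ x))))) = _
    rw [map_sub, map_add, map_smul, map_smul, eR I u x _ hxm, eR J u x _ hxm, dT_dRotate u hxm,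
      dT_dRotate u hxm, eA J ξ x hxm, dT_coordField hxm]
    rfl
  · refine jetEq_of_vanishes H.nhd hz (((sh z hz).clm_apply c).clm_apply c)
      (((sh z hz).clm_apply c).clm_apply c) (fun x hx hxm => ?_)
      (fun p hp hpm => H.polarization.symm p hp _ _ (sc ξ p hpm) (sc η p hpm))
    simp only [eB x _ _ hxm, dT_coordField hxm]
  · refine jetEq_of_vanishes H.nhd hz (((sh z hz).clm_apply ((sI z hz).clm_apply c)).clm_apply
      ((sI z hz).clm_apply c)) (((sh z hz).clm_apply c).clm_apply c) (fun x hx hxm => ?_)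
      (fun p hp hpm => H.polarization.hermitian_I p hp _ _ (sc ξ p hpm) (sc η p hpm))
    simp only [eB x _ _ hxm, dT_coordField hxm, eA I _ x hxm]
  · refine jetEq_of_vanishes H.nhd hz (((sh z hz).clm_apply ((sJ z hz).clm_apply c)).clm_apply
      ((sJ z hz).clm_apply c)) (((sh z hz).clm_apply c).clm_apply c) (fun x hx hxm => ?_)
      (fun p hp hpm => H.polarization.hermitian_J p hp _ _ (sc ξ p hpm) (sc η p hpm))
    simp only [eB x _ _ hxm, dT_coordField hxm, eA J _ x hxm]
  · refine jetEq_of_vanishes H.nhd hz ((((sh _ (hrot u z hz)).comp z (sr u z)).clm_apply c).clm_apply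
      c) (((sh z hz).clm_apply c).clm_apply c) (fun x hx hxm => ?_)
      (fun p hp hpm => H.polarization.invariant u p hp _ _ (sc ξ p hpm) (sc η p hpm))
    have h1 := locBil_apply h (x := rotate u x) hxm (dRotate u x (coordField m ξ x))
      (dRotate u x (coordField m η x))
    rw [dT_dRotate u hxm, dT_dRotate u hxm, tc_rotate u hxm, dT_coordField hxm,
      dT_coordField hxm] at h1
    rw [← h1, eB x _ _ hxm, dT_coordField hxm, dT_coordField hxm]
  · have s : ContDiffAt ℝ ∞ (fun w => (locBil h m w).comp (locEnd J m w)) z :=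
      (sh z hz).clm_comp (sJ z hz)
    refine jetEq_of_vanishes H.nhd hz ((JetEq.refl (mode := mode) s).dTwo ξ η ζ).left
      contDiffAt_const
      (fun x hx hxm => ?_) (fun p hp hpm =>
        H.polarization.kahler_J p hp _ _ _ (sc ξ p hpm) (sc η p hpm) (sc ζ p hpm))
    rw [extDerivTwo_coordField H.hodge.smooth_J H.polarization.smooth H.nhd.isOpen hx hxm, sub_zero]
  · refine jetEq_of_vanishesAlong (n := m) 𝓘(ℝ, E) H.nhd hz
      ((contDiffAt_const.clm_comp (sI z hz)).clm_apply c)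
      contDiffAt_const (fun x hx => by rwa [extChartAt_source]) (fun x hx hxm => ?_)
      (fun p hp hpm => H.holomorphic p hp _ (sc ξ p hpm))
    have h1 := dB_mfderiv_proj hxm (I x (coordField m ξ x))
    have h2 := dB_mfderiv_proj hxm (coordField m ξ x)
    rw [eA I ξ x hxm] at h1
    rw [dT_coordField hxm] at h2
    rw [dChart_eq_dB hxm]
    refine ((dB E m x.1).map_sub _ _).trans ?_
    refine congrArg₂ _ h1 (((dB E m x.1).map_smul _ _).trans ?_)
    exact congrArg (fun v : E => Complex.I • v) h2

end Transfer
/-! ### Maps to the cotangent bundle in coordinates, and their uniqueness -/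

section Uniqueness

universe u v

variable {E : Type u} [NormedAddCommGroup E] [NormedSpace ℂ E] [FiniteDimensional ℂ E]
  {M : Type v} [TopologicalSpace M] [ChartedSpace E M] [IsManifold 𝓘(ℂ, E) ω M]
  {m : M} {x : ConjTangent E M} {mode : Mode} {U W : Set (ConjTangent E M)} {z : E × E}
  {I J : ∀ x : ConjTangent E M, TT x →L[ℝ] TT x}
  {h : ∀ x : ConjTangent E M, TT x →L[ℝ] TT x →L[ℝ] ℝ}
  {κ κ' : ConjTangent E M → Cotangent E M}

lemma formI_chart (I J : ∀ x : ConjTangent E M, TT x →L[ℝ] TT x)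
    (h : ∀ x : ConjTangent E M, TT x →L[ℝ] TT x →L[ℝ] ℝ) (hx : x.1 ∈ (chartAt E m).source)
    (v w : TT x) : formI I J h x v w =
      locForm (locEnd I m) (locEnd J m) (locBil h m) (tc m x) (dT m x v) (dT m x w) := by
  show _ = cForm _ _ _ (dT m x v) (dT m x w)
  rw [cForm_apply, locEnd_apply J hx, locEnd_apply I hx, locBil_apply h hx, locBil_apply h hx]
  rfl

lemma Mode.points_mono (mode : Mode) (hWU : W ⊆ U) : mode.points W ⊆ mode.points U := by
  cases mode
  · exact hWU
  · exact subset_rfl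

lemma IsCotangentMap.mono (C : IsCotangentMap mode U I J h κ) (hW : IsInvariantNhd W) (hWU : W ⊆ U) :
    IsCotangentMap mode W I J h κ where
  nhd := hW
  smooth := C.smooth.mono hWU
  proj_eq x hx := C.proj_eq x (hWU hx)
  equivariant u p hp := C.equivariant u p (mode.points_mono hWU hp)
  holomorphic p hp := C.holomorphic p (mode.points_mono hWU hp)
  symplectic p hp := C.symplectic p (mode.points_mono hWU hp)

lemma IsInvariantNhd.inter (hU : IsInvariantNhd U) (hW : IsInvariantNhd W) :
    IsInvariantNhd (U ∩ W) where
  isOpen := hU.isOpen.inter hW.isOpen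
  zero_subset := Set.subset_inter hU.zero_subset hW.zero_subset
  rotate_mem u x hx := ⟨hU.rotate_mem u x hx.1, hW.rotate_mem u x hx.2⟩

lemma IsInvariantNhd.points_subset (hU : IsInvariantNhd U) : mode.points U ⊆ U := by
  cases mode
  · exact subset_rfl
  · exact hU.zero_subset

/-- The fibre coordinates of a map to the cotangent bundle, in charts. -/
def locCot (κ : ConjTangent E M → Cotangent E M) (m : M) (z : E × E) : E →L[ℂ] ℂ :=
  (cc m (κ ((tc m).symm z))).2

lemma locCot_apply (κ : ConjTangent E M → Cotangent E M) (hx : x.1 ∈ (chartAt E m).source) :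
    locCot κ m (tc m x) = (cc m (κ x)).2 := by
  rw [locCot, (tc m).left_inv (mem_tc_source.2 hx)]

lemma cc_eq (hκ : (κ x).1 = x.1) (hx : x.1 ∈ (chartAt E m).source) :
    cc m (κ x) = ((tc m x).1, locCot κ m (tc m x)) := by
  refine Prod.ext ?_ (locCot_apply κ hx).symm
  rw [cc_fst, hκ]
  rfl

lemma contDiffAt_locCot (hκ : ContMDiffAt (modelT E) (modelC E) ∞ κ x)
    (hp : (κ x).1 = x.1) (hx : x.1 ∈ (chartAt E m).source) :
    ContDiffAt ℝ ∞ (locCot κ m) (tc m x) := by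
  have hs := mem_cc_source.2 (hp ▸ hx : (κ x).1 ∈ (chartAt E m).source)
  have h1 : ContMDiffAt (modelT E) 𝓘(ℝ, E × (E →L[ℂ] ℂ)) ∞ (fun x => cc m (κ x)) x :=
    (contMDiffAt_extChartAt' (by rwa [extChartAt_source] at hs)).comp x hκ
  exact ((contMDiffAt_iff_chart (modelT E) (mem_tc_source.2 hx)).1 h1).snd

/-- The derivative of a map to the cotangent bundle over the identity, in charts. -/
lemma dC_mfderiv (hκ : ContMDiffAt (modelT E) (modelC E) ∞ κ x)
    (hp : ∀ᶠ y in 𝓝 x, (κ y).1 = y.1) (hx : x.1 ∈ (chartAt E m).source) (v : TT x) :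
    dC m (κ x) (mfderiv (modelT E) (modelC E) κ x v) =
      ((dT m x v).1, fderiv ℝ (locCot κ m) (tc m x) (dT m x v)) := by
  have hpx := hp.self_of_nhds
  have hs := mem_cc_source.2 (hpx ▸ hx : (κ x).1 ∈ (chartAt E m).source)
  have h1 := dChart_mfderiv (modelT E) (modelC E) (hκ.mdifferentiableAt (by simp))
    (mem_tc_source.2 hx) hs v
  refine h1.trans ?_
  have e : (fun w => cc m (κ ((tc m).symm w))) =ᶠ[𝓝 (tc m x)] fun w => (w.1, locCot κ m w) := by
    filter_upwards [eventually_tc hx hp] with w hw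
    obtain ⟨y, h1, h2, h3, h4⟩ := hw
    rw [h3, ← h4]
    exact cc_eq h2 h1
  have hd := ((contDiffAt_locCot hκ hpx hx).differentiableAt (by simp)).hasFDerivAt
  have h2 := (hasFDerivAt_fst (𝕜 := ℝ) (p := tc m x)).prodMk hd
  rw [e.fderiv_eq, h2.fderiv]
  rfl

lemma IsCotangentMap.contMDiffAt (C : IsCotangentMap mode W I J h κ) (hx : x ∈ W) :
    ContMDiffAt (modelT E) (modelC E) ∞ κ x :=
  (C.smooth x hx).contMDiffAt (C.nhd.isOpen.mem_nhds hx)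

lemma IsCotangentMap.eventually_proj (C : IsCotangentMap mode W I J h κ) (hx : x ∈ W) :
    ∀ᶠ y in 𝓝 x, (κ y).1 = y.1 := by
  filter_upwards [C.nhd.isOpen.mem_nhds hx] with y hy using C.proj_eq y hy

/-- Maps to the cotangent bundle that agree at the points of `W`, in coordinates. -/
lemma jetEq_of_agree (hW : IsInvariantNhd W) (hz : z ∈ domain mode W m)
    {F F' : E × E → E →L[ℂ] ℂ} (hF : ContDiffAt ℝ ∞ F z) (hF' : ContDiffAt ℝ ∞ F' z)
    (hκ : ∀ x ∈ W, (κ x).1 = x.1)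
    (e : ∀ x ∈ W, x.1 ∈ (chartAt E m).source → (cc m (κ x)).2 = F (tc m x))
    (e' : ∀ x ∈ W, x.1 ∈ (chartAt E m).source → (cc m (κ' x)).2 = F' (tc m x))
    (hv : ∀ p ∈ mode.points W, p.1 ∈ (chartAt E m).source → mode.Agree κ κ' p) :
    JetEq mode z F F' := by
  refine JetEq.ext_dual fun ℓ => ?_
  have s1 : ContDiffAt ℝ ∞ (fun w => ℓ (F w)) z := ℓ.contDiff.contDiffAt.comp z hF
  have s2 : ContDiffAt ℝ ∞ (fun w => ℓ (F' w)) z := ℓ.contDiff.contDiffAt.comp z hF'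
  refine jetEq_of_vanishes hW hz (f := fun x => ℓ (cc m (κ x)).2 - ℓ (cc m (κ' x)).2)
    s1 s2 (fun x hx hxm => by rw [e x hx hxm, e' x hx hxm]) fun p hp hpm => ?_
  have hA := hv p hp hpm
  cases mode
  · have hA' : κ p = κ' p := hA
    show ℓ (cc m (κ p)).2 - ℓ (cc m (κ' p)).2 = 0
    rw [hA', sub_self]
  · refine hA.2 (fun q => ℓ (cc m q).2) ?_
    have hs := mem_cc_source.2 (by rwa [hκ p (hW.zero_subset hp)] : (κ p).1 ∈ (chartAt E m).source)
    have h1 : ContMDiffAt (modelC E) 𝓘(ℝ, E × (E →L[ℂ] ℂ)) ∞ (cc m) (κ p) :=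
      contMDiffAt_extChartAt' (by rwa [extChartAt_source] at hs)
    exact (ℓ.comp (ContinuousLinearMap.snd ℝ E (E →L[ℂ] ℂ))).contMDiff.contMDiffAt.comp (κ p) h1

/-- Both maps cover the identity, so they differ only in their fibre coordinates. Any test function
on T^*M is a smooth function of the base and fibre coordinates. -/
lemma agree_of_jetEq (hx : x ∈ mode.points W) {F F' : E × E → E →L[ℂ] ℂ}
    (hj : JetEq mode (tc x.1 x) F F')
    (e : ∀ᶠ y in 𝓝 x, y.1 ∈ (chartAt E x.1).source → (κ y).1 = y.1 ∧ (κ' y).1 = y.1 ∧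
      (cc x.1 (κ y)).2 = F (tc x.1 y) ∧ (cc x.1 (κ' y)).2 = F' (tc x.1 y)) :
    mode.Agree κ κ' x := by
  have hm := mem_chart_source E x.1
  have hsrc : ∀ (κ : ConjTangent E M → Cotangent E M) (y : ConjTangent E M), (κ y).1 = y.1 →
      y.1 ∈ (chartAt E x.1).source → κ y ∈ (cc (E := E) x.1).source := fun κ y h1 h2 =>
    mem_cc_source.2 (by rwa [h1])
  have hcc : ∀ (κ : ConjTangent E M → Cotangent E M) (y : ConjTangent E M)
      (F : E × E → E →L[ℂ] ℂ), (κ y).1 = y.1 → (cc x.1 (κ y)).2 = F (tc x.1 y) →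
      cc x.1 (κ y) = ((tc x.1 y).1, F (tc x.1 y)) := fun κ y F h1 h2 => by
    refine Prod.ext ?_ h2
    rw [cc_fst, h1]
    rfl
  have hx0 : κ x = κ' x := by
    obtain ⟨h1, h2, h3, h4⟩ := e.self_of_nhds hm
    refine (cc x.1).injOn (hsrc κ x h1 hm) (hsrc κ' x h2 hm) ?_
    rw [hcc κ x F h1 h3, hcc κ' x F' h2 h4, hj.eq_at]
  cases mode
  · exact hx0
  · refine ⟨hx0, fun g hg => ?_⟩
    obtain ⟨h1, h2, h3, h4⟩ := e.self_of_nhds hm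
    have hg' := (contMDiffAt_iff_chart (modelC E) (hsrc κ x h1 hm)).1 hg
    rw [hcc κ x F h1 h3] at hg'
    have j1 := (JetEq.refl (mode := .formal) (contDiffAt_fst (𝕜 := ℝ) (n := ∞)
      (p := tc x.1 x))).prodMk hj
    have j2 := j1.comp_left (fun q => g ((cc x.1).symm q)) hg'
    refine vanishes_of_jetEq (mode := .formal) hx j2 ?_
    filter_upwards [e] with y hy hym
    obtain ⟨h1, h2, h3, h4⟩ := hy hym
    rw [← hcc κ y F h1 h3, ← hcc κ' y F' h2 h4, (cc x.1).left_inv (hsrc κ y h1 hym),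
      (cc x.1).left_inv (hsrc κ' y h2 hym)]

/-- A map to the cotangent bundle is determined by the contraction of the symplectic form with the
generator of the action of `U(1)`. -/
theorem IsCotangentMap.eq_contraction (hU : IsInvariantNhd U) (hI : SmoothEndOn I U)
    (hJ : SmoothEndOn J U) (hh : SmoothBilinOn h U)
    (hWU : W ⊆ U) (C : IsCotangentMap mode W I J h κ) (hz : z ∈ domain mode W m) (η : E × E) :
    JetEq mode z (fun w => locCot κ m w η.1)
      (fun w => contraction (locForm (locEnd I m) (locEnd J m) (locBil h m)) w η) := by
  have hW := C.nhd
  have sk : ∀ z ∈ domain mode W m, ContDiffAt ℝ ∞ (locCot κ m) z := fun z hz => by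
    obtain ⟨x, -, hx, hxm, rfl⟩ := exists_of_mem_domain hW hz
    exact contDiffAt_locCot (C.contMDiffAt hx) (C.proj_eq x hx) hxm
  refine JetEq.eq_contraction (P := domain mode W m) (isOpen_domain hW) sk
    (fun u z hz => ?_) (fun z hz ξ η => ?_) hz η
  · refine jetEq_of_agree (κ := fun x => κ (rotate u x)) (κ' := fun x => rotateCot u (κ x)) hW hz
      ((sk _ (rot_mem_domain hW u hz)).comp z
      (rot (E := E) u).contDiff.contDiffAt) ((sk z hz).const_smul (u : ℂ))
      (fun x hx => C.proj_eq _ (hW.rotate_mem u x hx)) (fun x hx hxm => ?_) (fun x hx hxm => ?_)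
      (fun p hp hpm => C.equivariant u p hp)
    · rw [← locCot_apply κ (x := rotate u x) hxm, tc_rotate u hxm]
    · rw [cc_rotateCot u (by rwa [C.proj_eq x hx]), locCot_apply κ hxm]
  · have sΩ : ContDiffAt ℝ ∞ (locForm (locEnd I m) (locEnd J m) (locBil h m)) z := by
      obtain ⟨x, -, hx, hxm, rfl⟩ := exists_of_mem_domain hW hz
      have h1 := contDiffAt_locEnd hI hU.isOpen (hWU hx) hxm
      have h2 := contDiffAt_locEnd hJ hU.isOpen (hWU hx) hxm
      have h3 := contDiffAt_locBil hh hU.isOpen (hWU hx) hxm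
      exact (contDiffAt_const.clm_comp (h3.clm_comp h2)).add
        (contDiffAt_const.clm_comp (h3.clm_comp (h1.clm_comp h2)))
    have sd : ∀ ξ : E × E, ContDiffAt ℝ ∞ (fun w => fderiv ℝ (locCot κ m) w ξ) z := fun ξ =>
      ((sk z hz).fderiv_right (by simp)).clm_apply contDiffAt_const
    have sd' : ∀ ξ η : E × E, ContDiffAt ℝ ∞ (fun w => fderiv ℝ (locCot κ m) w ξ η.1) z :=
      fun ξ η => (evC η.1).contDiff.contDiffAt.comp z (sd ξ)
    refine jetEq_of_vanishes hW hz ((sd' ξ η).sub (sd' η ξ))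
      ((sΩ.clm_apply contDiffAt_const).clm_apply contDiffAt_const) (fun x hx hxm => ?_)
      (fun p hp hpm => C.symplectic p hp _ _ (smoothAt_coordField hpm ξ)
        (smoothAt_coordField hpm η))
    have hq : (κ x).1 ∈ (chartAt E m).source := by rwa [C.proj_eq x hx]
    rw [canonicalForm_chart hq, formI_chart I J h hxm,
      dC_mfderiv (C.contMDiffAt hx) (C.eventually_proj hx) hxm,
      dC_mfderiv (C.contMDiffAt hx) (C.eventually_proj hx) hxm, dT_coordField hxm,
      dT_coordField hxm]

/-- In charts both maps equal the contraction of Ω_I with φ. The intersection with U matters because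
the structure is smooth only there, and the domain of a formal map need not lie in U. -/
theorem IsCotangentMap.agree (hU : IsInvariantNhd U) (hI : SmoothEndOn I U)
    (hJ : SmoothEndOn J U) (hh : SmoothBilinOn h U)
    {V V' : Set (ConjTangent E M)} (C : IsCotangentMap mode V I J h κ)
    (C' : IsCotangentMap mode V' I J h κ') (hx : x ∈ mode.points (V ∩ V' ∩ U)) :
    mode.Agree κ' κ x := by
  have hW := (C.nhd.inter C'.nhd).inter hU
  have D := C.mono hW (fun x hx => hx.1.1)
  have D' := C'.mono hW (fun x hx => hx.1.2)
  have hWU : V ∩ V' ∩ U ⊆ U := Set.inter_subset_right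
  have hx' := hW.points_subset hx
  refine agree_of_jetEq hx (JetEq.complexLinear_ext fun a =>
    (IsCotangentMap.eq_contraction hU hI hJ hh hWU D' (mem_domain hx) (a, 0)).trans
      (IsCotangentMap.eq_contraction hU hI hJ hh hWU D (mem_domain hx) (a, 0)).symm) ?_
  filter_upwards [hW.isOpen.mem_nhds hx'] with y hy hym
  exact ⟨D'.proj_eq y hy, D.proj_eq y hy, (locCot_apply κ' hym).symm, (locCot_apply κ hym).symm⟩

end Uniqueness
/-! ### The map to the cotangent bundle and its domain -/

section Construction

universe u v

variable {E : Type u} [NormedAddCommGroup E] [NormedSpace ℂ E] [FiniteDimensional ℂ E]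

/-! ### Behaviour of the potential under a change of chart. -/

section Covariance

variable {T J₀ J₁ : E × E →L[ℝ] E × E} {A : E →L[ℂ] E} {Ω₀ Ω₁ : E × E →L[ℝ] E × E →L[ℝ] ℂ}

lemma baseMap_covariant (h1 : ∀ ξ, (T ξ).1 = A ξ.1) (h2 : ∀ v, T (0, v) = (0, A v))
    (hJ : ∀ ξ, J₁ (T ξ) = T (J₀ ξ)) (v : E) : baseMap J₁ (A v) = A (baseMap J₀ v) := by
  rw [baseMap_apply, baseMap_apply, ← h2, hJ, h1]

lemma isInvertible_baseMap_iff (hA : A.IsInvertible) (h1 : ∀ ξ, (T ξ).1 = A ξ.1)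
    (h2 : ∀ v, T (0, v) = (0, A v)) (hJ : ∀ ξ, J₁ (T ξ) = T (J₀ ξ)) :
    (baseMap J₁).IsInvertible ↔ (baseMap J₀).IsInvertible := by
  obtain ⟨e, rfl⟩ := hA
  let e' : E ≃L[ℝ] E := e.restrictScalars ℝ
  have h : (baseMap J₁).comp (e' : E →L[ℝ] E) = (e' : E →L[ℝ] E).comp (baseMap J₀) :=
    ContinuousLinearMap.ext fun v => baseMap_covariant h1 h2 hJ v
  rw [← ContinuousLinearMap.isInvertible_comp_equiv (e := e'), h,
    ContinuousLinearMap.isInvertible_equiv_comp]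

/-- Here T plays the role of the derivative of a transition map over A. It intertwines the two
operators J, hence also the lifts J(0, B⁻¹ a), where B denotes `baseMap`; the complex-linear part is
compatible with the complex-linear A. -/
lemma potential_covariant (hA : A.IsInvertible) (h1 : ∀ ξ, (T ξ).1 = A ξ.1)
    (h2 : ∀ v, T (0, v) = (0, A v)) (hJ : ∀ ξ, J₁ (T ξ) = T (J₀ ξ))
    (hΩ : ∀ ξ η, Ω₁ (T ξ) (T η) = Ω₀ ξ η) (hB : (baseMap J₀).IsInvertible) (v a : E) :
    potential J₁ Ω₁ (A v) (A a) = potential J₀ Ω₀ v a := by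
  have hB' := (isInvertible_baseMap_iff hA h1 h2 hJ).2 hB
  have hl : ∀ a, lift J₁ (A a) = T (lift J₀ a) := by
    intro a
    have e : (baseMap J₁).inverse (A a) = A ((baseMap J₀).inverse a) := by
      refine hB'.injective ?_
      rw [hB'.self_apply_inverse, baseMap_covariant h1 h2 hJ, hB.self_apply_inverse]
    show J₁ (0, (baseMap J₁).inverse (A a)) = T (J₀ (0, (baseMap J₀).inverse a))
    rw [e, ← h2, hJ]
  have hr : ∀ a, (-Complex.I • Ω₁ (0, -Complex.I • A v)).comp (lift J₁) (A a) =
      (-Complex.I • Ω₀ (0, -Complex.I • v)).comp (lift J₀) a := by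
    intro a
    show -Complex.I • Ω₁ (0, -Complex.I • A v) (lift J₁ (A a)) =
      -Complex.I • Ω₀ (0, -Complex.I • v) (lift J₀ a)
    rw [hl, ← map_smul A, ← h2, hΩ]
  have hi : Complex.I • A a = A (Complex.I • a) := (A.map_smul _ _).symm
  rw [potential, potential, complexPart_apply, complexPart_apply, hr, hi, hr]

end Covariance

variable {M : Type v} [TopologicalSpace M] [ChartedSpace E M] [IsManifold 𝓘(ℂ, E) ω M]
  {m : M} {x : ConjTangent E M} {mode : Mode} {U W : Set (ConjTangent E M)} {z : E × E}
  {I J : ∀ x : ConjTangent E M, TT x →L[ℝ] TT x}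
  {h : ∀ x : ConjTangent E M, TT x →L[ℝ] TT x →L[ℝ] ℝ}

/-- The form `Ω_I` in the chart `tc m`. -/
def chartForm (I J : ∀ x : ConjTangent E M, TT x →L[ℝ] TT x)
    (h : ∀ x : ConjTangent E M, TT x →L[ℝ] TT x →L[ℝ] ℝ) (m : M) :
    E × E → E × E →L[ℝ] E × E →L[ℝ] ℂ :=
  locForm (locEnd I m) (locEnd J m) (locBil h m)

/-- The potential of `Ω_I` in the chart `tc m`. -/
def chartPotential (I J : ∀ x : ConjTangent E M, TT x →L[ℝ] TT x)
    (h : ∀ x : ConjTangent E M, TT x →L[ℝ] TT x →L[ℝ] ℝ) (m : M) (z : E × E) : E →L[ℂ] ℂ :=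
  potential (locEnd J m z) (chartForm I J h m z) z.2

/-- The map to the cotangent bundle. -/
def cotangentMap (I J : ∀ x : ConjTangent E M, TT x →L[ℝ] TT x)
    (h : ∀ x : ConjTangent E M, TT x →L[ℝ] TT x →L[ℝ] ℝ) (x : ConjTangent E M) : Cotangent E M :=
  ⟨x.1, (show E →L[ℂ] ℂ from chartPotential (E := E) I J h x.1 (tc x.1 x))⟩

/-- The fibre coordinates of the vertical vectors are mapped isomorphically to the base by `J`,
and in the actual case the form `Ω_I` vanishes on the fibres. -/
def IsGood (mode : Mode) (I J : ∀ x : ConjTangent E M, TT x →L[ℝ] TT x)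
    (h : ∀ x : ConjTangent E M, TT x →L[ℝ] TT x →L[ℝ] ℝ) (m : M) (z : E × E) : Prop :=
  (baseMap (locEnd J m z)).IsInvertible ∧ (mode = .actual → vert (chartForm I J h m) z = 0)

/-- The derivative of the transition map from the chart at the point itself. -/
lemma transition (I J : ∀ x : ConjTangent E M, TT x →L[ℝ] TT x)
    (h : ∀ x : ConjTangent E M, TT x →L[ℝ] TT x →L[ℝ] ℝ) (hx : x.1 ∈ (chartAt E m).source) :
    ∃ T : E × E →L[ℝ] E × E, (∀ ξ, (T ξ).1 = dB E m x.1 ξ.1) ∧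
      (∀ v, T (0, v) = (0, dB E m x.1 v)) ∧
      (∀ ξ, locEnd J m (tc m x) (T ξ) = T (locEnd J x.1 (tc x.1 x) ξ)) ∧
      ∀ ξ η, chartForm I J h m (tc m x) (T ξ) (T η) = chartForm I J h x.1 (tc x.1 x) ξ η := by
  have hs := mem_chart_source E x.1
  refine ⟨dT m x, fun ξ => dT_fst hx ξ, fun v => dT_vertical hx v, fun ξ => ?_, fun ξ η => ?_⟩
  · have h1 := locEnd_apply J hs (show TT x from ξ)
    rw [dT_self, dT_self] at h1
    rw [h1]
    exact locEnd_apply J hx _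
  · have h1 := formI_chart I J h hs (show TT x from ξ) (show TT x from η)
    rw [dT_self, dT_self] at h1
    exact (formI_chart I J h hx (show TT x from ξ) (show TT x from η)).symm.trans h1

/-- Change of chart acts on vertical vectors by the invertible derivative of the base chart, so
neither condition depends on the chart. -/
lemma isGood_iff (hx : x.1 ∈ (chartAt E m).source) :
    IsGood mode I J h m (tc m x) ↔ IsGood mode I J h x.1 (tc x.1 x) := by
  obtain ⟨T, h1, h2, h3, h4⟩ := transition I J h hx
  have hA := isInvertible_dB (E := E) hx
  refine and_congr (isInvertible_baseMap_iff hA h1 h2 h3) (imp_congr_right fun _ => ?_)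
  have h5 : ∀ v w : E, vert (chartForm I J h m) (tc m x) (dB E m x.1 v) (dB E m x.1 w) =
      vert (chartForm I J h x.1) (tc x.1 x) v w := fun v w => by
    rw [vert_apply, vert_apply, ← h2, ← h2, h4]
  constructor
  · intro h0
    refine ContinuousLinearMap.ext fun v => ContinuousLinearMap.ext fun w => ?_
    rw [← h5, h0]
    rfl
  · intro h0
    obtain ⟨L, hL⟩ := hA
    refine ContinuousLinearMap.ext fun v => ContinuousLinearMap.ext fun w => ?_
    have := h5 (L.symm v) (L.symm w)
    rw [← hL] at this
    simp only [ContinuousLinearEquiv.coe_coe, ContinuousLinearEquiv.apply_symm_apply] at this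
    rw [this, h0]
    rfl

/-- The definition of κ at x uses the chart over the base point of x, which varies with x.
Covariance replaces it by one fixed chart, and only then are smoothness and derivatives accessible.
-/
lemma locCot_cotangentMap (hx : x.1 ∈ (chartAt E m).source)
    (hg : IsGood mode I J h x.1 (tc x.1 x)) :
    locCot (cotangentMap I J h) m (tc m x) = chartPotential I J h m (tc m x) := by
  obtain ⟨T, h1, h2, h3, h4⟩ := transition I J h hx
  have hA := isInvertible_dB (E := E) hx
  obtain ⟨L, hL⟩ := id hA
  refine ContinuousLinearMap.ext fun a => ?_
  have ha : dB E m x.1 (L.symm a) = a := by rw [← hL]; exact L.apply_symm_apply a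
  have h5 := congrArg (fun l => l (L.symm a)) (cc_comp (q := cotangentMap I J h x) hx)
  have h6 := potential_covariant hA h1 h2 h3 h4 hg.1 (tc x.1 x).2 (L.symm a)
  rw [locCot_apply _ hx]
  have h7 : (tc m x).2 = dB E m x.1 (tc x.1 x).2 := by
    rw [tc_self, tc_apply hx]
  rw [chartPotential, h7]
  rw [ha] at h6
  rw [h6]
  refine Eq.trans ?_ h5
  show (cc m (cotangentMap I J h x)).2 a = (cc m (cotangentMap I J h x)).2 (dB E m x.1 (L.symm a))
  rw [ha]

/-! The domain. -/

lemma rotate_rotate (u u' : Circle) (x : ConjTangent E M) :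
    rotate u (rotate u' x) = rotate (u * u') x := by
  have : (starRingEnd ℂ (u : ℂ) • starRingEnd ℂ (u' : ℂ) • (show E from x.2) : E) =
      starRingEnd ℂ ((u * u' : Circle) : ℂ) • (show E from x.2) := by
    rw [smul_smul, Circle.coe_mul, map_mul]
  exact congrArg (fun v : E => (⟨x.1, v⟩ : ConjTangent E M)) this

lemma rotate_one (x : ConjTangent E M) : rotate 1 x = x := by
  have : (starRingEnd ℂ ((1 : Circle) : ℂ) • (show E from x.2) : E) = (show E from x.2) := by
    rw [Circle.coe_one, map_one]
    exact one_smul ℂ (show E from x.2)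
  exact congrArg (fun v : E => (⟨x.1, v⟩ : ConjTangent E M)) this

lemma continuous_rotate :
    Continuous (fun p : Circle × ConjTangent E M => rotate p.1 p.2) := by
  rw [continuous_iff_continuousAt]
  rintro ⟨u, x⟩
  have hs := mem_tc_source.2 (mem_chart_source E x.1)
  have h1 : ContinuousAt (fun p : Circle × ConjTangent E M => tc x.1 p.2) (u, x) :=
    (continuousAt_extChartAt' hs).comp continuousAt_snd
  have h2 : ContinuousAt (fun p : Circle × ConjTangent E M => rot p.1 (tc x.1 p.2)) (u, x) := by
    refine h1.fst.prodMk ((Continuous.continuousAt ?_).smul h1.snd)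
    exact Complex.continuous_conj.comp (continuous_induced_dom.comp continuous_fst)
  have h3 : ContinuousAt (tc (E := E) x.1).symm (rot u (tc x.1 x)) :=
    continuousAt_extChartAt_symm'' (mem_rot_target u ((tc x.1).map_source hs)).1
  have h4 := ContinuousAt.comp (f := fun p : Circle × ConjTangent E M => rot p.1 (tc x.1 p.2))
    (x := (u, x)) h3 h2
  refine h4.congr ?_
  have h5 : ∀ᶠ p : Circle × ConjTangent E M in 𝓝 (u, x), p.2 ∈ (tc (E := E) x.1).source :=
    continuousAt_snd.eventually (extChartAt_source_mem_nhds' hs)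
  filter_upwards [h5] with p hp
  have := (mem_rot_target p.1 ((tc x.1).map_source hp)).2
  rw [(tc x.1).left_inv hp] at this
  exact this

/-- The invariant part of a set. -/
def invariantPart (W : Set (ConjTangent E M)) : Set (ConjTangent E M) :=
  {x | ∀ u : Circle, rotate u x ∈ W}

/-- The complement of the invariant part is the image of a closed set under projection along the
compact group U(1), hence closed. Points of the zero section are fixed by the action, so they
remain. -/
lemma isInvariantNhd_invariantPart (hW : IsOpen W) (h0 : zeroSection E M ⊆ W) :
    IsInvariantNhd (invariantPart W) where
  isOpen := by
    have h1 : IsClosed {p : Circle × ConjTangent E M | rotate p.1 p.2 ∈ Wᶜ} :=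
      hW.isClosed_compl.preimage continuous_rotate
    have h2 := (isClosedMap_snd_of_compactSpace _ h1).isOpen_compl
    convert h2 using 1
    ext x
    simp [invariantPart]
  zero_subset x hx u := by
    have h : x.2 = 0 := hx
    have e : x = ⟨x.1, 0⟩ := by rw [← h]
    rw [e, rotate_zero]
    exact h0 rfl
  rotate_mem u x hx u' := by
    rw [rotate_rotate]
    exact hx _

lemma invariantPart_subset : invariantPart W ⊆ W := fun x hx => by
  have := hx 1
  rwa [rotate_one] at this

end Construction
/-! ### Existence -/

section Existence

universe u v

variable {E : Type u} [NormedAddCommGroup E] [NormedSpace ℂ E] [FiniteDimensional ℂ E]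
  {M : Type v} [TopologicalSpace M] [ChartedSpace E M] [IsManifold 𝓘(ℂ, E) ω M]
  {m : M} {x : ConjTangent E M} {mode : Mode} {U W : Set (ConjTangent E M)} {z : E × E}
  {I J : ∀ x : ConjTangent E M, TT x →L[ℝ] TT x}
  {h : ∀ x : ConjTangent E M, TT x →L[ℝ] TT x →L[ℝ] ℝ}
  {κ κ' : ConjTangent E M → Cotangent E M}

/-- The points near which the potential is defined and a primitive of `Ω_I`. -/
def goodSet (mode : Mode) (U : Set (ConjTangent E M)) (I J : ∀ x : ConjTangent E M, TT x →L[ℝ] TT x)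
    (h : ∀ x : ConjTangent E M, TT x →L[ℝ] TT x →L[ℝ] ℝ) : Set (ConjTangent E M) :=
  interior {x | x ∈ U ∧ IsGood mode I J h x.1 (tc x.1 x)}

lemma domain_mono (hWU : W ⊆ U) : domain mode W m ⊆ domain mode U m := by
  cases mode
  · exact Set.inter_subset_inter_right _ (Set.preimage_mono hWU)
  · exact subset_rfl

lemma tc_zero (m : M) : (tc m (⟨m, 0⟩ : ConjTangent E M)).2 = 0 :=
  congrArg Prod.snd (tc_self (⟨m, 0⟩ : ConjTangent E M))

namespace IsPolarizedHodgeOver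

/-- Invertibility of `baseMap` holds on the zero section and is an open condition. In the actual
case, `vert_actual` gives vanishing on a whole neighbourhood of each point. -/
lemma zeroSection_subset (H : IsPolarizedHodgeOver mode U I J h) :
    zeroSection E M ⊆ goodSet mode U I J h := by
  intro x hx
  have hx0 : x.2 = 0 := hx
  obtain ⟨m, v⟩ := x
  obtain rfl : v = 0 := hx0
  set x : ConjTangent E M := ⟨m, 0⟩ with hxdef
  have hm : x.1 ∈ (chartAt E m).source := mem_chart_source E m
  have hp : x ∈ mode.points U := by
    cases mode
    · exact H.nhd.zero_subset hx
    · exact hx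
  have hz := mem_domain hp
  have L := H.localHodge m
  have h1 : ∀ᶠ w in 𝓝 (tc m x), (baseMap (locEnd J m w)).IsInvertible :=
    isInvertible_nhds (smooth_baseMap (L.smooth_J _ hz)).continuousAt
      (L.isInvertible_baseMap hz (tc_zero m))
  have h2 : ∀ᶠ w in 𝓝 (tc m x), mode = .actual → vert (chartForm I J h m) w = 0 := by
    cases mode
    · exact (L.vert_actual hz (tc_zero m)).2.2.mono fun w hw _ => hw
    · exact Eventually.of_forall fun w hw => by cases hw
  have h3 := (continuousAt_extChartAt' (mem_tc_source.2 hm)).eventually (h1.and h2)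
  refine mem_interior_iff_mem_nhds.2 ?_
  filter_upwards [h3, H.nhd.isOpen.mem_nhds (H.nhd.zero_subset hx),
    extChartAt_source_mem_nhds' (I := modelT E) (mem_tc_source.2 hm)] with y h4 h5 h6
  exact ⟨h5, (isGood_iff (mem_tc_source.1 h6)).1 h4⟩

lemma isInvariantNhd (H : IsPolarizedHodgeOver mode U I J h) :
    IsInvariantNhd (invariantPart (goodSet mode U I J h)) :=
  isInvariantNhd_invariantPart isOpen_interior H.zeroSection_subset

end IsPolarizedHodgeOver

lemma invariantPart_goodSet_subset : invariantPart (goodSet mode U I J h) ⊆ U := fun _ hx =>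
  (interior_subset (invariantPart_subset hx)).1

lemma isGood_of_mem (hx : x ∈ invariantPart (goodSet mode U I J h))
    (hxm : x.1 ∈ (chartAt E m).source) : IsGood mode I J h m (tc m x) :=
  (isGood_iff hxm).2 (interior_subset (invariantPart_subset hx)).2

/-- A form on the total space from a derivative of a map to complex-linear forms on the base. -/
def pairing (E : Type*) [NormedAddCommGroup E] [NormedSpace ℂ E] [FiniteDimensional ℂ E] :
    (E →L[ℂ] ℂ) →L[ℝ] (E × E →L[ℝ] ℂ) :=
  ((ContinuousLinearMap.compL ℝ (E × E) E ℂ).flip (ContinuousLinearMap.fst ℝ E E)).comp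
    (complexRestrict E)

namespace IsPolarizedHodgeOver

lemma eventually_locCot (H : IsPolarizedHodgeOver mode U I J h)
    (hx : x ∈ invariantPart (goodSet mode U I J h)) (hxm : x.1 ∈ (chartAt E m).source) :
    locCot (cotangentMap I J h) m =ᶠ[𝓝 (tc m x)] chartPotential I J h m := by
  filter_upwards [eventually_tc hxm (H.isInvariantNhd.isOpen.mem_nhds hx)] with w hw
  obtain ⟨y, h1, h2, h3, rfl⟩ := hw
  exact locCot_cotangentMap h1 (isGood_of_mem h2 (mem_chart_source E y.1))

lemma smooth_locCot (H : IsPolarizedHodgeOver mode U I J h)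
    (hx : x ∈ invariantPart (goodSet mode U I J h)) (hxm : x.1 ∈ (chartAt E m).source) :
    ContDiffAt ℝ ∞ (locCot (cotangentMap I J h) m) (tc m x) := by
  have hU := H.nhd.isOpen
  have hxU := invariantPart_goodSet_subset hx
  have h1 := contDiffAt_locEnd H.hodge.smooth_I hU hxU hxm
  have h2 := contDiffAt_locEnd H.hodge.smooth_J hU hxU hxm
  have h3 := contDiffAt_locBil H.polarization.smooth hU hxU hxm
  have h4 : ContDiffAt ℝ ∞ (chartForm I J h m) (tc m x) :=
    (contDiffAt_const.clm_comp (h3.clm_comp h2)).add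
      (contDiffAt_const.clm_comp (h3.clm_comp (h1.clm_comp h2)))
  have h5 : ContDiffAt ℝ ∞ (chartPotential I J h m) (tc m x) :=
    (complexPart E).contDiff.contDiffAt.comp _
      ((smooth_contraction h4).clm_comp (smooth_lift h2 (isGood_of_mem hx hxm).1))
  exact h5.congr_of_eventuallyEq (H.eventually_locCot hx hxm)

/-- The Lagrangian property enters here: in the actual case it is part of the definition of the
domain, in the formal case it is known only for jets on the zero section, by `vert_formal`. -/
lemma locCot_eq_contraction (H : IsPolarizedHodgeOver mode U I J h)
    (hz : z ∈ domain mode (invariantPart (goodSet mode U I J h)) m) (ξ : E × E) :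
    JetEq mode z (fun w => locCot (cotangentMap I J h) m w ξ.1)
      (fun w => contraction (chartForm I J h m) w ξ) := by
  have hV := H.isInvariantNhd
  have L := H.localHodge m
  have hzU := domain_mono invariantPart_goodSet_subset hz
  obtain ⟨x, hxp, hx, hxm, rfl⟩ := exists_of_mem_domain hV hz
  have hv : JetEq mode (tc m x) (vert (chartForm I J h m)) (fun _ => 0) := by
    cases mode
    · refine ⟨smooth_vert (L.smooth_locForm hzU), contDiffAt_const, ?_⟩
      filter_upwards [eventually_tc hxm (hV.isOpen.mem_nhds hx)] with w hw
      obtain ⟨y, h1, h2, h3, rfl⟩ := hw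
      exact (isGood_of_mem h2 h1).2 rfl
    · have h0 : tc m x = tc m ⟨m, 0⟩ := hz
      exact L.vert_formal hzU (by rw [h0]; exact tc_zero m)
  refine (L.potential_eq hzU (isGood_of_mem hx hxm).1 hv ξ).congr_left ?_
  filter_upwards [H.eventually_locCot hx hxm] with w hw
  rw [hw]
  rfl

/-- The map to the cotangent bundle has all required properties. -/
theorem isCotangentMap (H : IsPolarizedHodgeOver mode U I J h) :
    IsCotangentMap mode (invariantPart (goodSet mode U I J h)) I J h (cotangentMap I J h) := by
  set V := invariantPart (goodSet mode U I J h) with hVdef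
  set κ := cotangentMap I J h with hκ
  have hV : IsInvariantNhd V := H.isInvariantNhd
  have hp : ∀ x, (κ x).1 = x.1 := fun _ => rfl
  have hs : ∀ x ∈ V, ContMDiffAt (modelT E) (modelC E) ∞ κ x := by
    intro x hx
    have hxm := mem_chart_source E x.1
    have hxs := mem_tc_source.2 hxm
    have h1 : ContMDiffAt (modelT E) 𝓘(ℝ, E × E) ∞ (tc x.1) x :=
      contMDiffAt_extChartAt' (by rwa [extChartAt_source] at hxs)
    have h2 : ContMDiffAt 𝓘(ℝ, E × E) 𝓘(ℝ, E × (E →L[ℂ] ℂ)) ∞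
        (fun w => (w.1, locCot κ x.1 w)) (tc x.1 x) :=
      (contDiffAt_fst.prodMk (H.smooth_locCot hx hxm)).contMDiffAt
    have h3 : ContMDiffAt 𝓘(ℝ, E × (E →L[ℂ] ℂ)) (modelC E) ∞ (cc x.1).symm
        ((tc x.1 x).1, locCot κ x.1 (tc x.1 x)) := by
      rw [← cc_eq (hp x) hxm]
      exact contMDiffAt_chart_symm (modelC E)
        ((cc x.1).map_source ((mem_cc_source (q := κ x)).2 hxm))
    have h4 := ContMDiffAt.comp (tc x.1 x) (f := fun w : E × E => (w.1, locCot κ x.1 w)) h3 h2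
    refine (h4.comp x h1).congr_of_eventuallyEq ?_
    filter_upwards [extChartAt_source_mem_nhds' (I := modelT E) hxs] with y hy
    have hym := mem_tc_source.1 hy
    simp only [Function.comp_apply]
    rw [← cc_eq (hp y) hym, (cc x.1).left_inv ((mem_cc_source (q := κ y)).2 hym)]
  have hd : ∀ x ∈ V, ∀ m : M, x.1 ∈ (chartAt E m).source → ∀ v : TT x,
      dC m (κ x) (mfderiv (modelT E) (modelC E) κ x v) =
        ((dT m x v).1, fderiv ℝ (locCot κ m) (tc m x) (dT m x v)) := fun x hx m hxm v =>
    dC_mfderiv (hs x hx) (.of_forall hp) hxm v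
  have hk : ∀ x ∈ V, ContDiffAt ℝ ∞ (locCot κ x.1) (tc x.1 x) := fun x hx =>
    H.smooth_locCot hx (mem_chart_source E x.1)
  have hpr : ∀ x ∈ mode.points V, ∀ ξ η : E × E, JetEq mode (tc x.1 x)
      (fun w => fderiv ℝ (locCot κ x.1) w ξ η.1 - fderiv ℝ (locCot κ x.1) w η ξ.1)
      (fun w => chartForm I J h x.1 w ξ η) := fun x hx =>
    (H.localHodge x.1).primitive (domain_mono invariantPart_goodSet_subset (mem_domain hx))
      (hk x (hV.points_subset hx)) (H.locCot_eq_contraction (mem_domain hx))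
  have hVn : ∀ x ∈ mode.points V, ∀ᶠ y in 𝓝 x, y ∈ V := fun x hx =>
    hV.isOpen.mem_nhds (hV.points_subset hx)
  refine ⟨hV, fun x hx => (hs x hx).contMDiffWithinAt, fun x _ => rfl, fun u x hx => ?_,
    fun x hx X hX => ?_, fun x hx X Y hX hY => ?_⟩
  · have hz := mem_domain hx
    refine agree_of_jetEq hx ((H.localHodge x.1).equivariant (k := locCot κ x.1)
      (domain_mono invariantPart_goodSet_subset hz) u (H.locCot_eq_contraction hz)
      (H.locCot_eq_contraction (rot_mem_domain hV u hz))) (.of_forall fun y hy => ?_)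
    refine ⟨rfl, rfl, ?_, ?_⟩
    · rw [← tc_rotate u hy, locCot_apply κ (x := rotate u y) hy]
    · rw [cc_rotateCot u (q := κ y) hy, locCot_apply κ hy]
  -- Holomorphy splits into the base component, given by the projection, and the fibre component,
  -- given by `LocalHodge.holomorphic`.
  · have hxV := hV.points_subset hx
    have hzU := domain_mono invariantPart_goodSet_subset (mem_domain hx)
    have hxm := mem_chart_source E x.1
    have L := H.localHodge x.1
    have sX := (smoothAt_iff hxm).1 hX
    have sD : ContDiffAt ℝ ∞ (fderiv ℝ (locCot κ x.1)) (tc x.1 x) := (hk x hxV).fderiv_right (by simp)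
    have j1 := JetEq.subst
      (A := fun w => (ContinuousLinearMap.fst ℝ E E).comp (locEnd I x.1 w))
      (B := fun _ => (mulC E Complex.I).comp (ContinuousLinearMap.fst ℝ E E))
      (fun ξ => (L.proj _ hzU).apply_const ξ) (JetEq.refl sX)
    have j2 := JetEq.subst
      (A := fun w => (fderiv ℝ (locCot κ x.1) w).comp (locEnd I x.1 w))
      (B := fun w => Complex.I • fderiv ℝ (locCot κ x.1) w)
      (fun ξ => L.holomorphic hzU (hk x hxV) (hpr x hx) ξ) (JetEq.refl sX)
    refine vanishesAlong_of_jetEq (modelC E) (n := (⟨x.1, 0⟩ : Cotangent E M)) hx (j1.prodMk j2)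
      (Φ := fun w => (w.1, locCot κ x.1 w)) (contDiffAt_fst.prodMk (hk x hxV)) ?_
    filter_upwards [hVn x hx] with y hyV hy
    refine ⟨(mem_cc_source (q := κ y)).2 hy, cc_eq (hp y) hy, ?_⟩
    have e1 := hd y hyV x.1 hy (I y (X y))
    have e2 := hd y hyV x.1 hy (X y)
    have e3 : dC x.1 (κ y) (mulI (κ y) (mfderiv (modelT E) (modelC E) κ y (X y))) = _ :=
      dC_mulI (q := κ y) hy _
    rw [e2] at e3
    refine (map_sub (dC x.1 (κ y)) _ _).trans ?_
    rw [e1, e3, (tc x.1).left_inv (mem_tc_source.2 hy), ← locEnd_apply I hy]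
    rfl
  · have hxV := hV.points_subset hx
    have hxm := mem_chart_source E x.1
    have sX := (smoothAt_iff hxm).1 hX
    have sY := (smoothAt_iff hxm).1 hY
    -- In charts κ^*(dp ∧ dx) is the antisymmetrized derivative of k, so the claim is the primitive
    -- identity with the given fields in place of constant vectors.
    have j := JetEq.subst₂ (A := fun w => (pairing E).comp (fderiv ℝ (locCot κ x.1) w) -
        ((pairing E).comp (fderiv ℝ (locCot κ x.1) w)).flip) (B := fun w => chartForm I J h x.1 w)
      (fun ξ η => hpr x hx ξ η) (JetEq.refl sX) (JetEq.refl sY)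
    refine vanishes_of_jetEq hx j ?_
    filter_upwards [hVn x hx] with y hyV hy
    rw [canonicalForm_chart (q := κ y) hy, formI_chart I J h hy, hd y hyV x.1 hy, hd y hyV x.1 hy,
      (tc x.1).left_inv (mem_tc_source.2 hy)]
    rfl

end IsPolarizedHodgeOver

/-! ### Formal completions -/

lemma vanishes_formal_of_eventually {G : Type*} [NormedAddCommGroup G] [NormedSpace ℝ G]
    {f : ConjTangent E M → G} (hf : ∀ᶠ y in 𝓝 x, f y = 0) : Mode.formal.Vanishes f x := by
  intro k
  have h1 : f ∘ (tc x.1).symm =ᶠ[𝓝 (tc x.1 x)] fun _ => 0 :=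
    eventually_chart (modelT E) (mem_tc_source.2 (mem_chart_source E x.1)) hf
  refine ((h1.iteratedFDeriv ℝ k).eq_of_nhds).trans ?_
  simp

/-- A map to the cotangent bundle near the zero section gives a formal one. -/
theorem IsCotangentMap.toFormal (C : IsCotangentMap .actual W I J h κ) :
    IsCotangentMap .formal W I J h κ := by
  have hn : ∀ p ∈ Mode.formal.points W, ∀ᶠ y in 𝓝 p, y ∈ W := fun p hp =>
    C.nhd.isOpen.mem_nhds (C.nhd.zero_subset hp)
  -- A field smooth at p need not be smooth of all orders at a nearby y. At y it is replaced by a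
  -- coordinate field with the same value, which is harmless because the identities are pointwise in
  -- the field.
  have hc : ∀ (y : ConjTangent E M) (X : ∀ x : ConjTangent E M, TT x),
      coordField y.1 (dT y.1 y (X y)) y = X y := fun y X =>
    inverse_dT (mem_chart_source E y.1) _
  have hsm : ∀ (y : ConjTangent E M) (ξ : E × E), SmoothAt (coordField y.1 ξ) y := fun y ξ =>
    smoothAt_coordField (mem_chart_source E y.1) ξ
  refine ⟨C.nhd, C.smooth, C.proj_eq, fun u p hp => ?_, fun p hp X hX => ?_,
    fun p hp X Y hX hY => ?_⟩
  · have h1 : ∀ y ∈ W, κ (rotate u y) = rotateCot u (κ y) := fun y hy => C.equivariant u y hy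
    refine ⟨h1 p (C.nhd.zero_subset hp), fun g _ => vanishes_formal_of_eventually ?_⟩
    filter_upwards [hn p hp] with y hy
    rw [h1 y hy, sub_self]
  · intro g _
    refine vanishes_formal_of_eventually ?_
    filter_upwards [hn p hp] with y hy
    have h1 : mfderiv (modelT E) (modelC E) κ y (I y (coordField y.1 (dT y.1 y (X y)) y)) -
      mulI (κ y) (mfderiv (modelT E) (modelC E) κ y (coordField y.1 (dT y.1 y (X y)) y)) = 0 :=
      C.holomorphic y hy _ (hsm y (dT y.1 y (X y)))
    rw [hc] at h1
    rw [h1]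
    exact map_zero _
  · refine vanishes_formal_of_eventually ?_
    filter_upwards [hn p hp] with y hy
    have h1 := C.symplectic y hy _ _ (hsm y (dT y.1 y (X y))) (hsm y (dT y.1 y (Y y)))
    have h2 : canonicalForm (κ y) (mfderiv (modelT E) (modelC E) κ y
        (coordField y.1 (dT y.1 y (X y)) y)) (mfderiv (modelT E) (modelC E) κ y
        (coordField y.1 (dT y.1 y (Y y)) y)) - formI I J h y (coordField y.1 (dT y.1 y (X y)) y)
        (coordField y.1 (dT y.1 y (Y y)) y) = 0 := h1
    rw [hc, hc] at h2
    exact h2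

end Existence

end HodgeCotangent

end

theorem mainTheorem10 {E : Type*} [NormedAddCommGroup E] [NormedSpace ℂ E] [FiniteDimensional ℂ E]
    {M : Type*} [TopologicalSpace M] [T2Space M] [SigmaCompactSpace M] [ChartedSpace E M]
    [IsManifold 𝓘(ℂ, E) ω M]
    (U : Set (HodgeCotangent.ConjTangent E M))
    (I J : ∀ x : HodgeCotangent.ConjTangent E M,
      HodgeCotangent.TT x →L[ℝ] HodgeCotangent.TT x)
    (h : ∀ x : HodgeCotangent.ConjTangent E M,
      HodgeCotangent.TT x →L[ℝ] HodgeCotangent.TT x →L[ℝ] ℝ) :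
    (HodgeCotangent.IsPolarizedHodgeOver .formal U I J h →
      ∃ (V : Set (HodgeCotangent.ConjTangent E M))
        (κ : HodgeCotangent.ConjTangent E M → HodgeCotangent.Cotangent E M),
        HodgeCotangent.IsCotangentMap .formal V I J h κ ∧
        ∀ (V' : Set (HodgeCotangent.ConjTangent E M))
          (κ' : HodgeCotangent.ConjTangent E M → HodgeCotangent.Cotangent E M),
          HodgeCotangent.IsCotangentMap .formal V' I J h κ' →
          ∀ p ∈ HodgeCotangent.zeroSection E M, HodgeCotangent.Mode.formal.Agree κ' κ p) ∧
    (HodgeCotangent.IsPolarizedHodgeOver .actual U I J h →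
      ∃ (V : Set (HodgeCotangent.ConjTangent E M))
        (κ : HodgeCotangent.ConjTangent E M → HodgeCotangent.Cotangent E M),
        V ⊆ U ∧ HodgeCotangent.IsCotangentMap .actual V I J h κ ∧
        (∀ (V' : Set (HodgeCotangent.ConjTangent E M))
          (κ' : HodgeCotangent.ConjTangent E M → HodgeCotangent.Cotangent E M),
          V' ⊆ U → HodgeCotangent.IsCotangentMap .actual V' I J h κ' →
          ∀ p ∈ V ∩ V', κ' p = κ p) ∧
        (∀ (V' : Set (HodgeCotangent.ConjTangent E M))
          (κ' : HodgeCotangent.ConjTangent E M → HodgeCotangent.Cotangent E M),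
          HodgeCotangent.IsCotangentMap .formal V' I J h κ' →
          ∀ p ∈ HodgeCotangent.zeroSection E M, HodgeCotangent.Mode.formal.Agree κ' κ p)) := by
  refine ⟨fun H => ⟨_, _, H.isCotangentMap, fun V' κ' C' p hp => ?_⟩,
    fun H => ⟨_, _, HodgeCotangent.invariantPart_goodSet_subset, H.isCotangentMap,
      fun V' κ' hV' C' p hp => ?_, fun V' κ' C' p hp => ?_⟩⟩
  · exact HodgeCotangent.IsCotangentMap.agree H.nhd H.hodge.smooth_I H.hodge.smooth_J
      H.polarization.smooth H.isCotangentMap C' hp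
  · exact HodgeCotangent.IsCotangentMap.agree H.nhd H.hodge.smooth_I H.hodge.smooth_J
      H.polarization.smooth H.isCotangentMap C' ⟨hp, hV' hp.2⟩
  -- The actual map is also a formal one, so formal uniqueness identifies its jet.
  · exact HodgeCotangent.IsCotangentMap.agree H.nhd H.hodge.smooth_I H.hodge.smooth_J
      H.polarization.smooth H.isCotangentMap.toFormal C' hp
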